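/- **Setting.** Let $h:(\varrho_-,\varrho_+)\to\mathbb R$, $-\infty\le\varrho_-<0<\varrho_+\le+\infty$, be continuous and strictly increasing with $h(0)=0$ (so $h=\phi^{-1}$ for an increasing homeomorphism $\phi$ between open intervals containing $0$, $\phi(0)=0$), and let $g:\mathbb R\to\mathbb R$ be continuous with $g(0)=0$ and $g(x)x>0$ for $x\ne0$. Let $m\ge 0$, $0=t_0<s_0<t_1<\dots<t_m<s_m=L$, $\mu_0,\dots,\mu_m>0$, and let $a=\mu_i$ on $[t_i,s_i]$ and $a=0$ on $(s_i,t_{i+1})$. Put $\tau_i=s_i-t_i$ and $\varsigma_i=t_{i+1}-s_i$. Let $\lambda>0$. Solutions $(x,y):[0,L]\to\mathbb R\times(\varrho_-,\varrho_+)$ of $$x'=h(y),\qquad y'=-\lambda x-a(t)g(x)$$ are meant in the Carathéodory sense (absolutely continuous, equation satisfied a.e.); then $u=x$ solves $-(\phi(u'))'=\lambda u+a(t)g(u)$. **Energies and times.** Put $H(y)=\int_0^yh$, $G(x)=\int_0^xg$, $F_i(x)=\frac\lambda2x^2+\mu_iG(x)$, $\mathcal H_i(x,y)=H(y)+F_i(x)$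 and $H^*=\min\{\lim_{y\to\varrho_-}H(y),\lim_{y\to\varrho_+}H(y)\}$. Let $H_\pm^{-1}$ and $G_\pm^{-1}$ be the inverses of $H$ and $G$ restricted to arguments $\ge0$ ($+$) and $\le0$ ($-$). For $0<c<H^*$ let $x_-^i(c)<0<x_+^i(c)$ be the two solutions of $F_i(x)=c$. The times the orbit $\mathcal H_i=c$ needs to cross the quadrants are $$\mathcal T_{i,I}(c)=\int_0^{x_+^i(c)}\frac{dx}{h(H_+^{-1}(c-F_i(x)))},\qquad \mathcal T_{i,IV}(c)=\int_0^{x_+^i(c)}\frac{dx}{-h(H_-^{-1}(c-F_i(x)))},$$ $$\mathcal T_{i,III}(c)=\int_{x_-^i(c)}^0\frac{dx}{-h(H_-^{-1}(c-F_i(x)))},\qquad \mathcal T_{i,II}(c)=\int_{x_-^i(c)}^0\frac{dx}{h(H_+^{-1}(c-F_i(x)))},$$ and $\mathcal T_i(c)$ is their sum. Quadrants are ordered clockwise: $\kappa+1$ follows $\kappa$ in the cycle $I\to IV\to III\to II\to I$, and $\kappa-1$ precedes it. **Annuli.** For each $i$ fix $0<c_{1,i}<c_{2,i}<H^*$. Let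 $\mathcal A_{i,\kappa}$ be the set of the points $(x,y)$ of the closed quadrant $\kappa$ with $y\in(\varrho_-,\varrho_+)$ and $c_{1,i}\le\mathcal H_i(x,y)\le c_{2,i}$. **Hypotheses.** (1) *Twist.* For each $i\in\{0,\dots,m\}$ there are integers $0\le\alpha_i<\beta_i$ and a labelling $\{d_i,e_i\}=\{c_{1,i},c_{2,i}\}$ such that, for both $\kappa=I$ and $\kappa=III$, $$\mathcal T_{i,\kappa+1}(d_i)+\mathcal T_{i,\kappa+2}(d_i)+\alpha_i\mathcal T_i(d_i)>\tau_i,\qquad \mathcal T_{i,\kappa}(e_i)+\mathcal T_{i,\kappa+1}(e_i)+\beta_i\mathcal T_i(e_i)<\tau_i .$$ (2) *Gaps.* For $i\in\{0,\dots,m-1\}$ call a level $c$ compatible if $$0<c\le\min_{j\in\{i,i+1\}}c_{1,j},\qquad \min\{G(-\sqrt{2c/\lambda}),G(\sqrt{2c/\lambda})\}>\max_{j\in\{i,i+1\}}\frac{c_{2,j}-c}{\mu_j}.$$ For compatible $c$ and $n\in\{1,2\}$ put $x_{\ell,j}^n(c)=G_-^{-1}((c_{n,j}-c)/\mu_j)$,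 $x_{r,j}^n(c)=G_+^{-1}((c_{n,j}-c)/\mu_j)$ and $$\mathcal S^{n}_{i,II\to I}(c)=\int_{x_{\ell,i}^n(c)}^{x_{r,i+1}^n(c)}\frac{dx}{h(H_+^{-1}(c-\frac\lambda2x^2))},\qquad \mathcal S^{n}_{i,IV\to III}(c)=\int_{x_{\ell,i+1}^n(c)}^{x_{r,i}^n(c)}\frac{dx}{-h(H_-^{-1}(c-\frac\lambda2x^2))}.$$ For every $i\in\{0,\dots,m-1\}$ and both $\kappa\in\{I,III\}$ there are compatible levels $\hat d\ne\hat e$ (which may depend on $i$ and $\kappa$) with $$\mathcal S^{2}_{i,\kappa-1\to\kappa}(\hat e)\le\varsigma_i\le\mathcal S^{1}_{i,\kappa-1\to\kappa}(\hat d).$$ (3) *Boundary arcs.* Let $\kappa_0\in\{I,III\}$ and $\kappa_L\in\{II,IV\}$; let $r_0\subset\mathcal A_{0,\kappa_0}$ and $r_L\subset\mathcal A_{m,\kappa_L}$ be arcs (homeomorphic images of $[0,1]$), with one endpoint on the inner boundary $\mathcal H_0=c_{1,0}$, respectively $\mathcal H_m=c_{1,m}$, and the other on the outer boundary $\mathcal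 H_0=c_{2,0}$, respectively $\mathcal H_m=c_{2,m}$. **Conclusion.** The boundary value problem for the above system with $(x(0),y(0))\in r_0$ and $(x(L),y(L))\in r_L$ has at least $$2^m\prod_{i=0}^m(\beta_i-\alpha_i)$$ solutions on $[0,L]$. More precisely, call *admissible itinerary* a choice of entries $\kappa_i\in\{I,III\}$, exits $\omega_i\in\{II,IV\}$ and counters $j_i\in\{1,\dots,\beta_i-\alpha_i\}$, $i=0,\dots,m$, such that the entry $\kappa_0$ is the prescribed one, $\omega_m=\kappa_L$, and $\kappa_{i+1}=\omega_i+1$ for $i<m$ (that is, $II\to I$ and $IV\to III$ across the gaps). There are solutions of the boundary value problem, one for each admissible itinerary and pairwise different on $[0,L]$, such that the solution of the itinerary $(\kappa,\omega,j)$ satisfies: - for $0\le i\le m$, $(x,y)(t_i)\in\mathcal A_{i,\kappa_i}$ and $(x,y)(s_i)\in\mathcal A_{i,\omega_i}$; - if $\omega_i=\kappa_i-1$, then $x$ has exactly $2(\alpha_i+j_i)-1$ zeros in $(t_i,s_i)$ and $y$ has exactly $2(\alpha_i+j_i)$ zeros in $[t_i,s_i]$; if $\omega_i=\kappa_i+1$,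 then $x$ has exactly $2(\alpha_i+j_i)$ zeros in $(t_i,s_i)$ and $y$ has exactly $2(\alpha_i+j_i)+1$ zeros in $[t_i,s_i]$; - for $0\le i<m$, $x$ has exactly one zero in $[s_i,t_{i+1}]$, which lies in $(s_i,t_{i+1})$, and $y$ has no zero in $[s_i,t_{i+1}]$. -/

import Mathlib

open Set MeasureTheory

namespace SturmLiouville

/-- The four quadrants of the plane. -/
inductive Quadrant : Type
  | I
  | II
  | III
  | IV

namespace Quadrant

/-- The quadrant `κ + 1` that follows `κ` in the clockwise order `I → IV → III → II → I`. -/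
def next : Quadrant → Quadrant
  | I => IV
  | IV => III
  | III => II
  | II => I

/-- The quadrant `κ - 1` that precedes `κ` in the clockwise order. -/
def prev : Quadrant → Quadrant
  | IV => I
  | III => IV
  | II => III
  | I => II

/-- The closed quadrant as a set of points `(x, y)`. -/
def carrier : Quadrant → Set (ℝ × ℝ)
  | I => {z | 0 ≤ z.1 ∧ 0 ≤ z.2}
  | II => {z | z.1 ≤ 0 ∧ 0 ≤ z.2}
  | III => {z | z.1 ≤ 0 ∧ z.2 ≤ 0}
  | IV => {z | 0 ≤ z.1 ∧ z.2 ≤ 0}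

end Quadrant

/-- The data of the switched planar system `x' = h(y)`, `y' = -lam x - a(t) g(x)` on `[0, L]`,
where `a` takes the value `μ i > 0` on `[t i, s i]`, `i = 0, …, m`, and vanishes on the gaps
`(s i, t (i+1))`. The function `h` lives on the open interval `(ρm, ρp)`, possibly unbounded. -/
structure SwitchedSystem (m : ℕ) where
  lam : ℝ
  L : ℝ
  ρm : EReal
  ρp : EReal
  h : ℝ → ℝ
  g : ℝ → ℝ
  t : Fin (m + 1) → ℝ
  s : Fin (m + 1) → ℝ
  μ : Fin (m + 1) → ℝ
  ρm_neg : ρm < 0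
  ρp_pos : 0 < ρp
  h_continuousOn : ContinuousOn h {y : ℝ | ρm < (y : EReal) ∧ (y : EReal) < ρp}
  h_strictMonoOn : StrictMonoOn h {y : ℝ | ρm < (y : EReal) ∧ (y : EReal) < ρp}
  h_zero : h 0 = 0
  g_continuous : Continuous g
  g_zero : g 0 = 0
  g_sign : ∀ x : ℝ, x ≠ 0 → 0 < g x * x
  t_zero : t 0 = 0
  s_last : s (Fin.last m) = L
  t_lt_s : ∀ i, t i < s i
  s_lt_t : ∀ i : Fin m, s i.castSucc < t i.succ
  μ_pos : ∀ i, 0 < μ i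

namespace SwitchedSystem

variable {m : ℕ} (P : SwitchedSystem m)

/-- The open interval on which `h` is defined. -/
def J : Set ℝ := {y : ℝ | P.ρm < (y : EReal) ∧ (y : EReal) < P.ρp}

/-- The piecewise constant weight. -/
noncomputable def a (r : ℝ) : ℝ :=
  ∑ i, (Icc (P.t i) (P.s i)).indicator (fun _ => P.μ i) r

/-- The length `τ i` of `[t i, s i]`. -/
def tau (i : Fin (m + 1)) : ℝ := P.s i - P.t i

/-- The length `ς i` of the gap between `s i` and `t (i+1)`. -/
def gap (i : Fin m) : ℝ := P.t i.succ - P.s i.castSucc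

/-! ### Primitives and Hamiltonians -/

noncomputable def H (y : ℝ) : ℝ := ∫ r in (0 : ℝ)..y, P.h r

noncomputable def G (x : ℝ) : ℝ := ∫ r in (0 : ℝ)..x, P.g r

noncomputable def F (i : Fin (m + 1)) (x : ℝ) : ℝ := P.lam / 2 * x ^ 2 + P.μ i * P.G x

/-- The Hamiltonian of the nonlinear system `x' = h(y)`, `y' = -lam x - μ i g(x)`. -/
noncomputable def Ham (i : Fin (m + 1)) (z : ℝ × ℝ) : ℝ := P.H z.2 + P.F i z.1

/-- `H* = min {H(ρm), H(ρp)}`, in the extended reals. As `H` is monotone on either side of `0`, its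
limits at the ends of `J` are suprema. -/
noncomputable def Hstar : EReal :=
  min (⨆ y ∈ P.J ∩ Iic 0, (P.H y : EReal)) (⨆ y ∈ P.J ∩ Ici 0, (P.H y : EReal))

/-! ### Inverse branches (each is only used at values that are attained on the branch) -/

/-- The inverse of `H` restricted to `[0, ρp)`. -/
noncomputable def HinvPos : ℝ → ℝ := Function.invFunOn P.H (P.J ∩ Ici 0)

/-- The inverse of `H` restricted to `(ρm, 0]`. -/
noncomputable def HinvNeg : ℝ → ℝ := Function.invFunOn P.H (P.J ∩ Iic 0)

/-- The inverse of `G` restricted to `[0, ∞)`. -/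
noncomputable def GinvPos : ℝ → ℝ := Function.invFunOn P.G (Ici 0)

/-- The inverse of `G` restricted to `(-∞, 0]`. -/
noncomputable def GinvNeg : ℝ → ℝ := Function.invFunOn P.G (Iic 0)

/-- The point `x₊(c) > 0` with `F i (x₊(c)) = c` (unique for `lam > 0` and `c > 0`). -/
noncomputable def xPos (i : Fin (m + 1)) (c : ℝ) : ℝ := Function.invFunOn (P.F i) (Ici 0) c

/-- The point `x₋(c) < 0` with `F i (x₋(c)) = c` (unique for `lam > 0` and `c > 0`). -/
noncomputable def xNeg (i : Fin (m + 1)) (c : ℝ) : ℝ := Function.invFunOn (P.F i) (Iic 0) c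

/-! ### Crossing times of the nonlinear systems -/

/-- The time that the orbit `Ham i = c` needs to cross a given quadrant. -/
noncomputable def T (i : Fin (m + 1)) : Quadrant → ℝ → ℝ
  | .I, c => ∫ x in (0 : ℝ)..P.xPos i c, 1 / P.h (P.HinvPos (c - P.F i x))
  | .IV, c => ∫ x in (0 : ℝ)..P.xPos i c, 1 / -P.h (P.HinvNeg (c - P.F i x))
  | .III, c => ∫ x in P.xNeg i c..0, 1 / -P.h (P.HinvNeg (c - P.F i x))
  | .II, c => ∫ x in P.xNeg i c..0, 1 / P.h (P.HinvPos (c - P.F i x))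

/-- The period of the orbit `Ham i = c`. -/
noncomputable def period (i : Fin (m + 1)) (c : ℝ) : ℝ :=
  P.T i .I c + P.T i .IV c + P.T i .III c + P.T i .II c

/-- The twist condition on the `i`-th annulus for orbits that start in the quadrant `κ`. -/
def Twist (i : Fin (m + 1)) (κ : Quadrant) (α β : ℕ) (d e : ℝ) : Prop :=
  P.tau i < P.T i κ.next d + P.T i κ.next.next d + α * P.period i d ∧
  P.T i κ e + P.T i κ.next e + β * P.period i e < P.tau i

/-! ### Transition times of the `x`-linear system `x' = h(y)`, `y' = -lam x`, for `lam > 0` -/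

/-- The abscissa `x > 0` of the points where `H(y) + lam x² / 2 = c` meets `Ham i = b`. -/
noncomputable def xr (i : Fin (m + 1)) (b c : ℝ) : ℝ := P.GinvPos ((b - c) / P.μ i)

/-- The abscissa `x < 0` of the points where `H(y) + lam x² / 2 = c` meets `Ham i = b`. -/
noncomputable def xl (i : Fin (m + 1)) (b c : ℝ) : ℝ := P.GinvNeg ((b - c) / P.μ i)

/-- The time needed along the level line `H(y) + lam x² / 2 = c`, in the upper half-plane, from the
left intersection with `Ham i = b i` to the right intersection with `Ham (i+1) = b (i+1)`. -/
noncomputable def SUpper (b : Fin (m + 1) → ℝ) (i : Fin m) (c : ℝ) : ℝ :=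
  ∫ x in P.xl i.castSucc (b i.castSucc) c..P.xr i.succ (b i.succ) c,
    1 / P.h (P.HinvPos (c - P.lam / 2 * x ^ 2))

/-- The time needed along the level line `H(y) + lam x² / 2 = c`, in the lower half-plane, from the
right intersection with `Ham i = b i` to the left intersection with `Ham (i+1) = b (i+1)`. -/
noncomputable def SLower (b : Fin (m + 1) → ℝ) (i : Fin m) (c : ℝ) : ℝ :=
  ∫ x in P.xl i.succ (b i.succ) c..P.xr i.castSucc (b i.castSucc) c,
    1 / -P.h (P.HinvNeg (c - P.lam / 2 * x ^ 2))

/-- The level `c` is compatible with the annuli `c₁ j ≤ Ham j ≤ c₂ j`, `j = i, i + 1`: the closed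
orbit `H(y) + lam x² / 2 = c` crosses both. -/
def Compatible (c₁ c₂ : Fin (m + 1) → ℝ) (i : Fin m) (c : ℝ) : Prop :=
  0 < c ∧ c ≤ min (c₁ i.castSucc) (c₁ i.succ) ∧
  max ((c₂ i.castSucc - c) / P.μ i.castSucc) ((c₂ i.succ - c) / P.μ i.succ) <
    min (P.G (-Real.sqrt (2 * c / P.lam))) (P.G (Real.sqrt (2 * c / P.lam)))

/-- The linked twist inequalities on the `i`-th gap for a transition time `S b i c`. -/
def LinkedTwist (S : (Fin (m + 1) → ℝ) → Fin m → ℝ → ℝ) (c₁ c₂ : Fin (m + 1) → ℝ)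
    (i : Fin m) : Prop :=
  ∃ d e : ℝ, d ≠ e ∧ P.Compatible c₁ c₂ i d ∧ P.Compatible c₁ c₂ i e ∧
    S c₂ i e ≤ P.gap i ∧ P.gap i ≤ S c₁ i d

/-! ### Annuli, arcs, solutions -/

/-- The part in the closed quadrant `κ` of the annulus `c₁ i ≤ Ham i ≤ c₂ i`. -/
def annulus (c₁ c₂ : Fin (m + 1) → ℝ) (i : Fin (m + 1)) (κ : Quadrant) : Set (ℝ × ℝ) :=
  {z | z ∈ κ.carrier ∧ z.2 ∈ P.J ∧ c₁ i ≤ P.Ham i z ∧ P.Ham i z ≤ c₂ i}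

/-- `r` is an arc (a homeomorphic image of `[0, 1]`) in the annulus part `annulus c₁ c₂ i κ` that
links the inner boundary `Ham i = c₁ i` to the outer boundary `Ham i = c₂ i`. -/
def IsLinkingArc (c₁ c₂ : Fin (m + 1) → ℝ) (i : Fin (m + 1)) (κ : Quadrant)
    (r : Set (ℝ × ℝ)) : Prop :=
  ∃ γ : C(unitInterval, ℝ × ℝ), Function.Injective γ ∧ range γ = r ∧
    r ⊆ P.annulus c₁ c₂ i κ ∧ P.Ham i (γ 0) = c₁ i ∧ P.Ham i (γ 1) = c₂ i

/-- `u = (x, y)` solves the switched system on `[0, L]` in the Carathéodory sense. -/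
def IsSolution (u : ℝ → ℝ × ℝ) : Prop :=
  AbsolutelyContinuousOnInterval (fun r => (u r).1) 0 P.L ∧
  AbsolutelyContinuousOnInterval (fun r => (u r).2) 0 P.L ∧
  (∀ r ∈ Icc 0 P.L, (u r).2 ∈ P.J) ∧
  ∀ᵐ r, r ∈ Icc 0 P.L →
    HasDerivAt (fun q => (u q).1) (P.h (u r).2) r ∧
    HasDerivAt (fun q => (u q).2) (-P.lam * (u r).1 - P.a r * P.g (u r).1) r

/-- `u` solves the boundary value problem with boundary conditions `u(0) ∈ r₀`, `u(L) ∈ rL`. -/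
def IsBVPSolution (r₀ rL : Set (ℝ × ℝ)) (u : ℝ → ℝ × ℝ) : Prop :=
  P.IsSolution u ∧ u 0 ∈ r₀ ∧ u P.L ∈ rL

end SwitchedSystem

/-- An admissible itinerary: on `[t i, s i]` it goes from the quadrant `entry i ∈ {I, III}` to the
quadrant `exit i ∈ {II, IV}` (both choices being allowed), with a counter `lap i` between `1` and
`β i - α i`, and on the `i`-th gap it goes from `II` to `I` or from `IV` to `III`. The first
entry `κ₀` and the last exit `κL` are prescribed. -/
structure Itinerary (m : ℕ) (κ₀ κL : Quadrant) (α β : Fin (m + 1) → ℕ) where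
  entry : Fin (m + 1) → Quadrant
  exit : Fin (m + 1) → Quadrant
  lap : Fin (m + 1) → ℕ
  entry_mem : ∀ i, entry i = .I ∨ entry i = .III
  exit_mem : ∀ i, exit i = .II ∨ exit i = .IV
  entry_zero : entry 0 = κ₀
  exit_last : exit (Fin.last m) = κL
  link : ∀ i : Fin m, entry i.succ = (exit i.castSucc).next
  lap_pos : ∀ i, 1 ≤ lap i
  lap_le : ∀ i, lap i ≤ β i - α i

/-- The number of zeros of the function `f` in the set `s`. -/
noncomputable def zeros (f : ℝ → ℝ) (s : Set ℝ) : ℕ∞ := {r ∈ s | f r = 0}.encard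

/-- The solution `u = (x, y)` follows the itinerary `ι`: it visits the prescribed pieces of the
annuli at the times `t i` and `s i`, and the two components have the corresponding numbers of
zeros on the intervals `[t i, s i]` and on the gaps between them. -/
def SwitchedSystem.Follows {m : ℕ} (P : SwitchedSystem m) (c₁ c₂ : Fin (m + 1) → ℝ)
    {κ₀ κL : Quadrant} {α β : Fin (m + 1) → ℕ} (ι : Itinerary m κ₀ κL α β)
    (u : ℝ → ℝ × ℝ) : Prop :=
  (∀ i, u (P.t i) ∈ P.annulus c₁ c₂ i (ι.entry i) ∧
    u (P.s i) ∈ P.annulus c₁ c₂ i (ι.exit i) ∧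
    (ι.exit i = (ι.entry i).prev →
      zeros (fun r => (u r).1) (Ioo (P.t i) (P.s i)) = ((2 * (α i + ι.lap i) - 1 : ℕ) : ℕ∞) ∧
      zeros (fun r => (u r).2) (Icc (P.t i) (P.s i)) = ((2 * (α i + ι.lap i) : ℕ) : ℕ∞)) ∧
    (ι.exit i = (ι.entry i).next →
      zeros (fun r => (u r).1) (Ioo (P.t i) (P.s i)) = ((2 * (α i + ι.lap i) : ℕ) : ℕ∞) ∧
      zeros (fun r => (u r).2) (Icc (P.t i) (P.s i)) = ((2 * (α i + ι.lap i) + 1 : ℕ) : ℕ∞))) ∧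
  ∀ i : Fin m,
    zeros (fun r => (u r).1) (Ioo (P.s i.castSucc) (P.t i.succ)) = 1 ∧
    zeros (fun r => (u r).1) (Icc (P.s i.castSucc) (P.t i.succ)) = 1 ∧
    zeros (fun r => (u r).2) (Icc (P.s i.castSucc) (P.t i.succ)) = 0

end SturmLiouville

/-! On every interval where `a` is constant the system is autonomous and Hamiltonian with closed
level lines, so a solution amounts to a level and a clockwise angle that increases with time. The
proof stretches paths. Take a path in the entry quadrant of annulus `i` from the inner to the outer
boundary and follow its points for the time `tau i`. By the twist condition, on one boundary even
the most advanced starting point has not reached a given target quadrant, while on the other even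
the most delayed one has left it. By the intermediate value theorem a subpath ends inside that
quadrant and joins its two axes (`exists_twist`). The targets are the half-turns numbered from `l +
1 + 2α` to `l + 2β`, where `l` is the half-turn of the start; their parity alternates between the
two exits, which leaves `β - α` counters for each exit.

A path joining the axes in an exit quadrant is then followed across the gap. The levels of `H(y) +
lam x² / 2` along it run through both levels of the linked twist condition: on one of them the
orbits are too slow to get beyond the inner boundary of the next annulus, on the other they are fast
enough to reach the outer one. Again a subpath ends in the next entry quadrant, now joining inner to
outer boundary (`exists_gap`). Nested subpaths thus carry `r₀` to a path that joins the axes in the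
last exit quadrant, and this path meets `rL` by the Poincaré–Miranda theorem (`exists_inter`).
Quadrants and zero counts recover the itinerary, so different itineraries give different solutions
(`Follows.unique`).

Since `h` and `g` are merely continuous, no flow is invoked: solutions are written down as `(X, Y)`
at the angle `Θ`, the inverse of the travel time `N`. The usual travel time integral is singular at
turning points. On a level `E = A(x) + B(y)` of `x' = q(y)`, `y' = -p(x)` one has instead `dt = (B
dx / q(y) - A dy / p(x)) / E`, where `A / p` and `B / q` extend continuously by `0`; this makes the
time jointly continuous in level and angle. Finally `h` is made constant outside an interval that
contains all relevant orbits (`Trunc`), so that every system lives on the whole plane. -/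

namespace SturmLiouville

open Filter Topology Real

/-! ### Profiles: the signed primitive and its global inverse. -/

/-- A continuous function with the sign of its argument, whose absolute value has a primitive `sp`
that maps `ℝ` onto `ℝ`, and for which `sp / f` is continuous. -/
structure Profile where
  f : ℝ → ℝ
  cont : Continuous f
  zero : f 0 = 0
  sign : ∀ x, x ≠ 0 → 0 < f x * x
  surj : Function.Surjective fun x : ℝ => ∫ u in (0 : ℝ)..x, |f u|
  quot : Continuous fun x : ℝ => (∫ u in (0 : ℝ)..x, |f u|) / f x

namespace Profile

variable (p : Profile)

theorem ext_f {p q : Profile} (h : p.f = q.f) : p = q := by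
  cases p; cases q; congr

theorem pos {x : ℝ} (hx : 0 < x) : 0 < p.f x :=
  pos_of_mul_pos_left (p.sign x hx.ne') hx.le

theorem neg {x : ℝ} (hx : x < 0) : p.f x < 0 := by
  have := p.sign x hx.ne
  nlinarith

theorem ne_zero {x : ℝ} (hx : x ≠ 0) : p.f x ≠ 0 := fun h => by
  have := p.sign x hx
  simp [h] at this

/-- The primitive of `|f|` that vanishes at `0`, that is, the primitive of `f` with the sign of its
argument. -/
noncomputable def sp (x : ℝ) : ℝ := ∫ u in (0 : ℝ)..x, |p.f u|

theorem hasDerivAt_sp (x : ℝ) : HasDerivAt p.sp |p.f x| x :=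
  intervalIntegral.integral_hasDerivAt_right (p.cont.abs.intervalIntegrable _ _)
    (p.cont.abs.stronglyMeasurableAtFilter _ _) p.cont.abs.continuousAt

theorem continuous_sp : Continuous p.sp :=
  continuous_iff_continuousAt.2 fun x => (p.hasDerivAt_sp x).continuousAt

@[simp] theorem sp_zero : p.sp 0 = 0 := by simp [sp]

theorem strictMono_sp : StrictMono p.sp := by
  have h1 : StrictMonoOn p.sp (Iic 0) := by
    apply strictMonoOn_of_deriv_pos (convex_Iic 0) p.continuous_sp.continuousOn
    intro x hx
    rw [interior_Iic] at hx
    rw [(p.hasDerivAt_sp x).deriv]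
    exact abs_pos.2 (p.ne_zero (ne_of_lt hx))
  have h2 : StrictMonoOn p.sp (Ici 0) := by
    apply strictMonoOn_of_deriv_pos (convex_Ici 0) p.continuous_sp.continuousOn
    intro x hx
    rw [interior_Ici] at hx
    rw [(p.hasDerivAt_sp x).deriv]
    exact abs_pos.2 (p.ne_zero (ne_of_gt hx))
  exact StrictMonoOn.Iic_union_Ici h1 h2

/-- The inverse of `sp`. -/
noncomputable def inv : ℝ → ℝ := (p.strictMono_sp.orderIsoOfSurjective p.sp p.surj).symm

@[simp] theorem sp_inv (e : ℝ) : p.sp (p.inv e) = e :=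
  (p.strictMono_sp.orderIsoOfSurjective p.sp p.surj).apply_symm_apply e

@[simp] theorem inv_sp (x : ℝ) : p.inv (p.sp x) = x :=
  (p.strictMono_sp.orderIsoOfSurjective p.sp p.surj).symm_apply_apply x

theorem strictMono_inv : StrictMono p.inv :=
  (p.strictMono_sp.orderIsoOfSurjective p.sp p.surj).symm.strictMono

@[fun_prop]
theorem continuous_inv : Continuous p.inv :=
  (p.strictMono_sp.orderIsoOfSurjective p.sp p.surj).symm.continuous

@[simp] theorem inv_zero : p.inv 0 = 0 := by
  simpa using p.inv_sp 0

theorem inv_pos {e : ℝ} (he : 0 < e) : 0 < p.inv e := by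
  simpa using p.strictMono_inv he

theorem inv_nonneg {e : ℝ} (he : 0 ≤ e) : 0 ≤ p.inv e := by
  simpa using p.strictMono_inv.monotone he

theorem inv_eq_zero {e : ℝ} : p.inv e = 0 ↔ e = 0 := by
  rw [← p.strictMono_inv.injective.eq_iff (a := e), inv_zero]

theorem hasDerivAt_inv {e : ℝ} (he : e ≠ 0) : HasDerivAt p.inv |p.f (p.inv e)|⁻¹ e :=
  HasDerivAt.of_local_left_inverse p.continuous_inv.continuousAt (p.hasDerivAt_sp _)
    (abs_ne_zero.2 (p.ne_zero (mt p.inv_eq_zero.1 he)))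
    (Eventually.of_forall p.sp_inv)

theorem sp_nonneg {x : ℝ} (hx : 0 ≤ x) : 0 ≤ p.sp x := by
  simpa using p.strictMono_sp.monotone hx

theorem sp_nonpos {x : ℝ} (hx : x ≤ 0) : p.sp x ≤ 0 := by
  simpa using p.strictMono_sp.monotone hx

theorem sp_of_nonneg {x : ℝ} (hx : 0 ≤ x) : p.sp x = ∫ u in (0 : ℝ)..x, p.f u := by
  refine intervalIntegral.integral_congr fun u hu => ?_
  rw [uIcc_of_le hx] at hu
  rcases hu.1.eq_or_lt with h | h
  · simp [← h, p.zero]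
  · exact abs_of_pos (p.pos h)

theorem sp_of_nonpos {x : ℝ} (hx : x ≤ 0) : p.sp x = -∫ u in (0 : ℝ)..x, p.f u := by
  rw [← intervalIntegral.integral_neg]
  refine intervalIntegral.integral_congr fun u hu => ?_
  rw [uIcc_of_ge hx] at hu
  rcases hu.2.eq_or_lt with h | h
  · simp [h, p.zero]
  · exact abs_of_neg (p.neg h)

theorem abs_sp (x : ℝ) : |p.sp x| = ∫ u in (0 : ℝ)..x, p.f u := by
  rcases le_total 0 x with hx | hx
  · rw [abs_of_nonneg (p.sp_nonneg hx), p.sp_of_nonneg hx]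
  · rw [abs_of_nonpos (p.sp_nonpos hx), p.sp_of_nonpos hx, neg_neg]

theorem continuous_quot : Continuous fun x => p.sp x / p.f x := p.quot

theorem integral_abs_ref (f : ℝ → ℝ) (x : ℝ) :
    ∫ u in (0 : ℝ)..x, |-f (-u)| = -∫ u in (0 : ℝ)..-x, |f u| := by
  simp only [abs_neg]
  rw [intervalIntegral.integral_comp_neg (fun u => |f u|), neg_zero,
    intervalIntegral.integral_symm]

/-- The reflected profile `x ↦ -f (-x)`. -/
def ref : Profile where
  f x := -p.f (-x)
  cont := (p.cont.comp continuous_neg).neg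
  zero := by simp [p.zero]
  sign x hx := by
    have := p.sign (-x) (neg_ne_zero.2 hx)
    linarith
  surj e := by
    obtain ⟨x, hx⟩ := p.surj (-e)
    refine ⟨-x, ?_⟩
    simp only [integral_abs_ref, neg_neg] at hx ⊢
    rw [hx, neg_neg]
  quot := by
    have := p.quot.comp continuous_neg
    refine this.congr fun x => ?_
    simp only [Function.comp, integral_abs_ref, neg_div_neg_eq]

@[simp] theorem ref_ref : p.ref.ref = p := ext_f (by ext x; simp [ref])

theorem ref_f (x : ℝ) : p.ref.f x = -p.f (-x) := rfl

theorem ref_sp (x : ℝ) : p.ref.sp x = -p.sp (-x) := integral_abs_ref p.f x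

theorem ref_inv (e : ℝ) : p.ref.inv e = -p.inv (-e) := by
  apply p.ref.strictMono_sp.injective
  simp [ref_sp]

end Profile

/-! ### Planar Hamiltonian systems and the travel time within a quadrant. -/

/-- The planar system `x' = q(y)`, `y' = -p(x)`. -/
structure Planar where
  p : Profile
  q : Profile

namespace Planar

variable (S : Planar)

/-- The system in the coordinates `(-y, x)`. -/
def rot : Planar := ⟨S.q.ref, S.p⟩

/-- The system in the coordinates `(x, y)` exchanged, with time reversed. -/
def swap : Planar := ⟨S.q, S.p⟩

@[simp] theorem rot_four : S.rot.rot.rot.rot = S := by simp [rot]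

/-- Time from the `y`-axis to the point of the level `E` with abscissa `u`, in the first
quadrant. -/
noncomputable def V (E u : ℝ) : ℝ :=
  -- On the level, `S.p.sp x + S.q.sp y = E`, so `dt` splits as `E⁻¹ (sp_q dx / q - sp_p dy / p)`.
  -- Both integrands are continuous, in contrast to `1 / q`, which blows up at `y = 0`.
  E⁻¹ * ((∫ r in (0 : ℝ)..u, S.q.sp (S.q.inv (E - S.p.sp r)) / S.q.f (S.q.inv (E - S.p.sp r))) +
    ((∫ r in (0 : ℝ)..S.q.inv E,
        S.p.sp (S.p.inv (E - S.q.sp r)) / S.p.f (S.p.inv (E - S.q.sp r))) -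
      ∫ r in (0 : ℝ)..S.q.inv (E - S.p.sp u),
        S.p.sp (S.p.inv (E - S.q.sp r)) / S.p.f (S.p.inv (E - S.q.sp r))))

/-- Time to cross the first quadrant on the level `E`. -/
noncomputable def Q (E : ℝ) : ℝ := S.V E (S.p.inv E)

@[simp] theorem V_zero (E : ℝ) : S.V E 0 = 0 := by simp [V]

/-- The quotient `sp / f` is continuous through the zero of `f`, so this is a parametric primitive
of a jointly continuous function. The integral in the other variable is the same statement for
`swap`. -/
theorem continuous_integrand {X : Type*} [TopologicalSpace X] {s : X → ℝ} {E : X → ℝ}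
    (hE : Continuous E) (hs : Continuous s) :
    Continuous fun x => ∫ r in (0 : ℝ)..s x,
      S.q.sp (S.q.inv (E x - S.p.sp r)) / S.q.f (S.q.inv (E x - S.p.sp r)) := by
  have h : Continuous (Function.uncurry fun (e : ℝ) (r : ℝ) =>
      S.q.sp (S.q.inv (e - S.p.sp r)) / S.q.f (S.q.inv (e - S.p.sp r))) :=
    S.q.continuous_quot.comp (S.q.continuous_inv.comp
      (continuous_fst.sub (S.p.continuous_sp.comp continuous_snd)))
  exact (intervalIntegral.continuous_parametric_primitive_of_continuous (a₀ := 0) h).comp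
    (hE.prodMk hs)

theorem continuousOn_V :
    ContinuousOn (fun z : ℝ × ℝ => S.V z.1 z.2) (Ioi 0 ×ˢ univ) := by
  unfold V
  refine ContinuousOn.mul (continuousOn_fst.inv₀ fun z hz => (ne_of_gt hz.1)) ?_
  refine Continuous.continuousOn ?_
  have hs := S.p.continuous_sp
  refine (S.continuous_integrand continuous_fst continuous_snd).add
    ((S.swap.continuous_integrand continuous_fst (by fun_prop)).sub
    (S.swap.continuous_integrand continuous_fst (by fun_prop)))

/-- The two integrals contribute `sp_q / q` and `sp_p / q`, the factor `p` cancelling in the chain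
rule; their sum is `E / q`, so the regularised formula does have the speed of the orbit. -/
theorem hasDerivAt_V {E u : ℝ} (hE : 0 < E) (h0 : 0 < u) (hu : u < S.p.inv E) :
    HasDerivAt (S.V E) (S.q.f (S.q.inv (E - S.p.sp u)))⁻¹ u := by
  have hu' : S.p.sp u < E := by simpa using S.p.strictMono_sp hu
  have hu0 : 0 < S.p.sp u := by simpa using S.p.strictMono_sp h0
  have hy : 0 < S.q.inv (E - S.p.sp u) := S.q.inv_pos (by linarith)
  have hqy := S.q.pos hy
  have hpu := S.p.pos h0
  have c1 : Continuous fun r => S.q.sp (S.q.inv (E - S.p.sp r)) / S.q.f (S.q.inv (E - S.p.sp r)) :=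
    S.q.continuous_quot.comp (S.q.continuous_inv.comp (continuous_const.sub S.p.continuous_sp))
  have c2 : Continuous fun r => S.p.sp (S.p.inv (E - S.q.sp r)) / S.p.f (S.p.inv (E - S.q.sp r)) :=
    S.p.continuous_quot.comp (S.p.continuous_inv.comp (continuous_const.sub S.q.continuous_sp))
  have d1 := c1.integral_hasStrictDerivAt 0 u |>.hasDerivAt
  have d2 := c2.integral_hasStrictDerivAt 0 (S.q.inv (E - S.p.sp u)) |>.hasDerivAt
  have d3 := (S.q.hasDerivAt_inv (e := E - S.p.sp u) (by linarith)).comp u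
    ((S.p.hasDerivAt_sp u).const_sub E)
  have d4 := (d1.add ((d2.comp u d3).const_sub
    (∫ r in (0 : ℝ)..S.q.inv E,
        S.p.sp (S.p.inv (E - S.q.sp r)) / S.p.f (S.p.inv (E - S.q.sp r))))).const_mul E⁻¹
  refine d4.congr_deriv ?_
  simp only [Profile.sp_inv, sub_sub_cancel, Profile.inv_sp, abs_of_pos hqy, abs_of_pos hpu]
  field_simp
  ring

theorem continuousOn_V_right {E : ℝ} (hE : 0 < E) : Continuous (S.V E) := by
  have := S.continuousOn_V.comp_continuous (f := fun u : ℝ => (E, u)) (by fun_prop)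
    (fun u => ⟨hE, trivial⟩)
  exact this

/-- Times as integrals along level lines. -/
theorem V_eq_integral {E u : ℝ} (hE : 0 < E) (h0 : 0 ≤ u) (hu : u ≤ S.p.inv E) :
    IntervalIntegrable (fun r => 1 / S.q.f (S.q.inv (E - S.p.sp r))) volume 0 u ∧
    S.V E u = ∫ r in (0 : ℝ)..u, 1 / S.q.f (S.q.inv (E - S.p.sp r)) := by
  have hd : ∀ r ∈ Ioo 0 u, HasDerivAt (S.V E) (1 / S.q.f (S.q.inv (E - S.p.sp r))) r := by
    intro r hr
    rw [one_div]
    exact S.hasDerivAt_V hE hr.1 (hr.2.trans_le hu)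
  have hpos : ∀ r ∈ Ioo 0 u, 0 ≤ 1 / S.q.f (S.q.inv (E - S.p.sp r)) := by
    intro r hr
    have : S.p.sp r < E := by simpa using S.p.strictMono_sp (hr.2.trans_le hu)
    exact one_div_nonneg.2 (S.q.pos (S.q.inv_pos (by linarith))).le
  have hc := (S.continuousOn_V_right hE)
  -- Integrability of the singular integrand comes for free: it is the nonnegative derivative of a
  -- function that is continuous up to the endpoints.
  have hi : IntervalIntegrable (fun r => 1 / S.q.f (S.q.inv (E - S.p.sp r))) volume 0 u := by
    apply intervalIntegral.intervalIntegrable_deriv_of_nonneg hc.continuousOn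
    · simpa [h0] using hd
    · simpa [h0] using hpos
  refine ⟨hi, ?_⟩
  rw [intervalIntegral.integral_eq_sub_of_hasDerivAt_of_le h0 hc.continuousOn hd hi]
  simp

/-- The quarter time as a function of the angle. -/
noncomputable def W (E φ : ℝ) : ℝ := S.V E (S.p.inv (E * sin φ ^ 2))

@[simp] theorem W_zero (E : ℝ) : S.W E 0 = 0 := by simp [W]

@[simp] theorem W_pi_div_two (E : ℝ) : S.W E (π / 2) = S.Q E := by simp [W, Q]

theorem continuousOn_W :
    ContinuousOn (fun z : ℝ × ℝ => S.W z.1 z.2) (Ioi 0 ×ˢ univ) := by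
  unfold W
  refine S.continuousOn_V.comp (f := fun z : ℝ × ℝ => (z.1, S.p.inv (z.1 * sin z.2 ^ 2))) ?_ ?_
  · fun_prop
  · exact fun z hz => ⟨hz.1, trivial⟩

/-- Reversal of time exchanges the roles of the two axes. -/
theorem W_swap (E φ : ℝ) : S.W E φ = S.Q E - S.swap.W E (π / 2 - φ) := by
  have h1 : E - E * sin φ ^ 2 = E * sin (π / 2 - φ) ^ 2 := by
    rw [sin_pi_div_two_sub, cos_sq']; ring
  have h2 : E - E * sin (π / 2 - φ) ^ 2 = E * sin φ ^ 2 := by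
    rw [sin_pi_div_two_sub, cos_sq']; ring
  simp only [W, Q, V, swap, Profile.sp_inv, h1, h2, sub_self, Profile.inv_zero,
    intervalIntegral.integral_same]
  ring

theorem Q_swap (E : ℝ) : S.swap.Q E = S.Q E := by
  have := S.W_swap E 0
  simp at this
  linarith

end Planar

end SturmLiouville

namespace SturmLiouville

open Filter Topology Real

/-! ### Angles on level lines, and time as an increasing function of the angle. -/

namespace Planar

variable (S : Planar)

/-- First coordinate of the point with angle `θ` (clockwise from the positive `y`-axis) on the
level `E`. -/
noncomputable def X (E θ : ℝ) : ℝ := S.p.inv (E * (sin θ * |sin θ|))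

/-- Second coordinate of the point with angle `θ` on the level `E`. -/
noncomputable def Y (E θ : ℝ) : ℝ := S.q.inv (E * (cos θ * |cos θ|))

/-- The derivative of time with respect to the angle. -/
noncomputable def rate (E θ : ℝ) : ℝ :=
  2 * E * |sin θ * cos θ| / |S.p.f (S.X E θ) * S.q.f (S.Y E θ)|

theorem rot_X (E θ : ℝ) : S.rot.X E (θ - π / 2) = -S.Y E θ := by
  simp [X, Y, rot, Profile.ref_inv, sin_sub_pi_div_two]

theorem rot_Y (E θ : ℝ) : S.rot.Y E (θ - π / 2) = S.X E θ := by
  simp [X, Y, rot, cos_sub_pi_div_two]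

/-- A quarter turn exchanges sine with cosine and `p` with `q`, up to signs that the absolute values
absorb. Hence one formula gives the rate in all quadrants, although `W` covers only the first. -/
theorem rot_rate (E θ : ℝ) : S.rot.rate E (θ - π / 2) = S.rate E θ := by
  have h1 : S.rot.p.f (-S.Y E θ) = -S.q.f (S.Y E θ) := by simp [rot, Profile.ref_f]
  have h2 : S.rot.q = S.p := rfl
  rw [rate, rate, rot_X, rot_Y, h1, h2, sin_sub_pi_div_two, cos_sub_pi_div_two]
  simp only [abs_mul, abs_neg, mul_comm]

theorem iterate_rot_rate (j : ℕ) (E θ : ℝ) :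
    (rot^[j] S).rate E (θ - j * (π / 2)) = S.rate E θ := by
  induction j generalizing S θ with
  | zero => simp
  | succ j ih =>
    rw [Function.iterate_succ_apply, ← S.rot_rate E θ, ← ih S.rot]
    congr 1; push_cast; ring

theorem hasDerivAt_W {E φ : ℝ} (hE : 0 < E) (h0 : 0 < φ) (h1 : φ < π / 2) :
    HasDerivAt (S.W E) (S.rate E φ) φ := by
  have hs : 0 < sin φ := sin_pos_of_pos_of_lt_pi h0 (by linarith)
  have hc : 0 < cos φ := cos_pos_of_mem_Ioo ⟨by linarith, h1⟩
  have hs2 := sin_sq_add_cos_sq φ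
  have hes : 0 < E * sin φ ^ 2 := by positivity
  have hlt : E * sin φ ^ 2 < E := by nlinarith [mul_pos hE (pow_pos hc 2)]
  have hx : 0 < S.p.inv (E * sin φ ^ 2) := S.p.inv_pos hes
  have hy : 0 < S.q.inv (E * cos φ ^ 2) := S.q.inv_pos (by positivity)
  have d1 := S.hasDerivAt_V hE hx (S.p.strictMono_inv hlt)
  have d2 := S.p.hasDerivAt_inv hes.ne'
  have d3 := ((hasDerivAt_sin φ).pow 2).const_mul E
  have d := d1.comp φ (d2.comp φ d3)
  refine d.congr_deriv ?_
  have e1 : E - E * sin φ ^ 2 = E * cos φ ^ 2 := by rw [cos_sq']; ring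
  have eX : S.X E φ = S.p.inv (E * sin φ ^ 2) := by rw [X, abs_of_pos hs, sq]
  have eY : S.Y E φ = S.q.inv (E * cos φ ^ 2) := by rw [Y, abs_of_pos hc, sq]
  rw [rate, eX, eY, Profile.sp_inv, e1, abs_of_pos (mul_pos hs hc),
    abs_of_pos (mul_pos (S.p.pos hx) (S.q.pos hy)), abs_of_pos (S.p.pos hx)]
  have := S.p.pos hx
  have := S.q.pos hy
  field_simp
  norm_num [mul_comm]

theorem rate_pos {E θ : ℝ} (hE : 0 < E) (hs : sin θ ≠ 0) (hc : cos θ ≠ 0) : 0 < S.rate E θ := by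
  have hx : S.X E θ ≠ 0 := by
    rw [X, Ne, Profile.inv_eq_zero]
    simp [hE.ne', hs]
  have hy : S.Y E θ ≠ 0 := by
    rw [Y, Ne, Profile.inv_eq_zero]
    simp [hE.ne', hc]
  have := S.p.ne_zero hx
  have := S.q.ne_zero hy
  unfold rate
  positivity

theorem strictMonoOn_W {E : ℝ} (hE : 0 < E) : StrictMonoOn (S.W E) (Icc 0 (π / 2)) := by
  apply strictMonoOn_of_deriv_pos (convex_Icc _ _)
  · exact (S.continuousOn_W.comp_continuous (f := fun u : ℝ => (E, u)) (by fun_prop)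
      (fun u => ⟨hE, trivial⟩)).continuousOn
  · intro φ hφ
    rw [interior_Icc] at hφ
    rw [(S.hasDerivAt_W hE hφ.1 hφ.2).deriv]
    exact S.rate_pos hE (sin_pos_of_pos_of_lt_pi hφ.1 (by linarith [hφ.2, pi_pos])).ne'
      (cos_pos_of_mem_Ioo ⟨by linarith [hφ.1, pi_pos], hφ.2⟩).ne'

theorem Q_pos {E : ℝ} (hE : 0 < E) : 0 < S.Q E := by
  have := S.strictMonoOn_W hE (left_mem_Icc.2 (by positivity)) (right_mem_Icc.2 (by positivity))
    (by positivity : 0 < π / 2)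
  simpa using this

/-- The angle within the `j`-th quarter turn. -/
noncomputable def clampAngle (j : ℕ) (θ : ℝ) : ℝ := min (max (θ - j * (π / 2)) 0) (π / 2)

theorem clampAngle_mem (j : ℕ) (θ : ℝ) : clampAngle j θ ∈ Icc 0 (π / 2) :=
  ⟨le_min (le_max_right _ _) (by positivity), min_le_right _ _⟩

theorem monotone_clampAngle (j : ℕ) : Monotone (clampAngle j) := fun a b h => by
  unfold clampAngle; gcongr

@[fun_prop]
theorem continuous_clampAngle (j : ℕ) : Continuous (clampAngle j) := by
  unfold clampAngle; fun_prop

theorem clampAngle_of_le {j : ℕ} {θ : ℝ} (h : θ ≤ j * (π / 2)) : clampAngle j θ = 0 := by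
  rw [clampAngle, max_eq_right (by linarith), min_eq_left (by positivity)]

theorem clampAngle_of_ge {j : ℕ} {θ : ℝ} (h : (j + 1) * (π / 2) ≤ θ) :
    clampAngle j θ = π / 2 := by
  have : (0 : ℝ) < π / 2 := by positivity
  rw [clampAngle, max_eq_left (by linarith), min_eq_right (by linarith)]

theorem clampAngle_of_mem {j : ℕ} {θ : ℝ} (h : θ ∈ Icc (j * (π / 2)) ((j + 1) * (π / 2))) :
    clampAngle j θ = θ - j * (π / 2) := by
  rw [clampAngle, max_eq_left (by linarith [h.1]), min_eq_left (by linarith [h.2])]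

/-- The time at which the angle `θ` is reached on the level `E`, starting from the angle `0`, for
`θ` between `0` and `K * (π / 2)`; it has slope `1` outside of this interval. -/
noncomputable def N (K : ℕ) (E θ : ℝ) : ℝ :=
  ∑ j ∈ Finset.range K, (rot^[j] S).W E (clampAngle j θ) + (θ - min (max θ 0) (K * (π / 2)))

theorem continuousOn_N (K : ℕ) :
    ContinuousOn (fun z : ℝ × ℝ => S.N K z.1 z.2) (Ioi 0 ×ˢ univ) := by
  unfold N
  refine ContinuousOn.add (continuousOn_finsetSum _ fun j _ => ?_) (by fun_prop)
  refine (rot^[j] S).continuousOn_W.comp (f := fun z : ℝ × ℝ => (z.1, clampAngle j z.2)) ?_ ?_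
  · exact Continuous.continuousOn (by fun_prop)
  · exact fun z hz => ⟨hz.1, trivial⟩

/-- Clamping does not increase distances. This is the linear tail of `N`, which vanishes on `[0,
c]`. -/
theorem monotone_sub_clamp {c : ℝ} (hc : 0 ≤ c) : Monotone fun θ : ℝ => θ - min (max θ 0) c := by
  intro a b h
  have : min (max b 0) c ≤ min (max a 0) c + (b - a) := by
    rcases le_total a 0 with ha | ha <;> rcases le_total b 0 with hb | hb <;>
    rcases le_total a c with hac | hac <;> rcases le_total b c with hbc | hbc <;>
    simp [*] <;> linarith
  simp only; linarith

/-- All summands are monotone, so it is enough that one increases strictly: the tail if `a` lies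
outside `[0, K * (π / 2))`, and otherwise the summand of the quarter turn that contains `a`. -/
theorem strictMono_N (K : ℕ) {E : ℝ} (hE : 0 < E) : StrictMono (S.N K E) := by
  intro a b hab
  have hpi : (0 : ℝ) < π / 2 := by positivity
  have hK : (0 : ℝ) ≤ K * (π / 2) := by positivity
  have hmono : ∀ j, (rot^[j] S).W E (clampAngle j a) ≤ (rot^[j] S).W E (clampAngle j b) :=
    fun j => ((rot^[j] S).strictMonoOn_W hE).monotoneOn (clampAngle_mem _ _) (clampAngle_mem _ _)
      (monotone_clampAngle j hab.le)
  have hlin := monotone_sub_clamp hK hab.le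
  have hsum : ∑ j ∈ Finset.range K, (rot^[j] S).W E (clampAngle j a) ≤
      ∑ j ∈ Finset.range K, (rot^[j] S).W E (clampAngle j b) :=
    Finset.sum_le_sum fun j _ => hmono j
  simp only at hlin
  unfold N
  rcases lt_or_ge a 0 with h0 | h0
  · have : a - min (max a 0) (K * (π / 2)) < b - min (max b 0) (K * (π / 2)) := by
      rw [max_eq_right h0.le, min_eq_left hK]
      rcases le_total b 0 with hb | hb
      · rw [max_eq_right hb, min_eq_left hK]; linarith
      · rw [max_eq_left hb]; linarith [min_le_left b (K * (π / 2))]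
    linarith
  rcases le_or_gt (K * (π / 2)) a with h1 | h1
  · have : a - min (max a 0) (K * (π / 2)) < b - min (max b 0) (K * (π / 2)) := by
      rw [max_eq_left h0, min_eq_right h1, max_eq_left (by linarith),
        min_eq_right (by linarith)]
      linarith
    linarith
  · refine add_lt_add_of_lt_of_le (Finset.sum_lt_sum (fun j _ => hmono j) ?_) hlin
    have hj0 : (⌊a / (π / 2)⌋₊ : ℝ) * (π / 2) ≤ a := by
      rw [← le_div_iff₀ hpi]; exact Nat.floor_le (by positivity)
    have hj1 : a < (⌊a / (π / 2)⌋₊ + 1 : ℝ) * (π / 2) := by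
      rw [← div_lt_iff₀ hpi]; exact Nat.lt_floor_add_one _
    refine ⟨⌊a / (π / 2)⌋₊, ?_, ?_⟩
    · rw [Finset.mem_range, Nat.floor_lt (by positivity), div_lt_iff₀ hpi]
      exact h1
    · refine (rot^[⌊a / (π / 2)⌋₊] S).strictMonoOn_W hE (clampAngle_mem _ _)
        (clampAngle_mem _ _) ?_
      rw [clampAngle_of_mem ⟨hj0, hj1.le⟩, clampAngle]
      refine lt_min ((?_ : _ < _).trans_le (le_max_left _ _)) ?_ <;> linarith

/-- The tails of slope `1` serve this purpose: they make `N` a homeomorphism of the line, so that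
`Θ` is defined at all times and no domain has to be tracked. -/
theorem surjective_N (K : ℕ) {E : ℝ} (hE : 0 < E) : Function.Surjective (S.N K E) := by
  have hc : Continuous (S.N K E) :=
    (S.continuousOn_N K).comp_continuous (f := fun u : ℝ => (E, u)) (by fun_prop)
      (fun u => ⟨hE, trivial⟩)
  have hK : (0 : ℝ) ≤ K * (π / 2) := by positivity
  refine hc.surjective ?_ ?_
  · have : Tendsto (fun θ : ℝ => ∑ j ∈ Finset.range K, (rot^[j] S).W E (π / 2) +
        (θ - K * (π / 2))) atTop atTop :=
      tendsto_atTop_add_const_left _ _ (tendsto_atTop_add_const_right _ _ tendsto_id)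
    refine this.congr' ?_
    filter_upwards [eventually_ge_atTop (K * (π / 2))] with θ hθ
    rw [N, max_eq_left (by linarith), min_eq_right hθ]
    congr 1
    refine Finset.sum_congr rfl fun j hj => ?_
    rw [clampAngle_of_ge]
    refine le_trans ?_ hθ
    gcongr
    exact_mod_cast Finset.mem_range.1 hj
  · refine tendsto_id.congr' ?_
    filter_upwards [eventually_le_atBot 0] with θ hθ
    rw [N, max_eq_right hθ, min_eq_left hK, Finset.sum_eq_zero]
    · simp
    intro j _
    rw [clampAngle_of_le (hθ.trans (by positivity)), W_zero]

theorem N_quarter (K : ℕ) {j : ℕ} (hj : j < K) (E : ℝ) {θ : ℝ}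
    (h : θ ∈ Icc (j * (π / 2)) ((j + 1) * (π / 2))) :
    S.N K E θ = ∑ i ∈ Finset.range j, (rot^[i] S).Q E + (rot^[j] S).W E (θ - j * (π / 2)) := by
  have hK : θ ≤ K * (π / 2) := by
    refine h.2.trans ?_
    gcongr
    exact_mod_cast hj
  have h0 : 0 ≤ θ := le_trans (by positivity) h.1
  have hsub : Finset.range (j + 1) ⊆ Finset.range K := by
    intro i hi; simp at *; omega
  rw [N, max_eq_left h0, min_eq_left hK, sub_self, add_zero, ← Finset.sum_subset hsub,
    Finset.sum_range_succ, clampAngle_of_mem h]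
  · congr 1
    refine Finset.sum_congr rfl fun i hi => ?_
    rw [clampAngle_of_ge, W_pi_div_two]
    refine le_trans ?_ h.1
    gcongr
    exact_mod_cast Finset.mem_range.1 hi
  · intro i _ hi
    rw [clampAngle_of_le, W_zero]
    refine h.2.trans ?_
    gcongr
    simp at hi
    exact_mod_cast hi

theorem N_mul_pi_div_two (K : ℕ) {j : ℕ} (hj : j < K) (E : ℝ) :
    S.N K E (j * (π / 2)) = ∑ i ∈ Finset.range j, (rot^[i] S).Q E := by
  rw [S.N_quarter K hj E (by constructor <;> nlinarith [pi_pos]), sub_self, W_zero, add_zero]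

theorem hasDerivAt_N (K : ℕ) {E θ : ℝ} (hE : 0 < E) (h0 : 0 < θ) (h1 : θ < K * (π / 2))
    (hs : sin θ ≠ 0) (hc : cos θ ≠ 0) : HasDerivAt (S.N K E) (S.rate E θ) θ := by
  have hpi : (0 : ℝ) < π / 2 := by positivity
  obtain ⟨j, hj⟩ : ∃ j, j = ⌊θ / (π / 2)⌋₊ := ⟨_, rfl⟩
  have hj0 : (j : ℝ) * (π / 2) ≤ θ := by
    rw [← le_div_iff₀ hpi, hj]; exact Nat.floor_le (by positivity)
  have hj1 : θ < (j + 1 : ℝ) * (π / 2) := by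
    rw [← div_lt_iff₀ hpi, hj]; exact Nat.lt_floor_add_one _
  have hjK : j < K := by
    rw [hj, Nat.floor_lt (by positivity), div_lt_iff₀ hpi]; exact h1
  -- Off the axes the angle is interior to its quarter turn, so near `θ` only one summand of `N`
  -- varies.
  have hj0' : (j : ℝ) * (π / 2) < θ := by
    refine hj0.lt_of_ne fun h => ?_
    have : sin (2 * θ) = 0 := by
      rw [← h, show 2 * ((j : ℝ) * (π / 2)) = j * π by ring]; exact sin_nat_mul_pi j
    rw [sin_two_mul] at this
    simp [hs, hc] at this
  have hd := (rot^[j] S).hasDerivAt_W hE (φ := θ - j * (π / 2)) (by linarith) (by linarith)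
  rw [iterate_rot_rate] at hd
  have hd' := ((hd.comp_sub_const θ (j * (π / 2)))).const_add
    (∑ i ∈ Finset.range j, (rot^[i] S).Q E)
  refine hd'.congr_of_eventuallyEq ?_
  filter_upwards [Ioo_mem_nhds hj0' hj1] with φ hφ
  exact S.N_quarter K hjK E (Ioo_subset_Icc_self hφ)

/-- The angle reached at the time `t` on the level `E`. -/
noncomputable def Θ (K : ℕ) (E : ℝ) : ℝ → ℝ := Function.invFun (S.N K E)

variable (K : ℕ)

theorem N_Θ {E : ℝ} (hE : 0 < E) (t : ℝ) : S.N K E (S.Θ K E t) = t :=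
  Function.invFun_eq (S.surjective_N K hE t)

theorem Θ_N {E : ℝ} (hE : 0 < E) (θ : ℝ) : S.Θ K E (S.N K E θ) = θ :=
  (S.strictMono_N K hE).injective (S.N_Θ K hE _)

theorem strictMono_Θ {E : ℝ} (hE : 0 < E) : StrictMono (S.Θ K E) := fun a b h => by
  rwa [← (S.strictMono_N K hE).lt_iff_lt, N_Θ _ _ hE, N_Θ _ _ hE]

/-- The inverse of a family of increasing homeomorphisms is jointly continuous: `θ < Θ(E, t)` means
`N(E, θ) < t`, which is an open condition on `(E, t)` for fixed `θ`, and likewise for the opposite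
inequality. -/
theorem continuousOn_Θ :
    ContinuousOn (fun z : ℝ × ℝ => S.Θ K z.1 z.2) (Ioi 0 ×ˢ univ) := by
  rintro ⟨E, t⟩ ⟨hE : 0 < E, -⟩
  refine ContinuousAt.continuousWithinAt ?_
  have hpos : ∀ᶠ z : ℝ × ℝ in 𝓝 (E, t), 0 < z.1 :=
    continuousAt_fst.eventually (lt_mem_nhds hE)
  have hN : ∀ θ, ContinuousAt (fun z : ℝ × ℝ => S.N K z.1 θ) (E, t) := by
    intro θ
    have h1 : ContinuousAt (fun z : ℝ × ℝ => S.N K z.1 z.2) (E, θ) :=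
      (S.continuousOn_N K).continuousAt (prod_mem_nhds (Ioi_mem_nhds hE) univ_mem)
    exact ContinuousAt.comp (f := fun z : ℝ × ℝ => (z.1, θ)) (x := (E, t)) h1 (by fun_prop)
  rw [ContinuousAt, tendsto_order]
  constructor
  · intro θ hθ
    have : S.N K E θ < t := by
      rw [← S.N_Θ K hE t]; exact S.strictMono_N K hE hθ
    filter_upwards [hpos, (hN θ).eventually_lt continuousAt_snd this] with z hz h
    rw [← (S.strictMono_N K hz).lt_iff_lt, N_Θ _ _ hz]
    exact h
  · intro θ hθ
    have : t < S.N K E θ := by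
      conv_lhs => rw [← S.N_Θ K hE t]
      exact S.strictMono_N K hE hθ
    filter_upwards [hpos, continuousAt_snd.eventually_lt (hN θ) this] with z hz h
    rw [← (S.strictMono_N K hz).lt_iff_lt, N_Θ _ _ hz]
    exact h

theorem continuous_Θ {E : ℝ} (hE : 0 < E) : Continuous (S.Θ K E) :=
  (S.continuousOn_Θ K).comp_continuous (f := fun u : ℝ => (E, u)) (by fun_prop)
      (fun _ => ⟨hE, trivial⟩)

theorem hasDerivAt_Θ {E t : ℝ} (hE : 0 < E) (h0 : 0 < S.Θ K E t)
    (h1 : S.Θ K E t < K * (π / 2)) (hs : sin (S.Θ K E t) ≠ 0) (hc : cos (S.Θ K E t) ≠ 0) :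
    HasDerivAt (S.Θ K E) (S.rate E (S.Θ K E t))⁻¹ t :=
  HasDerivAt.of_local_left_inverse (S.continuous_Θ K hE).continuousAt
    (S.hasDerivAt_N K hE h0 h1 hs hc) (S.rate_pos hE hs hc).ne'
    (Eventually.of_forall (S.N_Θ K hE))

theorem hasDerivAt_mul_abs {f : ℝ → ℝ} {f' x : ℝ} (hf : HasDerivAt f f' x) (h : f x ≠ 0) :
    HasDerivAt (fun x => f x * |f x|) (2 * |f x| * f') x := by
  rcases h.lt_or_gt with h | h
  · have := (hf.mul hf.neg)
    refine (this.congr_deriv ?_).congr_of_eventuallyEq ?_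
    · simp only [Pi.neg_apply, abs_of_neg h]; ring
    · filter_upwards [hf.continuousAt.eventually (gt_mem_nhds h)] with y hy
      simp [abs_of_neg hy]
  · have := (hf.mul hf)
    refine (this.congr_deriv ?_).congr_of_eventuallyEq ?_
    · simp only [abs_of_pos h]; ring
    · filter_upwards [hf.continuousAt.eventually (lt_mem_nhds h)] with y hy
      simp [abs_of_pos hy]

theorem sign_X {E θ : ℝ} (hE : 0 < E) (hs : sin θ ≠ 0) :
    0 < S.p.f (S.X E θ) * sin θ := by
  rcases hs.lt_or_gt with h | h
  · refine mul_pos_of_neg_of_neg (S.p.neg ?_) h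
    rw [X, ← S.p.inv_zero]
    exact S.p.strictMono_inv (mul_neg_of_pos_of_neg hE (mul_neg_of_neg_of_pos h (abs_pos.2 hs)))
  · refine mul_pos (S.p.pos (S.p.inv_pos ?_)) h
    positivity

theorem sign_Y {E θ : ℝ} (hE : 0 < E) (hc : cos θ ≠ 0) :
    0 < S.q.f (S.Y E θ) * cos θ := by
  rcases hc.lt_or_gt with h | h
  · refine mul_pos_of_neg_of_neg (S.q.neg ?_) h
    rw [Y, ← S.q.inv_zero]
    exact S.q.strictMono_inv (mul_neg_of_pos_of_neg hE (mul_neg_of_neg_of_pos h (abs_pos.2 hc)))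
  · refine mul_pos (S.q.pos (S.q.inv_pos ?_)) h
    positivity

/-- The curve `t ↦ (X, Y) (Θ t)` solves the system off the axes. -/
theorem hasDerivAt_orbit {E t : ℝ} (hE : 0 < E) (h0 : 0 < S.Θ K E t)
    (h1 : S.Θ K E t < K * (π / 2)) (hs : sin (S.Θ K E t) ≠ 0) (hc : cos (S.Θ K E t) ≠ 0) :
    HasDerivAt (fun t => S.X E (S.Θ K E t)) (S.q.f (S.Y E (S.Θ K E t))) t ∧
    HasDerivAt (fun t => S.Y E (S.Θ K E t)) (-S.p.f (S.X E (S.Θ K E t))) t := by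
  have hd := S.hasDerivAt_Θ K hE h0 h1 hs hc
  have sx := S.sign_X hE hs
  have sy := S.sign_Y hE hc
  set θ := S.Θ K E t with hθ
  have dx := (S.p.hasDerivAt_inv (e := E * (sin θ * |sin θ|)) (by simp [hE.ne', hs])).comp θ
    ((hasDerivAt_mul_abs (hasDerivAt_sin θ) hs).const_mul E)
  have dy := (S.q.hasDerivAt_inv (e := E * (cos θ * |cos θ|)) (by simp [hE.ne', hc])).comp θ
    ((hasDerivAt_mul_abs (hasDerivAt_cos θ) hc).const_mul E)
  have eX : S.p.inv (E * (sin θ * |sin θ|)) = S.X E θ := rfl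
  have eY : S.q.inv (E * (cos θ * |cos θ|)) = S.Y E θ := rfl
  have cx := dx.comp t hd
  have cy := dy.comp t hd
  rw [eX] at cx
  rw [eY] at cy
  have hsa := abs_pos.2 hs
  have hca := abs_pos.2 hc
  have hpx : S.p.f (S.X E θ) ≠ 0 := fun h => by simp [h] at sx
  have hqy : S.q.f (S.Y E θ) ≠ 0 := fun h => by simp [h] at sy
  have hpa := abs_pos.2 hpx
  have hqa := abs_pos.2 hqy
  constructor
  · refine cx.congr_deriv ?_
    rw [rate, abs_mul, abs_mul]
    field_simp
    have := abs_of_pos sy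
    rw [abs_mul] at this
    rcases hc.lt_or_gt with h | h
    · rw [abs_of_neg h] at this ⊢
      rw [abs_of_neg (neg_of_mul_pos_left sy h.le)]; ring
    · rw [abs_of_pos h] at this ⊢
      rw [abs_of_pos (pos_of_mul_pos_left sy h.le)]
  · refine cy.congr_deriv ?_
    rw [rate, abs_mul, abs_mul]
    field_simp
    rcases hs.lt_or_gt with h | h
    · rw [abs_of_neg h]
      rw [abs_of_neg (neg_of_mul_pos_left sx h.le)]; ring
    · rw [abs_of_pos h]
      rw [abs_of_pos (pos_of_mul_pos_left sx h.le)]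

end Planar

end SturmLiouville

namespace SturmLiouville

open Filter Topology Real

/-! ### One- and two-dimensional intermediate value theorems -/

/-- Take for `b'` the first point where `f` reaches `B`, and for `a'` the last point before `b'`
where `f` is at most `A`. -/
theorem exists_subinterval_of_le {f : ℝ → ℝ} {a b A B : ℝ} (hab : a ≤ b)
    (hf : ContinuousOn f (Icc a b)) (hAB : A < B) (ha : f a ≤ A) (hb : B ≤ f b) :
    ∃ a' b', a ≤ a' ∧ a' < b' ∧ b' ≤ b ∧ (∀ s ∈ Icc a' b', f s ∈ Icc A B) ∧
      f a' = A ∧ f b' = B := by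
  have hcl : IsClosed (Icc a b ∩ f ⁻¹' Ici B) :=
    hf.preimage_isClosed_of_isClosed isClosed_Icc isClosed_Ici
  obtain ⟨b', ⟨⟨hb1, hb2⟩, hb3 : B ≤ f b'⟩, hmin⟩ :=
    (isCompact_Icc.of_isClosed_subset hcl inter_subset_left).exists_isLeast
      ⟨b, ⟨hab, le_rfl⟩, hb⟩
  have hfb : ContinuousOn f (Icc a b') := hf.mono (Icc_subset_Icc_right hb2)
  have hcl' : IsClosed (Icc a b' ∩ f ⁻¹' Iic A) :=
    hfb.preimage_isClosed_of_isClosed isClosed_Icc isClosed_Iic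
  obtain ⟨a', ⟨⟨ha1, ha2⟩, ha3 : f a' ≤ A⟩, hmax⟩ :=
    (isCompact_Icc.of_isClosed_subset hcl' inter_subset_left).exists_isGreatest
      ⟨a, ⟨le_rfl, hb1⟩, ha⟩
  have hlt : a' < b' := ha2.lt_of_ne fun h => by subst h; linarith
  have hfa : ContinuousOn f (Icc a' b') := hfb.mono (Icc_subset_Icc_left ha1)
  have hB : f b' = B := by
    obtain ⟨s, hs, hsB⟩ := intermediate_value_Icc hlt.le hfa ⟨ha3.trans hAB.le, hb3⟩
    have : b' ≤ s := hmin ⟨⟨ha1.trans hs.1, hs.2.trans hb2⟩, hsB.ge⟩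
    rwa [← le_antisymm hs.2 this]
  have hA : f a' = A := by
    obtain ⟨s, hs, hsA⟩ := intermediate_value_Icc hlt.le hfa ⟨ha3, hAB.le.trans hb3⟩
    have : s ≤ a' := hmax ⟨⟨ha1.trans hs.1, hs.2⟩, hsA.le⟩
    rwa [← le_antisymm this hs.1]
  refine ⟨a', b', ha1, hlt, hb2, fun s hs => ⟨?_, ?_⟩, hA, hB⟩
  · by_contra! h
    have : s ≤ a' := hmax ⟨⟨ha1.trans hs.1, hs.2⟩, h.le⟩
    rw [le_antisymm this hs.1] at h
    linarith
  · by_contra! h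
    have : b' ≤ s := hmin ⟨⟨ha1.trans hs.1, hs.2.trans hb2⟩, h.le⟩
    rw [le_antisymm hs.2 this] at h
    linarith

/-- A function that crosses the interval `[A, B]` has a restriction that crosses it exactly. -/
theorem exists_subinterval {f : ℝ → ℝ} {a b A B : ℝ} (hab : a ≤ b)
    (hf : ContinuousOn f (Icc a b)) (hAB : A < B)
    (h : f a ≤ A ∧ B ≤ f b ∨ f b ≤ A ∧ B ≤ f a) :
    ∃ a' b', a ≤ a' ∧ a' < b' ∧ b' ≤ b ∧ (∀ s ∈ Icc a' b', f s ∈ Icc A B) ∧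
      (f a' = A ∧ f b' = B ∨ f b' = A ∧ f a' = B) := by
  rcases h with ⟨ha, hb⟩ | ⟨hb, ha⟩
  · obtain ⟨a', b', h1, h2, h3, h4, h5, h6⟩ := exists_subinterval_of_le hab hf hAB ha hb
    exact ⟨a', b', h1, h2, h3, h4, Or.inl ⟨h5, h6⟩⟩
  · obtain ⟨a', b', h1, h2, h3, h4, h5, h6⟩ := exists_subinterval_of_le (f := fun s => -f s)
      hab hf.neg (neg_lt_neg hAB) (neg_le_neg ha) (neg_le_neg hb)
    refine ⟨a', b', h1, h2, h3, fun s hs => ?_, Or.inr ⟨?_, ?_⟩⟩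
    · have := h4 s hs
      exact ⟨by linarith [this.2], by linarith [this.1]⟩
    · linarith
    · linarith

/-- A continuous angle whose cosine is nonnegative stays in the right half-plane. -/
theorem angle_mem_of_cos_nonneg {θ : ℝ → ℝ} (hθ : ContinuousOn θ (Icc 0 1)) {c : ℝ}
    (hcos : ∀ t ∈ Icc (0 : ℝ) 1, 0 ≤ cos (θ t - c)) {a b : ℝ} (ha : a ∈ Icc (0 : ℝ) 1)
    (hb : b ∈ Icc (0 : ℝ) 1) (h0 : |θ a - c| ≤ π / 2) : |θ b - c| ≤ π / 2 := by
  by_contra! h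
  have hsub : uIcc a b ⊆ Icc (0 : ℝ) 1 := uIcc_subset_Icc ha hb
  have hc : ContinuousOn (fun t => |θ t - c|) (uIcc a b) :=
    ((hθ.mono hsub).sub continuousOn_const).abs
  have hpi := pi_pos
  -- To leave the half-plane, `|θ - c|` would have to take a value strictly between `π / 2` and `3π
  -- / 2`, where the cosine is negative; capping at `π` provides such a value.
  obtain ⟨v, hv1, hv2, hv3⟩ : ∃ v, π / 2 < v ∧ v < 3 * π / 2 ∧ v ≤ |θ b - c| :=
    ⟨min π (|θ b - c|), lt_min (by linarith) h, (min_le_left _ _).trans_lt (by linarith),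
      min_le_right _ _⟩
  obtain ⟨t, ht, hv⟩ := intermediate_value_uIcc hc (mem_uIcc.2 (Or.inl ⟨h0.trans hv1.le, hv3⟩))
  have := hcos t (hsub ht)
  rw [← cos_abs] at this
  simp only at hv
  rw [hv] at this
  exact absurd this (not_le.2 (cos_neg_of_pi_div_two_lt_of_lt hv1 (by linarith)))

/-- The Poincaré–Miranda theorem on the unit square. -/
theorem exists_zero_of_sign {f g : ℝ × ℝ → ℝ} (hf : Continuous f) (hg : Continuous g)
    (hf0 : ∀ s ∈ Icc (0 : ℝ) 1, 0 ≤ f (s, 0)) (hf1 : ∀ s ∈ Icc (0 : ℝ) 1, f (s, 1) ≤ 0)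
    (hg0 : ∀ t ∈ Icc (0 : ℝ) 1, 0 ≤ g (0, t)) (hg1 : ∀ t ∈ Icc (0 : ℝ) 1, g (1, t) ≤ 0) :
    ∃ s ∈ Icc (0 : ℝ) 1, ∃ t ∈ Icc (0 : ℝ) 1, f (s, t) = 0 ∧ g (s, t) = 0 := by
  by_contra! hne
  -- Composition with the retraction onto the square yields a nonvanishing map on the whole simply
  -- connected plane, so that the covering property of the exponential provides a continuous angle.
  let pr : ℝ → ℝ := fun s => projIcc (0 : ℝ) 1 zero_le_one s
  have hpr : Continuous pr := continuous_subtype_val.comp continuous_projIcc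
  have hprmem : ∀ s, pr s ∈ Icc (0 : ℝ) 1 := fun s => (projIcc (0 : ℝ) 1 zero_le_one s).2
  have hpreq : ∀ s ∈ Icc (0 : ℝ) 1, pr s = s := fun s hs => by
    simp only [pr, projIcc_of_mem zero_le_one hs]
  let F : C(ℝ × ℝ, ℂ) := ⟨fun z => ⟨f (pr z.1, pr z.2), g (pr z.1, pr z.2)⟩, by
    have h1 : Continuous fun z : ℝ × ℝ => f (pr z.1, pr z.2) := by fun_prop
    have h2 : Continuous fun z : ℝ × ℝ => g (pr z.1, pr z.2) := by fun_prop
    have := (Complex.equivRealProdCLM.symm.continuous).comp (h1.prodMk h2)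
    exact this⟩
  have hF : ∀ z, F z ≠ 0 := by
    intro z hz
    have h1 : f (pr z.1, pr z.2) = 0 := congrArg Complex.re hz
    have h2 : g (pr z.1, pr z.2) = 0 := congrArg Complex.im hz
    exact hne _ (hprmem _) _ (hprmem _) h1 h2
  obtain ⟨l, ⟨hl0, hl⟩, -⟩ := Complex.isCoveringMapOn_exp.existsUnique_continuousMap_lifts F
    (a₀ := (0, 0)) (Complex.exp_log (hF (0, 0))) (fun z => hF z)
  have hexp : ∀ z, Complex.exp (l z) = F z := fun z => congrFun hl z
  let θ : ℝ × ℝ → ℝ := fun z => (l z).im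
  have hθ : Continuous θ := Complex.continuous_im.comp l.continuous
  have hre : ∀ z, F z = ⟨rexp (l z).re * cos (θ z), rexp (l z).re * sin (θ z)⟩ := by
    intro z
    rw [← hexp]
    apply Complex.ext
    · simp [Complex.exp_re, θ]
    · simp [Complex.exp_im, θ]
  have hcos : ∀ s ∈ Icc (0 : ℝ) 1, ∀ t ∈ Icc (0 : ℝ) 1,
      f (s, t) = rexp (l (s, t)).re * cos (θ (s, t)) := by
    intro s hs t ht
    have : f (pr s, pr t) = _ := congrArg Complex.re (hre (s, t))
    rwa [hpreq s hs, hpreq t ht] at this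
  have hsin : ∀ s ∈ Icc (0 : ℝ) 1, ∀ t ∈ Icc (0 : ℝ) 1,
      g (s, t) = rexp (l (s, t)).re * sin (θ (s, t)) := by
    intro s hs t ht
    have : g (pr s, pr t) = _ := congrArg Complex.im (hre (s, t))
    rwa [hpreq s hs, hpreq t ht] at this
  have z0 : (0 : ℝ) ∈ Icc (0 : ℝ) 1 := ⟨le_rfl, zero_le_one⟩
  have z1 : (1 : ℝ) ∈ Icc (0 : ℝ) 1 := ⟨zero_le_one, le_rfl⟩
  have c0 : ∀ s ∈ Icc (0 : ℝ) 1, 0 ≤ cos (θ (s, 0)) := fun s hs => by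
    have := hf0 s hs
    rw [hcos s hs 0 z0] at this
    exact nonneg_of_mul_nonneg_right this (exp_pos _)
  have c1 : ∀ s ∈ Icc (0 : ℝ) 1, cos (θ (s, 1)) ≤ 0 := fun s hs => by
    have := hf1 s hs
    rw [hcos s hs 1 z1] at this
    exact nonpos_of_mul_nonpos_right this (exp_pos _)
  have s0 : ∀ t ∈ Icc (0 : ℝ) 1, 0 ≤ sin (θ (0, t)) := fun t ht => by
    have := hg0 t ht
    rw [hsin 0 z0 t ht] at this
    exact nonneg_of_mul_nonneg_right this (exp_pos _)
  have s1 : ∀ t ∈ Icc (0 : ℝ) 1, sin (θ (1, t)) ≤ 0 := fun t ht => by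
    have := hg1 t ht
    rw [hsin 1 z1 t ht] at this
    exact nonpos_of_mul_nonpos_right this (exp_pos _)
  have hstart : θ (0, 0) ∈ Icc 0 (π / 2) := by
    have h : θ (0, 0) = Complex.arg (F (0, 0)) := by
      simp only [θ, hl0, Complex.log_im]
    have h1 : 0 ≤ (F (0, 0)).re := by
      change 0 ≤ f (pr 0, pr 0)
      rw [hpreq 0 z0]
      exact hf0 0 z0
    have h2 : 0 ≤ (F (0, 0)).im := by
      change 0 ≤ g (pr 0, pr 0)
      rw [hpreq 0 z0]
      exact hg0 0 z0
    rw [h]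
    exact ⟨Complex.arg_nonneg_iff.2 h2, (abs_le.1 (Complex.abs_arg_le_pi_div_two_iff.2 h1)).2⟩
  have hpi := pi_pos
  -- going around the boundary of the square in the two directions
  have a1 : |θ (1, 0) - 0| ≤ π / 2 :=
    angle_mem_of_cos_nonneg (θ := fun s => θ (s, 0)) (c := 0) (by fun_prop)
      (by simpa using c0) z0 z1 (by rw [abs_le]; constructor <;> linarith [hstart.1, hstart.2])
  have a2 : |θ (0, 1) - π / 2| ≤ π / 2 :=
    angle_mem_of_cos_nonneg (θ := fun t => θ (0, t)) (c := π / 2) (by fun_prop)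
      (by simpa [cos_sub_pi_div_two] using s0) z0 z1
      (by rw [abs_le]; constructor <;> linarith [hstart.1, hstart.2])
  have a3 : |θ (1, 1) - -(π / 2)| ≤ π / 2 := by
    have hs : ∀ t ∈ Icc (0 : ℝ) 1, 0 ≤ cos (θ (1, t) - -(π / 2)) := fun t ht => by
      rw [sub_neg_eq_add, cos_add_pi_div_two]; linarith [s1 t ht]
    refine angle_mem_of_cos_nonneg (θ := fun t => θ (1, t)) (by fun_prop) hs z0 z1 ?_
    have h1 := s1 0 z0
    rw [abs_le] at a1 ⊢
    have : θ (1, 0) ≤ 0 := by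
      by_contra! h
      exact absurd h1 (not_le.2 (sin_pos_of_pos_of_lt_pi h (by linarith [a1.2])))
    constructor <;> linarith [a1.1]
  have a4 : |θ (0, 1) - -π| ≤ π / 2 := by
    have hs : ∀ s ∈ Icc (0 : ℝ) 1, 0 ≤ cos (θ (s, 1) - -π) := fun s hs => by
      rw [sub_neg_eq_add, cos_add_pi]; linarith [c1 s hs]
    refine angle_mem_of_cos_nonneg (θ := fun s => θ (s, 1)) (by fun_prop) hs z1 z0 ?_
    have h1 := c1 1 z1
    rw [abs_le] at a3 ⊢
    have : θ (1, 1) ≤ -(π / 2) := by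
      by_contra! h
      exact absurd h1 (not_le.2 (cos_pos_of_mem_Ioo ⟨h, by linarith [a3.2]⟩))
    constructor <;> linarith [a3.1]
  -- Along the left edge the angle at `(0, 1)` is at least `0`; along the other three edges it is at
  -- most `-π / 2`.
  rw [abs_le] at a2 a4
  linarith [a2.1, a4.2]

end SturmLiouville

namespace SturmLiouville

open Filter Topology Real

/-! ### Solutions off a countable set, and the counting of zeros. -/

/-- `u` is Lipschitz on `[a, b]` and solves `x' = q(y)`, `y' = -p(x)` off a countable set. -/
def IsSol (p q : ℝ → ℝ) (u : ℝ → ℝ × ℝ) (a b : ℝ) : Prop :=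
  (∃ K, LipschitzOnWith K (fun t => (u t).1) (Icc a b)) ∧
  (∃ K, LipschitzOnWith K (fun t => (u t).2) (Icc a b)) ∧
  ∃ C : Set ℝ, C.Countable ∧ ∀ t ∈ Ioo a b, t ∉ C →
    HasDerivAt (fun t => (u t).1) (q (u t).2) t ∧ HasDerivAt (fun t => (u t).2) (-p (u t).1) t

/-- The fundamental theorem of calculus tolerates a countable exceptional set for continuous `x`,
and the velocity `v` is bounded by compactness. Orbits are differentiated only off the axes, hence
the exceptional set. -/
theorem exists_lipschitzOnWith {x v : ℝ → ℝ} {a b : ℝ} (hx : ContinuousOn x (Icc a b))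
    (hv : ContinuousOn v (Icc a b)) {C : Set ℝ} (hC : C.Countable)
    (hd : ∀ t ∈ Ioo a b, t ∉ C → HasDerivAt x (v t) t) :
    ∃ K, LipschitzOnWith K x (Icc a b) := by
  obtain ⟨M, hM⟩ := isCompact_Icc.exists_bound_of_continuousOn hv
  refine ⟨M.toNNReal, LipschitzOnWith.of_dist_le_mul ?_⟩
  suffices H : ∀ s ∈ Icc a b, ∀ t ∈ Icc a b, s ≤ t → dist (x s) (x t) ≤ M.toNNReal * dist s t by
    intro s hs t ht
    rcases le_total s t with h | h
    · exact H s hs t ht h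
    · rw [dist_comm, dist_comm s t]; exact H t ht s hs h
  intro s hs t ht hst
  have hsub : Icc s t ⊆ Icc a b := Icc_subset_Icc hs.1 ht.2
  have hint : IntervalIntegrable v volume s t :=
    ContinuousOn.intervalIntegrable (by rw [uIcc_of_le hst]; exact hv.mono hsub)
  have h := integral_eq_of_hasDerivAt_off_countable x v (a := s) (b := t) hC
    (by rw [uIcc_of_le hst]; exact hx.mono hsub)
    (fun r hr => hd r (by
      rw [min_eq_left hst, max_eq_right hst] at hr
      exact ⟨hs.1.trans_lt hr.1.1, hr.1.2.trans_le ht.2⟩) hr.2) hint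
  rw [dist_comm, dist_eq_norm, ← h, dist_comm, Real.dist_eq]
  refine intervalIntegral.norm_integral_le_of_norm_le_const fun r hr => ?_
  rw [uIoc_of_le hst] at hr
  exact (hM r (hsub ⟨hr.1.le, hr.2⟩)).trans (Real.le_coe_toNNReal M)

/-! ### Zeros along increasing reparametrizations -/

theorem zeros_comp_Icc (F : ℝ → ℝ) {φ : ℝ → ℝ} (hc : Continuous φ) (hm : StrictMono φ) {a b : ℝ}
    (hab : a ≤ b) : zeros (fun r => F (φ r)) (Icc a b) = zeros F (Icc (φ a) (φ b)) := by
  unfold zeros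
  rw [← hm.injective.encard_image]
  congr 1
  ext θ
  constructor
  · rintro ⟨r, ⟨hr, h⟩, rfl⟩
    exact ⟨⟨hm.monotone hr.1, hm.monotone hr.2⟩, h⟩
  · rintro ⟨hθ, h⟩
    obtain ⟨r, hr, rfl⟩ := intermediate_value_Icc hab hc.continuousOn hθ
    exact ⟨r, ⟨hr, h⟩, rfl⟩

theorem zeros_comp_Ioo (F : ℝ → ℝ) {φ : ℝ → ℝ} (hc : Continuous φ) (hm : StrictMono φ) {a b : ℝ}
    (hab : a ≤ b) : zeros (fun r => F (φ r)) (Ioo a b) = zeros F (Ioo (φ a) (φ b)) := by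
  unfold zeros
  rw [← hm.injective.encard_image]
  congr 1
  ext θ
  constructor
  · rintro ⟨r, ⟨hr, h⟩, rfl⟩
    exact ⟨⟨hm hr.1, hm hr.2⟩, h⟩
  · rintro ⟨hθ, h⟩
    obtain ⟨r, hr, rfl⟩ := intermediate_value_Ioo hab hc.continuousOn hθ
    exact ⟨r, ⟨hr, h⟩, rfl⟩

/-- The zeros are `n π` with `l < n ≤ L`: the interval is open, so `l π` and `(L + 1) π` do not
count even when they are its endpoints. -/
theorem zeros_sin {l L : ℕ} {θ₀ θ₁ : ℝ} (h₀ : θ₀ ∈ Icc (l * π) (l * π + π / 2))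
    (h₁ : θ₁ ∈ Icc (L * π + π / 2) ((L + 1) * π)) :
    zeros sin (Ioo θ₀ θ₁) = ((L - l : ℕ) : ℕ∞) := by
  have hpi := pi_pos
  have : {r ∈ Ioo θ₀ θ₁ | sin r = 0} = (fun n : ℕ => (n : ℝ) * π) '' (Finset.Ioc l L) := by
    ext θ
    constructor
    · rintro ⟨hθ, h⟩
      obtain ⟨n, rfl⟩ := sin_eq_zero_iff.1 h
      have h1 : (l : ℝ) < n := lt_of_mul_lt_mul_right (h₀.1.trans_lt hθ.1) hpi.le
      have h2 : (n : ℝ) < L + 1 := lt_of_mul_lt_mul_right (hθ.2.trans_le h₁.2) hpi.le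
      have h1' : (l : ℤ) < n := by exact_mod_cast h1
      have h2' : n < (L : ℤ) + 1 := by exact_mod_cast h2
      lift n to ℕ using (by omega)
      refine ⟨n, ?_, by simp⟩
      simp only [Finset.coe_Ioc, mem_Ioc]
      omega
    · rintro ⟨n, hn, rfl⟩
      simp only [Finset.coe_Ioc, mem_Ioc] at hn
      have h1 : (l : ℝ) + 1 ≤ n := by exact_mod_cast hn.1
      have h2 : (n : ℝ) ≤ L := by exact_mod_cast hn.2
      refine ⟨⟨h₀.2.trans_lt ?_, lt_of_lt_of_le ?_ h₁.1⟩, sin_nat_mul_pi n⟩ <;> nlinarith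
  rw [zeros, this, Function.Injective.encard_image, encard_coe_eq_coe_finsetCard, Nat.card_Ioc]
  intro a b h
  simpa [hpi.ne'] using h

/-- The zeros are `n π + π / 2` with `l ≤ n ≤ L`: the interval is closed, so both extreme ones count
even when they are its endpoints. -/
theorem zeros_cos {l L : ℕ} (hlL : l ≤ L) {θ₀ θ₁ : ℝ} (h₀ : θ₀ ∈ Icc (l * π) (l * π + π / 2))
    (h₁ : θ₁ ∈ Icc (L * π + π / 2) ((L + 1) * π)) :
    zeros cos (Icc θ₀ θ₁) = ((L - l + 1 : ℕ) : ℕ∞) := by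
  have hpi := pi_pos
  have : {r ∈ Icc θ₀ θ₁ | cos r = 0} =
      (fun n : ℕ => (n : ℝ) * π + π / 2) '' (Finset.Icc l L) := by
    ext θ
    constructor
    · rintro ⟨hθ, h⟩
      obtain ⟨n, rfl⟩ := cos_eq_zero_iff.1 h
      have h1 : (l : ℝ) < n + 1 := by nlinarith [h₀.1.trans hθ.1]
      have h2 : (n : ℝ) < L + 1 := by nlinarith [hθ.2.trans h₁.2]
      have h1' : (l : ℤ) < n + 1 := by exact_mod_cast h1
      have h2' : n < (L : ℤ) + 1 := by exact_mod_cast h2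
      lift n to ℕ using (by omega)
      refine ⟨n, ?_, by push_cast; ring⟩
      simp only [Finset.coe_Icc, mem_Icc]
      omega
    · rintro ⟨n, hn, rfl⟩
      simp only [Finset.coe_Icc, mem_Icc] at hn
      have h1 : (l : ℝ) ≤ n := by exact_mod_cast hn.1
      have h2 : (n : ℝ) ≤ L := by exact_mod_cast hn.2
      refine ⟨⟨h₀.2.trans ?_, le_trans ?_ h₁.1⟩, cos_eq_zero_iff.2 ⟨n, by push_cast; ring⟩⟩ <;>
        nlinarith
  rw [zeros, this, Function.Injective.encard_image, encard_coe_eq_coe_finsetCard, Nat.card_Icc]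
  · congr 1; omega
  intro a b h
  simpa [hpi.ne'] using h

/-- The union of the first quadrant (for even `l`) and the third one (for odd `l`). -/
def InFirst (l : ℕ) (z : ℝ × ℝ) : Prop := 0 ≤ (-1) ^ l * z.1 ∧ 0 ≤ (-1) ^ l * z.2

/-- The fourth quadrant (for even `l`) and the second one (for odd `l`). -/
def InFourth (l : ℕ) (z : ℝ × ℝ) : Prop := 0 ≤ (-1) ^ l * z.1 ∧ (-1) ^ l * z.2 ≤ 0

namespace Profile

variable (p : Profile)

theorem abs_sp_eq {l : ℕ} {x : ℝ} (h : 0 ≤ (-1) ^ l * x) : (-1) ^ l * |p.sp x| = p.sp x := by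
  rcases neg_one_pow_eq_or ℝ l with e | e <;> rw [e] at h ⊢
  · rw [one_mul, abs_of_nonneg (p.sp_nonneg (by linarith))]
  · rw [abs_of_nonpos (p.sp_nonpos (by linarith))]; ring

theorem inv_sign {l : ℕ} {e : ℝ} (h : 0 ≤ (-1) ^ l * e) : 0 ≤ (-1) ^ l * p.inv e := by
  rcases neg_one_pow_eq_or ℝ l with h' | h' <;> rw [h'] at h ⊢
  · rw [one_mul]; exact p.inv_nonneg (by linarith)
  · have : p.inv e ≤ p.inv 0 := p.strictMono_inv.monotone (by linarith)
    rw [inv_zero] at this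
    linarith

end Profile

/-! ### Angles of points, orbits, and stretching within an annulus. -/

namespace Planar

variable (S : Planar)

/-- The Hamiltonian of the system. -/
noncomputable def level (z : ℝ × ℝ) : ℝ := |S.p.sp z.1| + |S.q.sp z.2|

theorem continuous_level : Continuous S.level :=
  (S.p.continuous_sp.comp continuous_fst).abs.add (S.q.continuous_sp.comp continuous_snd).abs

theorem level_X_Y {E : ℝ} (hE : 0 < E) (θ : ℝ) : S.level (S.X E θ, S.Y E θ) = E := by
  simp only [level, X, Y, Profile.sp_inv, abs_mul, abs_abs, abs_of_pos hE]
  rw [← sq, ← sq, sq_abs, sq_abs, ← mul_add, sin_sq_add_cos_sq, mul_one]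

theorem X_eq_zero {E : ℝ} (hE : 0 < E) (θ : ℝ) : S.X E θ = 0 ↔ sin θ = 0 := by
  simp [X, Profile.inv_eq_zero, hE.ne']

theorem Y_eq_zero {E : ℝ} (hE : 0 < E) (θ : ℝ) : S.Y E θ = 0 ↔ cos θ = 0 := by
  simp [Y, Profile.inv_eq_zero, hE.ne']

theorem continuous_X_Y : Continuous fun z : ℝ × ℝ => (S.X z.1 z.2, S.Y z.1 z.2) := by
  unfold X Y; fun_prop

theorem sign_mul_abs {ε a : ℝ} (h : 0 ≤ ε * a) {E : ℝ} (hE : 0 < E) :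
    0 ≤ ε * (E * (a * |a|)) := by
  have := mul_nonneg (mul_nonneg h (abs_nonneg a)) hE.le
  linarith

theorem X_sign {E θ : ℝ} (hE : 0 < E) {l : ℕ} (h : θ ∈ Icc (l * π) ((l + 1) * π)) :
    0 ≤ (-1) ^ l * S.X E θ := by
  refine S.p.inv_sign (sign_mul_abs ?_ hE)
  rw [← sin_sub_nat_mul_pi]
  exact sin_nonneg_of_nonneg_of_le_pi (by linarith [h.1]) (by linarith [h.2])

theorem Y_sign {E θ : ℝ} (hE : 0 < E) {l : ℕ} (h : θ ∈ Icc (l * π - π / 2) (l * π + π / 2)) :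
    0 ≤ (-1) ^ l * S.Y E θ := by
  refine S.q.inv_sign (sign_mul_abs ?_ hE)
  rw [← cos_sub_nat_mul_pi]
  exact cos_nonneg_of_mem_Icc ⟨by linarith [h.1], by linarith [h.2]⟩

theorem inFourth_X_Y {E θ : ℝ} (hE : 0 < E) {L : ℕ}
    (h : θ ∈ Icc (L * π + π / 2) ((L + 1) * π)) : InFourth L (S.X E θ, S.Y E θ) := by
  have hpi := pi_pos
  have h2 := S.Y_sign hE (θ := θ) (l := L + 1) ⟨by push_cast; linarith [h.1], by
    push_cast; linarith [h.2]⟩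
  rw [pow_succ] at h2
  exact ⟨S.X_sign hE ⟨by linarith [h.1], h.2⟩, by linarith⟩

theorem inFirst_X_Y {E θ : ℝ} (hE : 0 < E) {l : ℕ}
    (h : θ ∈ Icc (l * π) (l * π + π / 2)) : InFirst l (S.X E θ, S.Y E θ) := by
  have hpi := pi_pos
  exact ⟨S.X_sign hE ⟨h.1, by linarith [h.2]⟩, S.Y_sign hE ⟨by linarith [h.1], h.2⟩⟩

/-- The angle of a point of the first or third quadrant. -/
noncomputable def angle (l : ℕ) (z : ℝ × ℝ) : ℝ :=
  l * π + arcsin (√(|S.p.sp z.1| / S.level z))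

theorem angle_mem (l : ℕ) (z : ℝ × ℝ) : S.angle l z ∈ Icc (l * π) (l * π + π / 2) := by
  have h1 := arcsin_nonneg.2 (sqrt_nonneg (|S.p.sp z.1| / S.level z))
  have h2 := arcsin_le_pi_div_two (√(|S.p.sp z.1| / S.level z))
  exact ⟨by rw [angle]; linarith, by rw [angle]; linarith⟩

theorem continuousOn_angle (l : ℕ) : ContinuousOn (S.angle l) {z | 0 < S.level z} := by
  refine continuousOn_const.add (continuous_arcsin.comp_continuousOn ?_)
  exact (((S.p.continuous_sp.comp continuous_fst).abs.continuousOn).div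
    S.continuous_level.continuousOn fun z hz => (ne_of_gt hz)).sqrt

/-- The squared sine of the angle is by definition the share of `x` in the level and the squared
cosine that of `y`; the half-turn `l` restores the signs. -/
theorem X_Y_angle {l : ℕ} {z : ℝ × ℝ} (hz : InFirst l z) (hE : 0 < S.level z) :
    (S.X (S.level z) (S.angle l z), S.Y (S.level z) (S.angle l z)) = z := by
  obtain ⟨r, hr⟩ : ∃ r, r = |S.p.sp z.1| / S.level z := ⟨_, rfl⟩
  have hr0 : 0 ≤ r := by rw [hr]; positivity
  have hr1 : r ≤ 1 := by
    rw [hr, div_le_one hE, level]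
    linarith [abs_nonneg (S.q.sp z.2)]
  have hsr : √r ≤ 1 := sqrt_le_one.2 hr1
  have hs : sin (S.angle l z) = (-1) ^ l * √r := by
    rw [angle, add_comm, sin_add_nat_mul_pi, sin_arcsin (by linarith [sqrt_nonneg (|S.p.sp z.1| / S.level z)])
      (hr ▸ hsr), ← hr]
  have hc : cos (S.angle l z) = (-1) ^ l * √(1 - r) := by
    rw [angle, add_comm, cos_add_nat_mul_pi, cos_arcsin, ← hr, sq_sqrt hr0]
  have e1 : S.level z * r = |S.p.sp z.1| := by rw [hr]; field_simp
  have e2 : S.level z * (1 - r) = |S.q.sp z.2| := by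
    rw [mul_sub, e1, level]; ring
  have habs : |(-1 : ℝ) ^ l| = 1 := by simp
  ext
  · rw [X, hs, abs_mul, habs, one_mul, abs_of_nonneg (sqrt_nonneg r), mul_assoc,
      mul_self_sqrt hr0, mul_left_comm, e1, S.p.abs_sp_eq hz.1, Profile.inv_sp]
  · rw [Y, hc, abs_mul, habs, one_mul, abs_of_nonneg (sqrt_nonneg _), mul_assoc,
      mul_self_sqrt (by linarith), mul_left_comm, e2, S.q.abs_sp_eq hz.2, Profile.inv_sp]

/-- The angle of a point of the fourth or second quadrant. -/
noncomputable def angle' (l : ℕ) (z : ℝ × ℝ) : ℝ := S.rot.angle l (-z.2, z.1) + π / 2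

theorem level_rot (z : ℝ × ℝ) : S.rot.level (-z.2, z.1) = S.level z := by
  simp [level, rot, Profile.ref_sp, add_comm]

theorem angle'_mem (l : ℕ) (z : ℝ × ℝ) : S.angle' l z ∈ Icc (l * π + π / 2) ((l + 1) * π) := by
  have := S.rot.angle_mem l (-z.2, z.1)
  exact ⟨by rw [angle']; linarith [this.1], by rw [angle']; linarith [this.2]⟩

theorem continuousOn_angle' (l : ℕ) : ContinuousOn (S.angle' l) {z | 0 < S.level z} := by
  refine ContinuousOn.add ?_ continuousOn_const
  refine (S.rot.continuousOn_angle l).comp (f := fun z : ℝ × ℝ => (-z.2, z.1)) (by fun_prop) ?_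
  intro z hz
  simpa [level_rot] using hz

theorem X_Y_angle' {l : ℕ} {z : ℝ × ℝ} (hz : InFourth l z) (hE : 0 < S.level z) :
    (S.X (S.level z) (S.angle' l z), S.Y (S.level z) (S.angle' l z)) = z := by
  have h := S.rot.X_Y_angle (l := l) (z := (-z.2, z.1)) ⟨by simpa using hz.2, hz.1⟩
    (by rwa [level_rot])
  have e : S.rot.angle l (-z.2, z.1) = S.angle' l z - π / 2 := by rw [angle']; ring
  rw [level_rot, e, rot_X, rot_Y] at h
  have h1 := congrArg Prod.fst h
  have h2 := congrArg Prod.snd h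
  ext
  · exact h2
  · simpa using h1

/-- Solutions that run on a level line from one angle to another. -/
theorem exists_orbit (K : ℕ) {E θ₀ θ₁ a b : ℝ} (hE : 0 < E) (h0 : 0 < θ₀)
    (h1 : θ₁ < K * (π / 2)) (hN : S.N K E θ₁ = S.N K E θ₀ + (b - a)) :
    ∃ φ : ℝ → ℝ, Continuous φ ∧ StrictMono φ ∧ φ a = θ₀ ∧ φ b = θ₁ ∧
      IsSol S.p.f S.q.f (fun t => (S.X E (φ t), S.Y E (φ t))) a b := by
  have hc : Continuous fun t => S.Θ K E (S.N K E θ₀ + (t - a)) :=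
    (S.continuous_Θ K hE).comp (by fun_prop)
  have hm : StrictMono fun t => S.Θ K E (S.N K E θ₀ + (t - a)) := fun s t hst =>
    S.strictMono_Θ K hE (by linarith)
  have ha : S.Θ K E (S.N K E θ₀ + (a - a)) = θ₀ := by rw [sub_self, add_zero, Θ_N _ _ hE]
  have hb : S.Θ K E (S.N K E θ₀ + (b - a)) = θ₁ := by rw [← hN, Θ_N _ _ hE]
  refine ⟨fun t => S.Θ K E (S.N K E θ₀ + (t - a)), hc, hm, ha, hb, ?_⟩
  generalize hφ : (fun t => S.Θ K E (S.N K E θ₀ + (t - a))) = φ at *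
  have hXY := S.continuous_X_Y
  have hx : Continuous fun t => S.X E (φ t) :=
    (continuous_fst.comp hXY).comp (f := fun t => (E, φ t)) (by fun_prop)
  have hy : Continuous fun t => S.Y E (φ t) :=
    (continuous_snd.comp hXY).comp (f := fun t => (E, φ t)) (by fun_prop)
  -- The times on the axes are countably many, being the preimage of a countable set of angles under
  -- an injective map.
  let C : Set ℝ := φ ⁻¹' (range (fun n : ℤ => (n : ℝ) * π) ∪
    range (fun n : ℤ => (2 * n + 1) * π / 2))
  have hC : C.Countable :=
    ((countable_range _).union (countable_range _)).preimage_of_injOn hm.injective.injOn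
  have hd : ∀ t ∈ Ioo a b, t ∉ C →
      HasDerivAt (fun t => S.X E (φ t)) (S.q.f (S.Y E (φ t))) t ∧
      HasDerivAt (fun t => S.Y E (φ t)) (-S.p.f (S.X E (φ t))) t := by
    intro t ht htC
    have hsin : sin (φ t) ≠ 0 := fun h => by
      obtain ⟨n, hn⟩ := sin_eq_zero_iff.1 h
      exact htC (Or.inl ⟨n, hn⟩)
    have hcos : cos (φ t) ≠ 0 := fun h => by
      obtain ⟨n, hn⟩ := cos_eq_zero_iff.1 h
      exact htC (Or.inr ⟨n, hn.symm⟩)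
    have hl : 0 < φ t := by
      have := hm ht.1
      have ha' : φ a = θ₀ := by rw [← hφ]; exact ha
      linarith
    have hr : φ t < K * (π / 2) := by
      have := hm ht.2
      have hb' : φ b = θ₁ := by rw [← hφ]; exact hb
      linarith
    subst hφ
    have := S.hasDerivAt_orbit K hE hl hr hsin hcos
    have hs : HasDerivAt (fun t => S.N K E θ₀ + (t - a)) 1 t :=
      ((hasDerivAt_id t).sub_const a).const_add _
    constructor
    · exact (this.1.comp t hs).congr_deriv (mul_one _)
    · exact (this.2.comp t hs).congr_deriv (mul_one _)
  refine ⟨exists_lipschitzOnWith hx.continuousOn (S.q.cont.comp hy).continuousOn hC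
    fun t ht htC => (hd t ht htC).1, exists_lipschitzOnWith hy.continuousOn
    (S.p.cont.comp hx).neg.continuousOn hC fun t ht htC => (hd t ht htC).2, C, hC, hd⟩

/-- There is a solution from `z` to `w` in time `τ` along a level line, whose first component has
`n` zeros inside and whose second one has `n + 1` zeros. -/
def TwistConn (n : ℕ) (τ : ℝ) (z w : ℝ × ℝ) : Prop :=
  ∀ a, ∃ u, IsSol S.p.f S.q.f u a (a + τ) ∧ u a = z ∧ u (a + τ) = w ∧
    zeros (fun r => (u r).1) (Ioo a (a + τ)) = n ∧
    zeros (fun r => (u r).2) (Icc a (a + τ)) = ((n + 1 : ℕ) : ℕ∞) ∧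
    ∀ t, S.level (u t) = S.level z

theorem zeros_congr {f g : ℝ → ℝ} (h : ∀ t, f t = 0 ↔ g t = 0) (s : Set ℝ) :
    zeros f s = zeros g s := by
  unfold zeros; simp only [h]

/-- Paths between two levels with different rotation are stretched across a quadrant. -/
theorem exists_twist {l L : ℕ} (hl : 0 < l) (hlL : l ≤ L) {τ d e s₀ s₁ : ℝ} (hτ : 0 < τ)
    (hs : s₀ ≤ s₁) {γ : ℝ → ℝ × ℝ} (hγ : ContinuousOn γ (Icc s₀ s₁))
    (hq : ∀ s ∈ Icc s₀ s₁, InFirst l (γ s)) (hpos : ∀ s ∈ Icc s₀ s₁, 0 < S.level (γ s))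
    (hde : S.level (γ s₀) = d ∧ S.level (γ s₁) = e ∨ S.level (γ s₁) = d ∧ S.level (γ s₀) = e)
    (hd : ∑ i ∈ Finset.range (2 * l + 1), (rot^[i] S).Q d + τ <
      ∑ i ∈ Finset.range (2 * L + 1), (rot^[i] S).Q d)
    (he : ∑ i ∈ Finset.range (2 * L + 2), (rot^[i] S).Q e <
      ∑ i ∈ Finset.range (2 * l), (rot^[i] S).Q e + τ) :
    ∃ s₀' s₁' : ℝ, s₀ ≤ s₀' ∧ s₀' < s₁' ∧ s₁' ≤ s₁ ∧ ∃ δ : ℝ → ℝ × ℝ,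
      ContinuousOn δ (Icc s₀' s₁') ∧
      (∀ s ∈ Icc s₀' s₁', InFourth L (δ s) ∧ S.level (δ s) = S.level (γ s) ∧
        S.level (γ s) ≠ d ∧ S.level (γ s) ≠ e ∧ S.TwistConn (L - l) τ (γ s) (δ s)) ∧
      ((δ s₀').2 = 0 ∧ (δ s₁').1 = 0 ∨ (δ s₁').2 = 0 ∧ (δ s₀').1 = 0) := by
  have hpi := pi_pos
  -- Large enough for all angles up to `(2 * L + 2) * (π / 2)` to lie strictly within the range
  -- where `N` is the true travel time.
  set K := 2 * L + 4 with hK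
  set Ψ : ℝ → ℝ := fun s => S.Θ K (S.level (γ s))
    (S.N K (S.level (γ s)) (S.angle l (γ s)) + τ) with hΨ
  have hlev : ContinuousOn (fun s => S.level (γ s)) (Icc s₀ s₁) :=
    S.continuous_level.comp_continuousOn hγ
  have hang : ContinuousOn (fun s => S.angle l (γ s)) (Icc s₀ s₁) :=
    (S.continuousOn_angle l).comp hγ hpos
  have hΨc : ContinuousOn Ψ (Icc s₀ s₁) := by
    have hNc : ContinuousOn (fun s => S.N K (S.level (γ s)) (S.angle l (γ s))) (Icc s₀ s₁) :=
      (S.continuousOn_N K).comp (f := fun s => (S.level (γ s), S.angle l (γ s)))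
        (hlev.prodMk hang) fun s hs => ⟨hpos s hs, trivial⟩
    exact (S.continuousOn_Θ K).comp
      (f := fun s => (S.level (γ s), S.N K (S.level (γ s)) (S.angle l (γ s)) + τ))
      (hlev.prodMk (hNc.add continuousOn_const)) fun s hs => ⟨hpos s hs, trivial⟩
  -- On level `d` even the most advanced start, at angle `(2 * l + 1) * (π / 2)`, does not reach the
  -- target quadrant.
  have hslow : ∀ s ∈ Icc s₀ s₁, S.level (γ s) = d → Ψ s < (2 * L + 1 : ℕ) * (π / 2) := by
    intro s hs hsd
    have hE := hpos s hs
    rw [← (S.strictMono_N K hE).lt_iff_lt, hΨ]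
    simp only
    rw [N_Θ _ _ hE, S.N_mul_pi_div_two K (by omega), hsd]
    refine lt_of_le_of_lt (add_le_add_left ?_ _) hd
    rw [← S.N_mul_pi_div_two K (j := 2 * l + 1) (by omega)]
    refine (S.strictMono_N K (hsd ▸ hE)).monotone ?_
    refine (S.angle_mem l (γ s)).2.trans_eq ?_
    push_cast; ring
  -- On level `e` even the most delayed start, at angle `l * π`, goes beyond the target quadrant.
  have hfast : ∀ s ∈ Icc s₀ s₁, S.level (γ s) = e → (2 * L + 2 : ℕ) * (π / 2) < Ψ s := by
    intro s hs hsd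
    have hE := hpos s hs
    rw [← (S.strictMono_N K hE).lt_iff_lt, hΨ]
    simp only
    rw [N_Θ _ _ hE, S.N_mul_pi_div_two K (by omega), hsd]
    refine lt_of_lt_of_le he (add_le_add_left ?_ _)
    rw [← S.N_mul_pi_div_two K (j := 2 * l) (by omega)]
    refine (S.strictMono_N K (hsd ▸ hE)).monotone ?_
    refine le_of_eq_of_le ?_ (S.angle_mem l (γ s)).1
    push_cast; ring
  have hm0 : s₀ ∈ Icc s₀ s₁ := ⟨le_rfl, hs⟩
  have hm1 : s₁ ∈ Icc s₀ s₁ := ⟨hs, le_rfl⟩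
  obtain ⟨a, b, ha, hab, hb, hmem, hends⟩ := exists_subinterval hs hΨc
    (A := (2 * L + 1 : ℕ) * (π / 2)) (B := (2 * L + 2 : ℕ) * (π / 2))
    (by push_cast; linarith) (by
      rcases hde with ⟨h1, h2⟩ | ⟨h1, h2⟩
      · exact Or.inl ⟨(hslow _ hm0 h1).le, (hfast _ hm1 h2).le⟩
      · exact Or.inr ⟨(hslow _ hm1 h1).le, (hfast _ hm0 h2).le⟩)
  have hsub : Icc a b ⊆ Icc s₀ s₁ := Icc_subset_Icc ha hb
  have hmem' : ∀ s ∈ Icc a b, Ψ s ∈ Icc (L * π + π / 2) ((L + 1) * π) := by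
    intro s hs
    have := hmem s hs
    push_cast at this
    exact ⟨by linarith [this.1], by linarith [this.2]⟩
  refine ⟨a, b, ha, hab, hb, fun s => (S.X (S.level (γ s)) (Ψ s), S.Y (S.level (γ s)) (Ψ s)),
    ?_, ?_, ?_⟩
  · exact S.continuous_X_Y.comp_continuousOn (f := fun s => (S.level (γ s), Ψ s))
      ((hlev.mono hsub).prodMk (hΨc.mono hsub))
  · intro s hs
    have hE := hpos s (hsub hs)
    have hΨs := hmem' s hs
    refine ⟨S.inFourth_X_Y hE hΨs, S.level_X_Y hE _, fun h => ?_, fun h => ?_, ?_⟩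
    · exact absurd (hslow s (hsub hs) h) (not_lt.2 (hmem s hs).1)
    · exact absurd (hfast s (hsub hs) h) (not_lt.2 (hmem s hs).2)
    · intro t₀
      have hang := S.angle_mem l (γ s)
      obtain ⟨φ, hφc, hφm, hφ0, hφ1, hsol⟩ := S.exists_orbit K (E := S.level (γ s))
        (θ₀ := S.angle l (γ s)) (θ₁ := Ψ s) (a := t₀) (b := t₀ + τ) hE
        (lt_of_lt_of_le (by positivity) hang.1) (by
          rw [hK]; push_cast; linarith [hΨs.2]) (by
          simp only [hΨ]; rw [N_Θ _ _ hE, add_sub_cancel_left])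
      refine ⟨_, hsol, ?_, ?_, ?_, ?_, ?_⟩
      · simp only [hφ0]
        exact S.X_Y_angle (hq s (hsub hs)) hE
      · simp only [hφ1]
      · rw [zeros_congr (g := fun r => sin (φ r)) fun t => S.X_eq_zero hE _,
          zeros_comp_Ioo sin hφc hφm (by linarith), hφ0, hφ1, zeros_sin hang hΨs]
      · rw [zeros_congr (g := fun r => cos (φ r)) fun t => S.Y_eq_zero hE _,
          zeros_comp_Icc cos hφc hφm (by linarith), hφ0, hφ1, zeros_cos hlL hang hΨs]
      · intro t
        exact S.level_X_Y hE _
  · have hma : a ∈ Icc a b := ⟨le_rfl, hab.le⟩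
    have hmb : b ∈ Icc a b := ⟨hab.le, le_rfl⟩
    have hA : ∀ s ∈ Icc a b, Ψ s = (2 * L + 1 : ℕ) * (π / 2) → S.Y (S.level (γ s)) (Ψ s) = 0 := by
      intro s hs h
      rw [S.Y_eq_zero (hpos s (hsub hs)), h, cos_eq_zero_iff]
      exact ⟨L, by push_cast; ring⟩
    have hB : ∀ s ∈ Icc a b, Ψ s = (2 * L + 2 : ℕ) * (π / 2) → S.X (S.level (γ s)) (Ψ s) = 0 := by
      intro s hs h
      rw [S.X_eq_zero (hpos s (hsub hs)), h, sin_eq_zero_iff]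
      exact ⟨L + 1, by push_cast; ring⟩
    rcases hends with ⟨h1, h2⟩ | ⟨h1, h2⟩
    · exact Or.inl ⟨hA a hma h1, hB b hmb h2⟩
    · exact Or.inr ⟨hA b hmb h1, hB a hma h2⟩

end Planar

end SturmLiouville

namespace SturmLiouville

open Filter Topology Real

/-! ### Stretching across a gap, in the upper half-plane. -/

theorem zeros_sin_eq_one {s : Set ℝ} (hs : s ⊆ Ioo (π + π / 2) (2 * π + π / 2))
    (h : 2 * π ∈ s) : zeros sin s = 1 := by
  have hpi := pi_pos
  rw [zeros, encard_eq_one]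
  refine ⟨2 * π, Subset.antisymm ?_ ?_⟩
  · rintro θ ⟨hθ, h0⟩
    obtain ⟨n, rfl⟩ := sin_eq_zero_iff.1 h0
    have := hs hθ
    have h1 : (1 : ℝ) < n := by
      refine lt_of_mul_lt_mul_right (?_ : 1 * π < n * π) hpi.le
      linarith [this.1]
    have h2 : (n : ℝ) < 3 := by
      refine lt_of_mul_lt_mul_right (?_ : n * π < 3 * π) hpi.le
      linarith [this.2]
    have h1' : 1 < n := by exact_mod_cast h1
    have h2' : n < 3 := by exact_mod_cast h2
    have : n = 2 := by omega
    simp [this]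
  · rintro _ rfl
    exact ⟨h, sin_two_pi⟩

theorem zeros_cos_eq_zero {s : Set ℝ} (hs : s ⊆ Ioo (π + π / 2) (2 * π + π / 2)) :
    zeros cos s = 0 := by
  rw [zeros, encard_eq_zero, eq_empty_iff_forall_notMem]
  rintro θ ⟨hθ, h0⟩
  have := hs hθ
  rw [← cos_sub_two_pi] at h0
  exact (cos_pos_of_mem_Ioo ⟨by linarith [this.1], by linarith [this.2]⟩).ne' h0

theorem strictMono_mul_abs : StrictMono fun x : ℝ => x * |x| := by
  intro a b h
  simp only
  rcases le_total 0 a with ha | ha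
  · rw [abs_of_nonneg ha, abs_of_nonneg (by linarith)]; nlinarith
  rcases le_total b 0 with hb | hb
  · rw [abs_of_nonpos ha, abs_of_nonpos hb]; nlinarith
  · rw [abs_of_nonpos ha, abs_of_nonneg hb]
    rcases ha.lt_or_eq with ha | rfl
    · nlinarith
    · nlinarith

namespace Planar

variable (S : Planar)

theorem strictMonoOn_X {E : ℝ} (hE : 0 < E) :
    StrictMonoOn (S.X E) (Icc (π + π / 2) (2 * π + π / 2)) := by
  intro a ha b hb hab
  refine S.p.strictMono_inv (mul_lt_mul_of_pos_left (strictMono_mul_abs ?_) hE)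
  rw [← sin_sub_two_pi a, ← sin_sub_two_pi b]
  exact strictMonoOn_sin ⟨by linarith [ha.1], by linarith [ha.2]⟩
    ⟨by linarith [hb.1], by linarith [hb.2]⟩ (by linarith)

/-- Times in the upper half-plane as integrals along level lines. -/
theorem N_sub_eq_integral {K : ℕ} (hK : 5 ≤ K) {E θ₀ θ₁ : ℝ} (hE : 0 < E)
    (h₀ : θ₀ ∈ Icc (π + π / 2) (2 * π)) (h₁ : θ₁ ∈ Icc (2 * π) (2 * π + π / 2)) :
    S.N K E θ₁ - S.N K E θ₀ =
      ∫ r in S.X E θ₀..S.X E θ₁, 1 / S.q.f (S.q.inv (E - |S.p.sp r|)) := by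
  have hpi := pi_pos
  have X_le : ∀ (S : Planar) (φ : ℝ), S.p.inv (E * sin φ ^ 2) ≤ S.p.inv E := fun S φ =>
    S.p.strictMono_inv.monotone (by nlinarith [sin_sq_le_one φ])
  have X_nonneg : ∀ (S : Planar) (φ : ℝ), 0 ≤ S.p.inv (E * sin φ ^ 2) := fun S φ =>
    S.p.inv_nonneg (by positivity)
  have e1 : S.N K E θ₁ = ∑ i ∈ Finset.range 4, (rot^[i] S).Q E + S.W E (θ₁ - 2 * π) := by
    rw [S.N_quarter K (j := 4) (by omega) E ⟨by push_cast; linarith [h₁.1], by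
      push_cast; linarith [h₁.2]⟩]
    have : (rot^[4]) S = S := by simp [Function.iterate_succ]
    rw [this]
    congr 2; push_cast; ring
  -- The second quadrant is the quarter turn of index `3`. Reversing time by `W_swap` measures it
  -- backwards from the positive `y`-axis, which is a first quadrant for the system with `p`
  -- reflected.
  have e0 : S.N K E θ₀ = ∑ i ∈ Finset.range 4, (rot^[i] S).Q E -
      (Planar.mk S.p.ref S.q).W E (2 * π - θ₀) := by
    rw [S.N_quarter K (j := 3) (by omega) E ⟨by push_cast; linarith [h₀.1], by
      push_cast; linarith [h₀.2]⟩, W_swap, Finset.sum_range_succ _ 3]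
    have : ((rot^[3]) S).swap = Planar.mk S.p.ref S.q := by
      simp [Function.iterate_succ, rot, swap]
    rw [this]
    have : π / 2 - (θ₀ - (3 : ℕ) * (π / 2)) = 2 * π - θ₀ := by push_cast; ring
    rw [this]; ring
  have hs1 : 0 ≤ sin θ₁ := by
    rw [← sin_sub_two_pi]
    exact sin_nonneg_of_nonneg_of_le_pi (by linarith [h₁.1]) (by linarith [h₁.2])
  have hs0 : sin θ₀ ≤ 0 := by
    rw [← sin_sub_two_pi]
    exact sin_nonpos_of_nonpos_of_neg_pi_le (by linarith [h₀.2]) (by linarith [h₀.1])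
  have x1 : S.p.inv (E * sin (θ₁ - 2 * π) ^ 2) = S.X E θ₁ := by
    rw [X, sin_sub_two_pi, abs_of_nonneg hs1, sq]
  have x0 : S.p.ref.inv (E * sin (2 * π - θ₀) ^ 2) = -S.X E θ₀ := by
    rw [Profile.ref_inv, X, sin_two_pi_sub, abs_of_nonpos hs0]; ring_nf
  have v1 := S.V_eq_integral hE (X_nonneg S (θ₁ - 2 * π)) (X_le S _)
  have v0 := (Planar.mk S.p.ref S.q).V_eq_integral hE
    (X_nonneg (Planar.mk S.p.ref S.q) (2 * π - θ₀)) (X_le (Planar.mk S.p.ref S.q) _)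
  have n1 := X_nonneg S (θ₁ - 2 * π)
  have n0 := X_nonneg (Planar.mk S.p.ref S.q) (2 * π - θ₀)
  simp only [x1, x0, Profile.ref_sp] at v1 v0 n1 n0
  have c1 : EqOn (fun r => 1 / S.q.f (S.q.inv (E - S.p.sp r)))
      (fun r => 1 / S.q.f (S.q.inv (E - |S.p.sp r|))) (uIcc 0 (S.X E θ₁)) := by
    intro r hr
    rw [uIcc_of_le n1] at hr
    simp only [abs_of_nonneg (S.p.sp_nonneg hr.1)]
  have c0 : EqOn (fun r => 1 / S.q.f (S.q.inv (E - -S.p.sp (- -r))))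
      (fun r => 1 / S.q.f (S.q.inv (E - |S.p.sp r|))) (uIcc (S.X E θ₀) 0) := by
    intro r hr
    rw [uIcc_of_le (by linarith)] at hr
    simp only [neg_neg, abs_of_nonpos (S.p.sp_nonpos hr.2)]
  have i1 := v1.1.congr (c1.mono uIoc_subset_uIcc)
  have i0 := (IntervalIntegrable.iff_comp_neg (by simp)).1 v0.1
  simp only [neg_zero, neg_neg] at i0
  have i0' : IntervalIntegrable (fun r => 1 / S.q.f (S.q.inv (E - |S.p.sp r|))) volume
      (S.X E θ₀) 0 := by
    refine i0.symm.congr ?_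
    simpa using c0.mono uIoc_subset_uIcc
  rw [← intervalIntegral.integral_add_adjacent_intervals i0' i1, e1, e0, W, W, x1, x0, v1.2, v0.2,
    intervalIntegral.integral_congr c1, ← intervalIntegral.integral_congr c0,
    intervalIntegral.integral_comp_neg (fun r => 1 / S.q.f (S.q.inv (E - -S.p.sp (-r)))), neg_zero]
  ring

theorem exists_angle_left {E x : ℝ} (hx : x ≤ 0) (hE : 0 < E) (h : |S.p.sp x| ≤ E) :
    ∃ θ ∈ Icc (π + π / 2) (2 * π), S.X E θ = x := by
  have hl : S.level (x, S.q.inv (E - |S.p.sp x|)) = E := by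
    rw [level, Profile.sp_inv, abs_of_nonneg (sub_nonneg.2 h)]; ring
  have hq : InFourth 1 (x, S.q.inv (E - |S.p.sp x|)) :=
    ⟨by simpa using hx, by simpa using S.q.inv_nonneg (sub_nonneg.2 h)⟩
  refine ⟨S.angle' 1 (x, S.q.inv (E - |S.p.sp x|)), ?_, ?_⟩
  · have := S.angle'_mem 1 (x, S.q.inv (E - |S.p.sp x|))
    push_cast at this
    exact ⟨by linarith [this.1], by linarith [this.2]⟩
  · have := S.X_Y_angle' hq (by rwa [hl])
    rw [hl] at this
    exact congrArg Prod.fst this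

theorem exists_angle_right {E x : ℝ} (hx : 0 ≤ x) (hE : 0 < E) (h : |S.p.sp x| ≤ E) :
    ∃ θ ∈ Icc (2 * π) (2 * π + π / 2), S.X E θ = x := by
  have hl : S.level (x, S.q.inv (E - |S.p.sp x|)) = E := by
    rw [level, Profile.sp_inv, abs_of_nonneg (sub_nonneg.2 h)]; ring
  have hq : InFirst 2 (x, S.q.inv (E - |S.p.sp x|)) :=
    ⟨by simpa using hx, by simpa using S.q.inv_nonneg (sub_nonneg.2 h)⟩
  refine ⟨S.angle 2 (x, S.q.inv (E - |S.p.sp x|)), ?_, ?_⟩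
  · have := S.angle_mem 2 (x, S.q.inv (E - |S.p.sp x|))
    push_cast at this
    exact this
  · have := S.X_Y_angle hq (by rwa [hl])
    rw [hl] at this
    exact congrArg Prod.fst this

/-- There is a solution from `z` to `w` in time `τ` along a level line; if `z` and `w` lie
strictly outside the inner boundaries then it stays off the axis `y = 0` and crosses the axis
`x = 0` exactly once, inside. -/
def GapConn (strict : Prop) (τ : ℝ) (z w : ℝ × ℝ) : Prop :=
  ∀ a, ∃ u, IsSol S.p.f S.q.f u a (a + τ) ∧ u a = z ∧ u (a + τ) = w ∧
    (strict → zeros (fun r => (u r).1) (Ioo a (a + τ)) = 1 ∧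
      zeros (fun r => (u r).1) (Icc a (a + τ)) = 1 ∧
      zeros (fun r => (u r).2) (Icc a (a + τ)) = 0) ∧
    ∀ t, S.level (u t) = S.level z

/-- Bounds that make the level `c` cross both annuli in the upper half-plane. -/
structure CrossLevel (G₀ G₁ : ℝ → ℝ) (b₀ B₀ b₁ B₁ c : ℝ) : Prop where
  pos : 0 < c
  le₀ : c ≤ b₀
  le₁ : c ≤ b₁
  lt₀ : B₀ - c < G₀ (S.p.inv (-c))
  lt₁ : B₁ - c < G₁ (S.p.inv c)

/-- The leftmost point of the level `c` lies beyond the outer boundary, so an abscissa whose energy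
is within that boundary is strictly inside the level. -/
theorem CrossLevel.abs_left {S : Planar} {G₀ G₁ : ℝ → ℝ} {b₀ B₀ b₁ B₁ c x : ℝ}
    (h : S.CrossLevel G₀ G₁ b₀ B₀ b₁ B₁ c) (hG : StrictAntiOn G₀ (Iic 0)) (hx : x ≤ 0)
    (hxG : G₀ x ≤ B₀ - c) : |S.p.sp x| < c := by
  have hn : S.p.inv (-c) ≤ 0 := by
    simpa using S.p.strictMono_inv.monotone (by linarith [h.pos] : -c ≤ 0)
  have h1 : S.p.inv (-c) < x := (hG.lt_iff_gt hx hn).1 (hxG.trans_lt h.lt₀)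
  have h2 := S.p.strictMono_sp h1
  rw [Profile.sp_inv] at h2
  rw [abs_of_nonpos (S.p.sp_nonpos hx)]
  linarith

theorem CrossLevel.abs_right {S : Planar} {G₀ G₁ : ℝ → ℝ} {b₀ B₀ b₁ B₁ c x : ℝ}
    (h : S.CrossLevel G₀ G₁ b₀ B₀ b₁ B₁ c) (hG : StrictMonoOn G₁ (Ici 0)) (hx : 0 ≤ x)
    (hxG : G₁ x ≤ B₁ - c) : |S.p.sp x| < c := by
  have h1 : x < S.p.inv c := (hG.lt_iff_lt hx (S.p.inv_nonneg h.pos.le)).1 (hxG.trans_lt h.lt₁)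
  have h2 := S.p.strictMono_sp h1
  rw [Profile.sp_inv] at h2
  rwa [abs_of_nonneg (S.p.sp_nonneg hx)]

/-- Paths between the axes in the second quadrant are stretched across an annulus in the first
quadrant. -/
theorem exists_gap {G₀ G₁ : ℝ → ℝ} (hG₀ : StrictAntiOn G₀ (Iic 0)) (hG₀0 : G₀ 0 = 0)
    (hG₁ : StrictMonoOn G₁ (Ici 0)) (hG₁0 : G₁ 0 = 0) (hG₁c : Continuous G₁)
    {τ b₀ B₀ b₁ B₁ d e s₀ s₁ : ℝ} (hτ : 0 < τ) (hB₀ : b₀ ≤ B₀) (hB₁ : b₁ < B₁) (hs : s₀ ≤ s₁)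
    {γ : ℝ → ℝ × ℝ} (hγ : ContinuousOn γ (Icc s₀ s₁))
    (hq : ∀ s ∈ Icc s₀ s₁, InFourth 1 (γ s))
    (hb : ∀ s ∈ Icc s₀ s₁, b₀ ≤ S.level (γ s) + G₀ (γ s).1)
    (hB : ∀ s ∈ Icc s₀ s₁, S.level (γ s) + G₀ (γ s).1 ≤ B₀)
    (hends : (γ s₀).2 = 0 ∧ (γ s₁).1 = 0 ∨ (γ s₁).2 = 0 ∧ (γ s₀).1 = 0)
    (hde : d ≠ e) (hd : S.CrossLevel G₀ G₁ b₀ B₀ b₁ B₁ d) (he : S.CrossLevel G₀ G₁ b₀ B₀ b₁ B₁ e)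
    {xl xr : ℝ} (hxl : xl ≤ 0) (hxl' : G₀ xl = b₀ - d) (hxr : 0 ≤ xr) (hxr' : G₁ xr = b₁ - d)
    (hdτ : τ ≤ ∫ r in xl..xr, 1 / S.q.f (S.q.inv (d - |S.p.sp r|)))
    {yl yr : ℝ} (hyl : yl ≤ 0) (hyl' : G₀ yl = B₀ - e) (hyr : 0 ≤ yr) (hyr' : G₁ yr = B₁ - e)
    (heτ : ∫ r in yl..yr, 1 / S.q.f (S.q.inv (e - |S.p.sp r|)) ≤ τ) :
    ∃ s₀' s₁' : ℝ, s₀ ≤ s₀' ∧ s₀' < s₁' ∧ s₁' ≤ s₁ ∧ ∃ δ : ℝ → ℝ × ℝ,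
      ContinuousOn δ (Icc s₀' s₁') ∧
      (∀ s ∈ Icc s₀' s₁', InFirst 2 (δ s) ∧ S.level (γ s) ≤ b₁ ∧
        S.level (δ s) + G₁ (δ s).1 ∈ Icc b₁ B₁ ∧
        S.GapConn (b₀ < S.level (γ s) + G₀ (γ s).1 ∧ b₁ < S.level (δ s) + G₁ (δ s).1) τ
          (γ s) (δ s)) ∧
      (S.level (δ s₀') + G₁ (δ s₀').1 = b₁ ∧ S.level (δ s₁') + G₁ (δ s₁').1 = B₁ ∨
        S.level (δ s₁') + G₁ (δ s₁').1 = b₁ ∧ S.level (δ s₀') + G₁ (δ s₀').1 = B₁) := by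
  have hpi := pi_pos
  set K := 6 with hK
  have hlev : ContinuousOn (fun s => S.level (γ s)) (Icc s₀ s₁) :=
    S.continuous_level.comp_continuousOn hγ
  have hx0 : ∀ s ∈ Icc s₀ s₁, (γ s).1 ≤ 0 := fun s hs => by simpa using (hq s hs).1
  -- On the axis `y = 0` the level is below `d` and `e`: otherwise the point would be too far to the
  -- left for the outer boundary. On the axis `x = 0` the level is at least `b₀`, hence at least `d`
  -- and `e`. So the path has to run through all levels between them.
  have haxis : ∀ s ∈ Icc s₀ s₁, (γ s).2 = 0 → ∀ c, S.CrossLevel G₀ G₁ b₀ B₀ b₁ B₁ c →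
      S.level (γ s) < c := by
    intro s hs hy c hc
    have hl : S.level (γ s) = |S.p.sp (γ s).1| := by simp [level, hy]
    by_contra! h
    have := hc.abs_left hG₀ (hx0 s hs) (by linarith [hB s hs])
    linarith
  have haxis' : ∀ s ∈ Icc s₀ s₁, (γ s).1 = 0 → b₀ ≤ S.level (γ s) := by
    intro s hs hx
    have := hb s hs
    rwa [hx, hG₀0, add_zero] at this
  have hm0 : s₀ ∈ Icc s₀ s₁ := ⟨le_rfl, hs⟩
  have hm1 : s₁ ∈ Icc s₀ s₁ := ⟨hs, le_rfl⟩
  -- restriction to the levels between `d` and `e`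
  obtain ⟨a, b, ha, hab, hbs, hmem, hE⟩ := exists_subinterval hs hlev (A := min d e)
    (B := max d e) (min_lt_max.2 hde) (by
      rcases hends with ⟨h1, h2⟩ | ⟨h1, h2⟩
      · exact Or.inl ⟨(lt_min (haxis _ hm0 h1 d hd) (haxis _ hm0 h1 e he)).le,
          (max_le hd.le₀ he.le₀).trans (haxis' _ hm1 h2)⟩
      · exact Or.inr ⟨(lt_min (haxis _ hm1 h1 d hd) (haxis _ hm1 h1 e he)).le,
          (max_le hd.le₀ he.le₀).trans (haxis' _ hm0 h2)⟩)
  have hsub : Icc a b ⊆ Icc s₀ s₁ := Icc_subset_Icc ha hbs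
  have hmin : S.CrossLevel G₀ G₁ b₀ B₀ b₁ B₁ (min d e) := by
    rcases min_choice d e with h | h <;> rw [h] <;> assumption
  have hpos : ∀ s ∈ Icc a b, 0 < S.level (γ s) := fun s hs =>
    hmin.pos.trans_le (hmem s hs).1
  set Ψ : ℝ → ℝ := fun s => S.Θ K (S.level (γ s))
    (S.N K (S.level (γ s)) (S.angle' 1 (γ s)) + τ) with hΨ
  have hlev' := hlev.mono hsub
  have hang : ContinuousOn (fun s => S.angle' 1 (γ s)) (Icc a b) :=
    (S.continuousOn_angle' 1).comp (hγ.mono hsub) hpos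
  have hΨc : ContinuousOn Ψ (Icc a b) := by
    have hNc : ContinuousOn (fun s => S.N K (S.level (γ s)) (S.angle' 1 (γ s))) (Icc a b) :=
      (S.continuousOn_N K).comp (f := fun s => (S.level (γ s), S.angle' 1 (γ s)))
        (hlev'.prodMk hang) fun s hs => ⟨hpos s hs, trivial⟩
    exact (S.continuousOn_Θ K).comp
      (f := fun s => (S.level (γ s), S.N K (S.level (γ s)) (S.angle' 1 (γ s)) + τ))
      (hlev'.prodMk (hNc.add continuousOn_const)) fun s hs => ⟨hpos s hs, trivial⟩
  have hNΨ : ∀ s ∈ Icc a b, S.N K (S.level (γ s)) (Ψ s) =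
      S.N K (S.level (γ s)) (S.angle' 1 (γ s)) + τ := fun s hs => by
    simp only [hΨ]; rw [N_Θ _ _ (hpos s hs)]
  have hangm : ∀ s, S.angle' 1 (γ s) ∈ Icc (π + π / 2) (2 * π) := fun s => by
    have := S.angle'_mem 1 (γ s)
    push_cast at this
    exact ⟨by linarith [this.1], by linarith [this.2]⟩
  have hXY : ∀ s ∈ Icc a b, (S.X (S.level (γ s)) (S.angle' 1 (γ s)),
      S.Y (S.level (γ s)) (S.angle' 1 (γ s))) = γ s := fun s hs =>
    S.X_Y_angle' (hq s (hsub hs)) (hpos s hs)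
  have hX : ∀ s ∈ Icc a b, S.X (S.level (γ s)) (S.angle' 1 (γ s)) = (γ s).1 := fun s hs =>
    congrArg Prod.fst (hXY s hs)
  -- The abscissa is monotone in the angle only near the first quadrant of the arrival, so the final
  -- angle is clamped to it.
  set cl : ℝ → ℝ := fun θ => min (max θ (2 * π)) (2 * π + π / 2) with hcl
  have hclc : Continuous cl := by fun_prop
  have hclm : ∀ θ, cl θ ∈ Icc (2 * π) (2 * π + π / 2) := fun θ =>
    ⟨le_min (le_max_right _ _) (by linarith), min_le_right _ _⟩
  have hI : Icc (2 * π) (2 * π + π / 2) ⊆ Icc (π + π / 2) (2 * π + π / 2) :=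
    Icc_subset_Icc_left (by linarith)
  have hI' : Icc (π + π / 2) (2 * π) ⊆ Icc (π + π / 2) (2 * π + π / 2) :=
    Icc_subset_Icc_right (by linarith)
  have hX2pi : ∀ E, 0 < E → S.X E (2 * π) = 0 := fun E hE => by
    rw [S.X_eq_zero hE, sin_two_pi]
  have hXnonneg : ∀ E, 0 < E → ∀ θ ∈ Icc (2 * π) (2 * π + π / 2), 0 ≤ S.X E θ := by
    intro E hE θ hθ
    rw [← hX2pi E hE]
    exact (S.strictMonoOn_X hE).monotoneOn (hI ⟨le_rfl, by linarith⟩) (hI hθ) hθ.1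
  -- The energy at the arrival with respect to the next annulus, with a penalty if the angle `2 * π`
  -- has not been reached. The penalty excludes orbits still in the second quadrant from `[b₁, B₁]`.
  set Φ : ℝ → ℝ := fun s => S.level (γ s) + G₁ (S.X (S.level (γ s)) (cl (Ψ s))) +
    min (Ψ s - 2 * π) 0 with hΦ
  have hΦc : ContinuousOn Φ (Icc a b) := by
    have h1 : ContinuousOn (fun s => S.X (S.level (γ s)) (cl (Ψ s))) (Icc a b) :=
      (continuous_fst.comp S.continuous_X_Y).comp_continuousOn
        (f := fun s => (S.level (γ s), cl (Ψ s))) (hlev'.prodMk (hclc.comp_continuousOn hΨc))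
    exact (hlev'.add (hG₁c.comp_continuousOn h1)).add
      ((hΨc.sub continuousOn_const).inf continuousOn_const)
  -- the two ends
  have hdend : ∀ s ∈ Icc a b, S.level (γ s) = d → Φ s ≤ b₁ := by
    intro s hs hsd
    have hs' := hsub hs
    obtain ⟨θl, hθl, hθl'⟩ := S.exists_angle_left hxl hd.pos
      (hd.abs_left hG₀ hxl (by linarith)).le
    obtain ⟨θr, hθr, hθr'⟩ := S.exists_angle_right hxr hd.pos
      (hd.abs_right hG₁ hxr (by linarith)).le
    have hint := S.N_sub_eq_integral (K := K) (by omega) hd.pos hθl hθr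
    rw [hθl', hθr'] at hint
    have h1 : (γ s).1 ≤ xl := (hG₀.le_iff_ge hxl (hx0 s hs')).1 (by linarith [hb s hs'])
    have h2 : S.angle' 1 (γ s) ≤ θl := by
      rw [← (S.strictMonoOn_X hd.pos).le_iff_le (hI' (hangm s)) (hI' hθl), hθl', ← hsd, hX s hs]
      exact h1
    have h3 : Ψ s ≤ θr := by
      rw [← (S.strictMono_N K hd.pos).le_iff_le]
      have h4 := hNΨ s hs
      have h5 := (S.strictMono_N K hd.pos).monotone h2
      rw [hsd] at h4
      linarith
    have h4 : S.X d (cl (Ψ s)) ≤ xr := by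
      rw [← hθr']
      refine (S.strictMonoOn_X hd.pos).monotoneOn (hI (hclm _)) (hI hθr) ?_
      exact (min_le_left _ _).trans (max_le h3 hθr.1)
    have h5 := hG₁.monotoneOn (hXnonneg d hd.pos _ (hclm _)) hxr h4
    have h6 := min_le_right (Ψ s - 2 * π) 0
    simp only [hΦ, hsd]
    linarith
  have heend : ∀ s ∈ Icc a b, S.level (γ s) = e → B₁ ≤ Φ s := by
    intro s hs hsd
    have hs' := hsub hs
    obtain ⟨θl, hθl, hθl'⟩ := S.exists_angle_left hyl he.pos
      (he.abs_left hG₀ hyl (by linarith)).le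
    obtain ⟨θr, hθr, hθr'⟩ := S.exists_angle_right hyr he.pos
      (he.abs_right hG₁ hyr (by linarith)).le
    have hint := S.N_sub_eq_integral (K := K) (by omega) he.pos hθl hθr
    rw [hθl', hθr'] at hint
    have h1 : yl ≤ (γ s).1 := (hG₀.le_iff_ge (hx0 s hs') hyl).1 (by linarith [hB s hs'])
    have h2 : θl ≤ S.angle' 1 (γ s) := by
      rw [← (S.strictMonoOn_X he.pos).le_iff_le (hI' hθl) (hI' (hangm s)), hθl', ← hsd, hX s hs]
      exact h1
    have h3 : θr ≤ Ψ s := by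
      rw [← (S.strictMono_N K he.pos).le_iff_le]
      have h4 := hNΨ s hs
      have h5 := (S.strictMono_N K he.pos).monotone h2
      rw [hsd] at h4
      linarith
    have h4 : yr ≤ S.X e (cl (Ψ s)) := by
      rw [← hθr']
      refine (S.strictMonoOn_X he.pos).monotoneOn (hI hθr) (hI (hclm _)) ?_
      exact le_min (h3.trans (le_max_left _ _)) hθr.2
    have h5 := hG₁.monotoneOn hyr (hXnonneg e he.pos _ (hclm _)) h4
    have h6 : min (Ψ s - 2 * π) 0 = 0 := min_eq_right (by linarith [hθr.1])
    simp only [hΦ, hsd, h6]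
    linarith
  have hma : a ∈ Icc a b := ⟨le_rfl, hab.le⟩
  have hmb : b ∈ Icc a b := ⟨hab.le, le_rfl⟩
  obtain ⟨a', b', ha', hab', hb', hmem', hends'⟩ := exists_subinterval hab.le hΦc hB₁ (by
    rcases lt_or_gt_of_ne hde with h | h
    · rw [min_eq_left h.le, max_eq_right h.le] at hE
      rcases hE with ⟨h1, h2⟩ | ⟨h1, h2⟩
      · exact Or.inl ⟨hdend a hma h1, heend b hmb h2⟩
      · exact Or.inr ⟨hdend b hmb h1, heend a hma h2⟩
    · rw [min_eq_right h.le, max_eq_left h.le] at hE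
      rcases hE with ⟨h1, h2⟩ | ⟨h1, h2⟩
      · exact Or.inr ⟨hdend b hmb h2, heend a hma h1⟩
      · exact Or.inl ⟨hdend a hma h2, heend b hmb h1⟩)
  have hsub' : Icc a' b' ⊆ Icc a b := Icc_subset_Icc ha' hb'
  have hle₁ : ∀ s ∈ Icc a b, S.level (γ s) ≤ b₁ := fun s hs =>
    (hmem s hs).2.trans (max_le hd.le₁ he.le₁)
  -- Before `2 * π`, `Φ` is the level, which is at most `b₁`, plus a negative penalty.
  have hΨ0 : ∀ s ∈ Icc a' b', 2 * π ≤ Ψ s := by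
    intro s hs
    by_contra! h
    have h1 : cl (Ψ s) = 2 * π := by
      simp only [hcl]; rw [max_eq_right h.le, min_eq_left (by linarith)]
    have h2 : Φ s = S.level (γ s) + (Ψ s - 2 * π) := by
      simp only [hΦ]
      rw [h1, hX2pi _ (hpos s (hsub' hs)), hG₁0, min_eq_left (by linarith), add_zero]
    linarith [(hmem' s hs).1, hle₁ s (hsub' hs)]
  -- At or beyond `2 * π + π / 2` the clamped point is the rightmost one of its level, whose energy
  -- exceeds `B₁` by `CrossLevel.lt₁`.
  have hΨ1 : ∀ s ∈ Icc a' b', Ψ s < 2 * π + π / 2 := by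
    intro s hs
    by_contra! h
    have hE := hpos s (hsub' hs)
    have h1 : cl (Ψ s) = 2 * π + π / 2 := by
      simp only [hcl]; rw [max_eq_left (by linarith), min_eq_right h]
    have h2 : S.X (S.level (γ s)) (2 * π + π / 2) = S.p.inv (S.level (γ s)) := by
      rw [X, add_comm, sin_add_two_pi, sin_pi_div_two]; simp
    have h3 : Φ s = S.level (γ s) + G₁ (S.p.inv (S.level (γ s))) := by
      simp only [hΦ]
      rw [h1, h2, min_eq_right (by linarith), add_zero]
    have h4 := hG₁.monotoneOn (S.p.inv_nonneg hmin.pos.le) (S.p.inv_nonneg hE.le)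
      (S.p.strictMono_inv.monotone (hmem s (hsub' hs)).1)
    linarith [(hmem' s hs).2, hmin.lt₁, (hmem s (hsub' hs)).1]
  have hΦeq : ∀ s ∈ Icc a' b', Φ s = S.level (γ s) + G₁ (S.X (S.level (γ s)) (Ψ s)) := by
    intro s hs
    have h1 : cl (Ψ s) = Ψ s := by
      simp only [hcl]; rw [max_eq_left (hΨ0 s hs), min_eq_left (hΨ1 s hs).le]
    simp only [hΦ]
    rw [h1, min_eq_right (by linarith [hΨ0 s hs]), add_zero]
  have hΨc' := hΨc.mono hsub'
  clear_value Ψ Φ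
  have hδ : ∀ s ∈ Icc a' b', S.level (S.X (S.level (γ s)) (Ψ s), S.Y (S.level (γ s)) (Ψ s)) +
      G₁ (S.X (S.level (γ s)) (Ψ s)) = Φ s := by
    intro s hs
    rw [S.level_X_Y (hpos s (hsub' hs)), hΦeq s hs]
  refine ⟨a', b', ha.trans ha', hab', hb'.trans hbs,
    fun s => (S.X (S.level (γ s)) (Ψ s), S.Y (S.level (γ s)) (Ψ s)), ?_, ?_, ?_⟩
  · exact S.continuous_X_Y.comp_continuousOn (f := fun s => (S.level (γ s), Ψ s))
      ((hlev'.mono hsub').prodMk hΨc')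
  · intro s hs
    have hE := hpos s (hsub' hs)
    refine ⟨S.inFirst_X_Y hE ⟨by push_cast; exact hΨ0 s hs, by push_cast; exact (hΨ1 s hs).le⟩,
      hle₁ s (hsub' hs), ?_, ?_⟩
    · simp only [hδ s hs]
      exact hmem' s hs
    · intro t₀
      obtain ⟨φ, hφc, hφm, hφ0, hφ1, hsol⟩ := S.exists_orbit K (E := S.level (γ s))
        (θ₀ := S.angle' 1 (γ s)) (θ₁ := Ψ s) (a := t₀) (b := t₀ + τ) hE
        (by linarith [(hangm s).1]) (by
          rw [hK]; push_cast; linarith [hΨ1 s hs]) (by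
          rw [hNΨ s (hsub' hs), add_sub_cancel_left])
      refine ⟨_, hsol, ?_, ?_, ?_, fun t => S.level_X_Y hE _⟩
      · simp only [hφ0]
        exact hXY s (hsub' hs)
      · simp only [hφ1]
      -- The levels in question are at most `b₀` and `b₁`. An endpoint on the axis `x = 0` would
      -- have an energy equal to its level, against the strict inequalities. Thus the crossing of
      -- that axis is interior.
      · rintro ⟨hs0, hs1⟩
        simp only [hδ s hs] at hs1
        have hy : π + π / 2 < S.angle' 1 (γ s) := by
          refine (hangm s).1.lt_of_ne fun h => ?_
          have h1 : (γ s).2 = 0 := by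
            rw [← congrArg Prod.snd (hXY s (hsub' hs)), S.Y_eq_zero hE, ← h, cos_eq_zero_iff]
            exact ⟨1, by push_cast; ring⟩
          exact absurd (hmem s (hsub' hs)).1 (not_le.2 (haxis s (hsub (hsub' hs)) h1 _ hmin))
        have hx : S.angle' 1 (γ s) < 2 * π := by
          refine (hangm s).2.lt_of_ne fun h => ?_
          have h1 := hX s (hsub' hs)
          rw [h, hX2pi _ hE] at h1
          rw [← h1, hG₀0, add_zero] at hs0
          exact absurd ((hmem s (hsub' hs)).2.trans (max_le hd.le₀ he.le₀)) (not_le.2 hs0)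
        have hx' : 2 * π < Ψ s := by
          refine (hΨ0 s hs).lt_of_ne fun h => ?_
          rw [hΦeq s hs, ← h, hX2pi _ hE, hG₁0, add_zero] at hs1
          exact absurd (hle₁ s (hsub' hs)) (not_le.2 hs1)
        have hin : Icc (S.angle' 1 (γ s)) (Ψ s) ⊆ Ioo (π + π / 2) (2 * π + π / 2) :=
          fun θ hθ => ⟨hy.trans_le hθ.1, hθ.2.trans_lt (hΨ1 s hs)⟩
        refine ⟨?_, ?_, ?_⟩
        · rw [zeros_congr (g := fun r => sin (φ r)) fun t => S.X_eq_zero hE _,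
            zeros_comp_Ioo sin hφc hφm (by linarith), hφ0, hφ1]
          exact zeros_sin_eq_one (Ioo_subset_Icc_self.trans hin) ⟨hx, hx'⟩
        · rw [zeros_congr (g := fun r => sin (φ r)) fun t => S.X_eq_zero hE _,
            zeros_comp_Icc sin hφc hφm (by linarith), hφ0, hφ1]
          exact zeros_sin_eq_one hin ⟨hx.le, hx'.le⟩
        · rw [zeros_congr (g := fun r => cos (φ r)) fun t => S.Y_eq_zero hE _,
            zeros_comp_Icc cos hφc hφm (by linarith), hφ0, hφ1]
          exact zeros_cos_eq_zero hin
  · simp only [hδ a' ⟨le_rfl, hab'.le⟩, hδ b' ⟨hab'.le, le_rfl⟩]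
    exact hends'

end Planar

end SturmLiouville

namespace SturmLiouville

open Filter Topology Real

/-! ### Criteria for profiles, and truncation of the switched system. -/

theorem invFunOn_eq_of_unique {f : ℝ → ℝ} {s : Set ℝ} {a b : ℝ} (ha : a ∈ s) (hab : f a = b)
    (h : ∀ x ∈ s, f x = b → x = a) : Function.invFunOn f s b = a :=
  h _ (Function.invFunOn_mem ⟨a, ha, hab⟩) (Function.invFunOn_eq ⟨a, ha, hab⟩)

namespace Profile

theorem tendsto_integral_abs {f : ℝ → ℝ} (hf : Continuous f) {k R : ℝ} (hk : 0 < k)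
    (h : ∀ x, R ≤ x → k ≤ |f x|) : Tendsto (fun x : ℝ => ∫ u in (0 : ℝ)..x, |f u|) atTop atTop := by
  have hl : Tendsto (fun x : ℝ => (∫ u in (0 : ℝ)..R, |f u|) + k * (x - R)) atTop atTop :=
    tendsto_atTop_add_const_left _ _
      ((tendsto_atTop_add_const_right _ _ tendsto_id).const_mul_atTop hk)
  refine tendsto_atTop_mono' _ ?_ hl
  filter_upwards [eventually_ge_atTop R] with x hx
  rw [← intervalIntegral.integral_add_adjacent_intervals (hf.abs.intervalIntegrable 0 R)
    (hf.abs.intervalIntegrable R x)]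
  gcongr
  have : ∫ _ in R..x, k ≤ ∫ u in R..x, |f u| :=
    intervalIntegral.integral_mono_on hx (by simp) (hf.abs.intervalIntegrable R x)
      fun u hu => h u hu.1
  rw [intervalIntegral.integral_const, smul_eq_mul] at this
  linarith

theorem surjective_integral_abs {f : ℝ → ℝ} (hf : Continuous f) {k R : ℝ} (hk : 0 < k)
    (h : ∀ x, R ≤ |x| → k ≤ |f x|) :
    Function.Surjective fun x : ℝ => ∫ u in (0 : ℝ)..x, |f u| := by
  refine Continuous.surjective
    (intervalIntegral.continuous_primitive (fun a b => hf.abs.intervalIntegrable a b) 0)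
    (tendsto_integral_abs hf hk fun x hx => h x (hx.trans (le_abs_self x))) ?_
  have h1 := tendsto_integral_abs (f := fun x => -f (-x)) (hf.comp continuous_neg).neg hk
    (R := R) fun x hx => by
      rw [abs_neg]; exact h _ (hx.trans (by rw [abs_neg]; exact le_abs_self x))
  simp only [integral_abs_ref] at h1
  have h2 := (tendsto_neg_atTop_atBot.comp h1).comp tendsto_neg_atBot_atTop
  refine h2.congr fun x => ?_
  simp

/-- Only the origin matters, where division by zero gives the value `0`; the primitive has to be
negligible compared with `f` there. -/
theorem continuous_integral_div {f : ℝ → ℝ} (hf : Continuous f) (h0 : ∀ x, x ≠ 0 → f x ≠ 0)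
    (h : ∀ ε > 0, ∀ᶠ x in 𝓝 (0 : ℝ), |(∫ u in (0 : ℝ)..x, |f u|)| ≤ ε * |f x|) :
    Continuous fun x : ℝ => (∫ u in (0 : ℝ)..x, |f u|) / f x := by
  have hc : Continuous fun x : ℝ => ∫ u in (0 : ℝ)..x, |f u| :=
    intervalIntegral.continuous_primitive (fun a b => hf.abs.intervalIntegrable a b) 0
  refine continuous_iff_continuousAt.2 fun x => ?_
  rcases eq_or_ne x 0 with rfl | hx
  · rw [ContinuousAt, intervalIntegral.integral_same, zero_div, Metric.tendsto_nhds]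
    intro ε hε
    filter_upwards [h (ε / 2) (half_pos hε)] with x hx
    rw [Real.dist_eq, sub_zero, abs_div]
    refine lt_of_le_of_lt (div_le_of_le_mul₀ (abs_nonneg _) (half_pos hε).le hx) (half_lt_self hε)
  · exact hc.continuousAt.div hf.continuousAt (h0 x hx)

end Profile

namespace SwitchedSystem

variable {m : ℕ} (P : SwitchedSystem m)

theorem ordConnected_J : OrdConnected P.J := by
  constructor
  intro a ha b hb c hc
  exact ⟨ha.1.trans_le (by exact_mod_cast hc.1), lt_of_le_of_lt (by exact_mod_cast hc.2) hb.2⟩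

theorem zero_mem_J : (0 : ℝ) ∈ P.J := ⟨by exact_mod_cast P.ρm_neg, by exact_mod_cast P.ρp_pos⟩

theorem strictMonoOn_h : StrictMonoOn P.h P.J := P.h_strictMonoOn

theorem continuousOn_h : ContinuousOn P.h P.J := P.h_continuousOn

theorem g_pos {x : ℝ} (hx : 0 < x) : 0 < P.g x := pos_of_mul_pos_left (P.g_sign x hx.ne') hx.le

theorem g_neg {x : ℝ} (hx : x < 0) : P.g x < 0 := by
  have := P.g_sign x hx.ne
  nlinarith

theorem g_mul_self_nonneg (x : ℝ) : 0 ≤ P.g x * x := by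
  rcases eq_or_ne x 0 with rfl | h
  · simp
  · exact (P.g_sign x h).le

theorem hasDerivAt_G (x : ℝ) : HasDerivAt P.G (P.g x) x :=
  (P.g_continuous.integral_hasStrictDerivAt 0 x).hasDerivAt

theorem continuous_G : Continuous P.G :=
  continuous_iff_continuousAt.2 fun x => (P.hasDerivAt_G x).continuousAt

theorem G_zero : P.G 0 = 0 := by simp [G]

theorem strictMonoOn_G : StrictMonoOn P.G (Ici 0) := by
  apply strictMonoOn_of_deriv_pos (convex_Ici 0) P.continuous_G.continuousOn
  intro x hx
  rw [interior_Ici] at hx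
  rw [(P.hasDerivAt_G x).deriv]
  exact P.g_pos hx

theorem strictAntiOn_G : StrictAntiOn P.G (Iic 0) := by
  apply strictAntiOn_of_deriv_neg (convex_Iic 0) P.continuous_G.continuousOn
  intro x hx
  rw [interior_Iic] at hx
  rw [(P.hasDerivAt_G x).deriv]
  exact P.g_neg hx

/-- A level `C` that is attained by `H` at points `ym < 0 < yp`, exclusively. -/
structure Trunc where
  lam_pos : 0 < P.lam
  C : ℝ
  ym : ℝ
  yp : ℝ
  ym_mem : ym ∈ P.J
  yp_mem : yp ∈ P.J
  ym_neg : ym < 0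
  yp_pos : 0 < yp
  C_lt_ym : C < P.H ym
  C_lt_yp : C < P.H yp

theorem exists_trunc (hlam : 0 < P.lam) {C : ℝ} (hC0 : 0 < C) (hC : (C : EReal) < P.Hstar) :
    ∃ D : P.Trunc, D.C = C := by
  rw [Hstar, lt_min_iff, lt_biSup_iff, lt_biSup_iff] at hC
  obtain ⟨⟨ym, hm, hm'⟩, ⟨yp, hp, hp'⟩⟩ := hC
  have hH0 : P.H 0 = 0 := by simp [H]
  have hm'' : C < P.H ym := by exact_mod_cast hm'
  have hp'' : C < P.H yp := by exact_mod_cast hp'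
  -- Neither point is `0`, since `H` vanishes there and `C > 0`.
  refine ⟨⟨hlam, C, ym, yp, hm.1, hp.1, hm.2.lt_of_ne ?_, hp.2.lt_of_ne' ?_, hm'', hp''⟩, rfl⟩ <;>
  · rintro rfl
    linarith

namespace Trunc

variable {P} (D : P.Trunc)

theorem Icc_subset_J : Icc D.ym D.yp ⊆ P.J := P.ordConnected_J.out D.ym_mem D.yp_mem

/-- The function `h`, made constant outside of `[ym, yp]`. -/
noncomputable def hc (y : ℝ) : ℝ := P.h (max D.ym (min y D.yp))

theorem clamp_mem (y : ℝ) : max D.ym (min y D.yp) ∈ Icc D.ym D.yp :=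
  ⟨le_max_left _ _, max_le (D.ym_neg.trans D.yp_pos).le (min_le_right _ _)⟩

theorem hc_eq {y : ℝ} (hy : y ∈ Icc D.ym D.yp) : D.hc y = P.h y := by
  rw [hc, min_eq_left hy.2, max_eq_right hy.1]

theorem continuous_hc : Continuous D.hc :=
  P.continuousOn_h.comp_continuous (by fun_prop) fun y => D.Icc_subset_J (D.clamp_mem y)

theorem monotone_hc : Monotone D.hc := fun a b hab =>
  P.strictMonoOn_h.monotoneOn (D.Icc_subset_J (D.clamp_mem a)) (D.Icc_subset_J (D.clamp_mem b))
    (by gcongr)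

theorem zero_mem : (0 : ℝ) ∈ Icc D.ym D.yp := ⟨D.ym_neg.le, D.yp_pos.le⟩

theorem hc_zero : D.hc 0 = 0 := by rw [D.hc_eq D.zero_mem, P.h_zero]

theorem hc_pos {y : ℝ} (hy : 0 < y) : 0 < D.hc y := by
  have h1 : 0 < max D.ym (min y D.yp) := lt_max_of_lt_right (lt_min hy D.yp_pos)
  have := P.strictMonoOn_h P.zero_mem_J (D.Icc_subset_J (D.clamp_mem y)) h1
  rwa [P.h_zero] at this

theorem hc_neg {y : ℝ} (hy : y < 0) : D.hc y < 0 := by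
  have h1 : max D.ym (min y D.yp) < 0 := max_lt D.ym_neg (min_lt_of_left_lt hy)
  have := P.strictMonoOn_h (D.Icc_subset_J (D.clamp_mem y)) P.zero_mem_J h1
  rwa [P.h_zero] at this

theorem abs_hc_le {u y : ℝ} (h : u ∈ uIcc 0 y) : |D.hc u| ≤ |D.hc y| := by
  rcases le_total 0 y with hy | hy
  · rw [uIcc_of_le hy] at h
    have := D.monotone_hc h.1
    have h2 := D.monotone_hc h.2
    rw [hc_zero] at this
    rwa [abs_of_nonneg this, abs_of_nonneg (this.trans h2)]
  · rw [uIcc_of_ge hy] at h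
    have := D.monotone_hc h.2
    have h2 := D.monotone_hc h.1
    rw [hc_zero] at this
    rw [abs_of_nonpos this, abs_of_nonpos (h2.trans this)]
    linarith

theorem abs_integral_le {f : ℝ → ℝ} {x M : ℝ} (h : ∀ u ∈ uIcc 0 x, |f u| ≤ M) :
    |(∫ u in (0 : ℝ)..x, |f u|)| ≤ M * |x| := by
  have := intervalIntegral.norm_integral_le_of_norm_le_const (f := fun u => |f u|) (a := 0)
    (b := x) (C := M) fun u hu => by
      rw [Real.norm_eq_abs, abs_abs]; exact h u (uIoc_subset_uIcc hu)
  simpa using this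

/-- The profile of the truncated function `h`. -/
noncomputable def hProf : Profile where
  f := D.hc
  cont := D.continuous_hc
  zero := D.hc_zero
  sign x hx := by
    rcases hx.lt_or_gt with h | h
    · exact mul_pos_of_neg_of_neg (D.hc_neg h) h
    · exact mul_pos (D.hc_pos h) h
  surj := by
    refine Profile.surjective_integral_abs D.continuous_hc
      (k := min (D.hc 1) (-D.hc (-1))) (R := 1)
      (lt_min (D.hc_pos one_pos) (neg_pos.2 (D.hc_neg (by norm_num)))) fun x hx => ?_
    rcases le_total 0 x with h | h
    · rw [abs_of_nonneg h] at hx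
      exact (min_le_left _ _).trans ((D.monotone_hc hx).trans (le_abs_self _))
    · rw [abs_of_nonpos h] at hx
      refine (min_le_right _ _).trans ((neg_le_neg (D.monotone_hc ?_)).trans (neg_le_abs _))
      linarith
  quot := by
    refine Profile.continuous_integral_div D.continuous_hc (fun x hx => ?_) fun ε hε => ?_
    · rcases hx.lt_or_gt with h | h
      · exact (D.hc_neg h).ne
      · exact (D.hc_pos h).ne'
    -- By monotonicity `|hc|` on the segment from `0` to `x` is at most `|hc x|`, so the primitive
    -- is at most `|x| |hc x|`.
    · filter_upwards [Metric.ball_mem_nhds (0 : ℝ) hε] with x hx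
      rw [Metric.mem_ball, Real.dist_eq, sub_zero] at hx
      refine (abs_integral_le fun u hu => D.abs_hc_le hu).trans ?_
      rw [mul_comm]
      gcongr

/-- The two summands have the same sign. This is where `lam > 0` enters: it makes the primitive of
`lam x + k g` surjective and negligible compared with the function at `0`, with no growth or
regularity of `g`. -/
theorem lam_mul_abs_le (D : P.Trunc) {k : ℝ} (hk : 0 ≤ k) (x : ℝ) :
    P.lam * |x| ≤ |P.lam * x + k * P.g x| := by
  have hl := D.lam_pos
  rcases lt_trichotomy x 0 with h | rfl | h
  · have := P.g_neg h
    have h2 : k * P.g x ≤ 0 := mul_nonpos_of_nonneg_of_nonpos hk this.le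
    rw [abs_of_neg h, abs_of_nonpos (by nlinarith)]
    nlinarith
  · simp [P.g_zero]
  · have := P.g_pos h
    have h2 : 0 ≤ k * P.g x := mul_nonneg hk this.le
    rw [abs_of_pos h, abs_of_nonneg (by positivity)]
    linarith

/-- The profile of `x ↦ lam * x + k * g x`. -/
noncomputable def fProf (k : ℝ) (hk : 0 ≤ k) : Profile where
  f x := P.lam * x + k * P.g x
  cont := by have := P.g_continuous; fun_prop
  zero := by simp [P.g_zero]
  sign x hx := by
    have h1 := mul_nonneg hk (P.g_mul_self_nonneg x)
    have h2 := mul_pos D.lam_pos (sq_pos_of_ne_zero hx)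
    nlinarith
  surj := by
    refine Profile.surjective_integral_abs (by have := P.g_continuous; fun_prop) D.lam_pos (R := 1)
      fun x hx => ?_
    have := D.lam_mul_abs_le hk x
    nlinarith [D.lam_pos]
  quot := by
    have hcont : Continuous fun x : ℝ => P.lam * x + k * P.g x := by
      have := P.g_continuous; fun_prop
    have hl := D.lam_pos
    refine Profile.continuous_integral_div hcont (fun x hx h0 => ?_) fun ε hε => ?_
    · have := D.lam_mul_abs_le hk x
      rw [h0, abs_zero] at this
      exact absurd this (not_le.2 (mul_pos hl (abs_pos.2 hx)))
    · have h0 : Tendsto (fun x : ℝ => P.lam * x + k * P.g x) (𝓝 0) (𝓝 0) := by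
        simpa [P.g_zero] using hcont.tendsto 0
      obtain ⟨δ, hδ, h⟩ := Metric.tendsto_nhds_nhds.1 h0 (ε * P.lam) (by positivity)
      filter_upwards [Metric.ball_mem_nhds (0 : ℝ) hδ] with x hx
      rw [Metric.mem_ball, Real.dist_eq, sub_zero] at hx
      refine (abs_integral_le (M := ε * P.lam) fun u hu => ?_).trans ?_
      · have hux : |u| ≤ |x| := by
          have := abs_sub_left_of_mem_uIcc hu
          simpa using this
        have := h (x := u) (by rw [Real.dist_eq, sub_zero]; exact hux.trans_lt hx)
        rw [Real.dist_eq, sub_zero] at this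
        exact this.le
      · rw [mul_assoc]
        exact mul_le_mul_of_nonneg_left (D.lam_mul_abs_le hk x) hε.le

/-- The system on `[t i, s i]`, truncated. -/
noncomputable def sys (i : Fin (m + 1)) : Planar := ⟨D.fProf (P.μ i) (P.μ_pos i).le, D.hProf⟩

/-- The system on the gaps, truncated. -/
noncomputable def gapSys : Planar := ⟨D.fProf 0 le_rfl, D.hProf⟩

theorem abs_sp_fProf {k : ℝ} (hk : 0 ≤ k) (x : ℝ) :
    |(D.fProf k hk).sp x| = P.lam / 2 * x ^ 2 + k * P.G x := by
  rw [Profile.abs_sp]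
  change ∫ u in (0 : ℝ)..x, (P.lam * u + k * P.g u) = _
  rw [intervalIntegral.integral_add (Continuous.intervalIntegrable (by fun_prop) _ _)
    ((P.g_continuous.const_mul k).intervalIntegrable _ _),
    intervalIntegral.integral_const_mul, intervalIntegral.integral_const_mul, integral_id, G]
  ring

theorem abs_sp_hProf {y : ℝ} (hy : y ∈ Icc D.ym D.yp) : |D.hProf.sp y| = P.H y := by
  rw [Profile.abs_sp, H]
  refine intervalIntegral.integral_congr fun u hu => D.hc_eq ?_
  exact ordConnected_Icc.uIcc_subset D.zero_mem hy hu

theorem H_strictMonoOn : StrictMonoOn P.H (P.J ∩ Ici 0) := by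
  intro a ha b hb hab
  have hsub : ∀ x ∈ P.J, uIcc 0 x ⊆ P.J := fun x hx => P.ordConnected_J.uIcc_subset P.zero_mem_J hx
  have i1 : IntervalIntegrable P.h volume 0 a :=
    (P.continuousOn_h.mono (hsub a ha.1)).intervalIntegrable
  have i2 : IntervalIntegrable P.h volume a b :=
    (P.continuousOn_h.mono (P.ordConnected_J.uIcc_subset ha.1 hb.1)).intervalIntegrable
  rw [H, H, ← intervalIntegral.integral_add_adjacent_intervals i1 i2]
  refine lt_add_of_pos_right _ (intervalIntegral.intervalIntegral_pos_of_pos_on i2 ?_ hab)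
  intro x hx
  have := P.strictMonoOn_h P.zero_mem_J
    (P.ordConnected_J.out ha.1 hb.1 (Ioo_subset_Icc_self hx)) (ha.2.trans_lt hx.1)
  rwa [P.h_zero] at this

theorem H_strictAntiOn : StrictAntiOn P.H (P.J ∩ Iic 0) := by
  intro a ha b hb hab
  have hsub : ∀ x ∈ P.J, uIcc 0 x ⊆ P.J := fun x hx => P.ordConnected_J.uIcc_subset P.zero_mem_J hx
  have i1 : IntervalIntegrable P.h volume 0 b :=
    (P.continuousOn_h.mono (hsub b hb.1)).intervalIntegrable
  have i2 : IntervalIntegrable P.h volume a b :=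
    (P.continuousOn_h.mono (P.ordConnected_J.uIcc_subset ha.1 hb.1)).intervalIntegrable
  rw [H, H, ← intervalIntegral.integral_add_adjacent_intervals i1 i2.symm,
    intervalIntegral.integral_symm a b, ← intervalIntegral.integral_neg]
  refine lt_add_of_pos_right _ (intervalIntegral.intervalIntegral_pos_of_pos_on i2.neg ?_ hab)
  intro x hx
  have := P.strictMonoOn_h (P.ordConnected_J.out ha.1 hb.1 (Ioo_subset_Icc_self hx)) P.zero_mem_J
    (hx.2.trans_le hb.2)
  rw [P.h_zero] at this
  simpa using this

theorem mem_of_H_le {y : ℝ} (hy : y ∈ P.J) (h : P.H y ≤ D.C) : y ∈ Icc D.ym D.yp := by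
  constructor
  · by_contra! hlt
    have := H_strictAntiOn ⟨hy, (hlt.trans D.ym_neg).le⟩ ⟨D.ym_mem, D.ym_neg.le⟩ hlt
    linarith [D.C_lt_ym]
  · by_contra! hlt
    have := H_strictMonoOn ⟨D.yp_mem, D.yp_pos.le⟩ ⟨hy, (D.yp_pos.trans hlt).le⟩ hlt
    linarith [D.C_lt_yp]

theorem mem_of_abs_sp_le {y : ℝ} (h : |D.hProf.sp y| ≤ D.C) : y ∈ Icc D.ym D.yp := by
  have hm := D.abs_sp_hProf ⟨le_rfl, (D.ym_neg.trans D.yp_pos).le⟩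
  have hp := D.abs_sp_hProf ⟨(D.ym_neg.trans D.yp_pos).le, le_rfl⟩
  rw [abs_of_nonpos (D.hProf.sp_nonpos D.ym_neg.le)] at hm
  rw [abs_of_nonneg (D.hProf.sp_nonneg D.yp_pos.le)] at hp
  rw [abs_le] at h
  constructor
  · by_contra! hlt
    have := D.hProf.strictMono_sp hlt
    linarith [D.C_lt_ym]
  · by_contra! hlt
    have := D.hProf.strictMono_sp hlt
    linarith [D.C_lt_yp]

theorem F_nonneg (D : P.Trunc) (i : Fin (m + 1)) (x : ℝ) : 0 ≤ P.F i x := by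
  rw [F, ← D.abs_sp_fProf (P.μ_pos i).le]
  exact abs_nonneg _

theorem level_sys (i : Fin (m + 1)) {z : ℝ × ℝ} (hz : z.2 ∈ Icc D.ym D.yp) :
    (D.sys i).level z = P.Ham i z := by
  rw [Planar.level, sys, D.abs_sp_fProf, D.abs_sp_hProf hz, Ham, F, add_comm]

theorem mem_of_Ham_le (i : Fin (m + 1)) {z : ℝ × ℝ} (hz : z.2 ∈ P.J) (h : P.Ham i z ≤ D.C) :
    z.2 ∈ Icc D.ym D.yp := by
  refine D.mem_of_H_le hz ?_
  rw [Ham] at h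
  linarith [D.F_nonneg i z.1]

/-- Both parts of the level are nonnegative, so an orbit of level at most `C` stays where the
truncation has not altered `h`. This is how truncated orbits become solutions of the original
system. -/
theorem mem_of_level_le {p : Profile} {z : ℝ × ℝ} (h : (Planar.mk p D.hProf).level z ≤ D.C) :
    z.2 ∈ Icc D.ym D.yp := by
  refine D.mem_of_abs_sp_le ?_
  rw [Planar.level] at h
  linarith [abs_nonneg (p.sp z.1)]

/-! ### Inverse branches -/

theorem inv_mem {e : ℝ} (he : |e| ≤ D.C) : D.hProf.inv e ∈ Icc D.ym D.yp :=
  D.mem_of_abs_sp_le (by rwa [Profile.sp_inv])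

theorem HinvPos_eq {e : ℝ} (h0 : 0 ≤ e) (he : e ≤ D.C) : P.HinvPos e = D.hProf.inv e := by
  have hm := D.inv_mem (e := e) (by rwa [abs_of_nonneg h0])
  have hJ : D.hProf.inv e ∈ P.J ∩ Ici 0 := ⟨D.Icc_subset_J hm, D.hProf.inv_nonneg h0⟩
  have hH : P.H (D.hProf.inv e) = e := by
    rw [← D.abs_sp_hProf hm, Profile.sp_inv, abs_of_nonneg h0]
  refine invFunOn_eq_of_unique hJ hH fun x hx hxe => ?_
  exact H_strictMonoOn.injOn hx hJ (hxe.trans hH.symm)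

theorem HinvNeg_eq {e : ℝ} (h0 : 0 ≤ e) (he : e ≤ D.C) : P.HinvNeg e = D.hProf.inv (-e) := by
  have hm := D.inv_mem (e := -e) (by rwa [abs_neg, abs_of_nonneg h0])
  have hJ : D.hProf.inv (-e) ∈ P.J ∩ Iic 0 := by
    refine ⟨D.Icc_subset_J hm, ?_⟩
    have := D.hProf.strictMono_inv.monotone (neg_nonpos.2 h0)
    rwa [Profile.inv_zero] at this
  have hH : P.H (D.hProf.inv (-e)) = e := by
    rw [← D.abs_sp_hProf hm, Profile.sp_inv, abs_neg, abs_of_nonneg h0]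
  refine invFunOn_eq_of_unique hJ hH fun x hx hxe => ?_
  exact H_strictAntiOn.injOn hx hJ (hxe.trans hH.symm)

theorem h_HinvPos {e : ℝ} (h0 : 0 ≤ e) (he : e ≤ D.C) :
    P.h (P.HinvPos e) = D.hProf.f (D.hProf.inv e) := by
  rw [D.HinvPos_eq h0 he]
  exact (D.hc_eq (D.inv_mem (by rwa [abs_of_nonneg h0]))).symm

theorem h_HinvNeg {e : ℝ} (h0 : 0 ≤ e) (he : e ≤ D.C) :
    -P.h (P.HinvNeg e) = D.hProf.ref.f (D.hProf.ref.inv e) := by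
  rw [D.HinvNeg_eq h0 he, Profile.ref_f, Profile.ref_inv, neg_neg]
  exact congrArg Neg.neg (D.hc_eq (D.inv_mem (by rwa [abs_neg, abs_of_nonneg h0]))).symm

theorem F_of_nonneg (i : Fin (m + 1)) {x : ℝ} (hx : 0 ≤ x) : P.F i x = (D.sys i).p.sp x := by
  rw [F, ← D.abs_sp_fProf (P.μ_pos i).le]
  exact abs_of_nonneg ((D.sys i).p.sp_nonneg hx)

theorem F_of_nonpos (i : Fin (m + 1)) {x : ℝ} (hx : x ≤ 0) : P.F i x = -(D.sys i).p.sp x := by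
  rw [F, ← D.abs_sp_fProf (P.μ_pos i).le]
  exact abs_of_nonpos ((D.sys i).p.sp_nonpos hx)

theorem xPos_eq (i : Fin (m + 1)) {c : ℝ} (hc : 0 < c) : P.xPos i c = (D.sys i).p.inv c := by
  refine invFunOn_eq_of_unique ((D.sys i).p.inv_nonneg hc.le) ?_ fun x hx h => ?_
  · rw [D.F_of_nonneg i ((D.sys i).p.inv_nonneg hc.le), Profile.sp_inv]
  · rw [D.F_of_nonneg i hx] at h
    rw [← h, Profile.inv_sp]

theorem xNeg_eq (i : Fin (m + 1)) {c : ℝ} (hc : 0 < c) : P.xNeg i c = -(D.sys i).p.ref.inv c := by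
  have h0 : -(D.sys i).p.ref.inv c ≤ 0 := neg_nonpos.2 ((D.sys i).p.ref.inv_nonneg hc.le)
  refine invFunOn_eq_of_unique h0 ?_ fun x hx h => ?_
  · rw [D.F_of_nonpos i h0, ← Profile.ref_sp, Profile.sp_inv]
  · rw [D.F_of_nonpos i hx] at h
    have : (D.sys i).p.ref.sp (-x) = c := by rw [Profile.ref_sp, neg_neg, h]
    rw [← this, Profile.inv_sp, neg_neg]

/-! ### Crossing times -/

theorem Q_eq_integral (S : Planar) {E : ℝ} (hE : 0 < E) :
    S.Q E = ∫ r in (0 : ℝ)..S.p.inv E, 1 / S.q.f (S.q.inv (E - S.p.sp r)) :=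
  (S.V_eq_integral hE (S.p.inv_nonneg hE.le) le_rfl).2

theorem range_of_mem (p : Profile) {E r : ℝ} (hE : 0 < E) (hr : r ∈ uIcc 0 (p.inv E)) :
    0 ≤ r ∧ 0 ≤ E - p.sp r ∧ E - p.sp r ≤ E := by
  rw [uIcc_of_le (p.inv_nonneg hE.le)] at hr
  have h1 := p.strictMono_sp.monotone hr.2
  rw [Profile.sp_inv] at h1
  exact ⟨hr.1, by linarith, by linarith [p.sp_nonneg hr.1]⟩

theorem T_I (i : Fin (m + 1)) {c : ℝ} (h0 : 0 < c) (hc : c ≤ D.C) :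
    P.T i .I c = (D.sys i).Q c := by
  rw [Q_eq_integral _ h0, T, D.xPos_eq i h0]
  refine intervalIntegral.integral_congr fun r hr => ?_
  obtain ⟨h1, h2, h3⟩ := range_of_mem _ h0 hr
  rw [D.F_of_nonneg i h1, D.h_HinvPos h2 (h3.trans hc)]
  rfl

/-- A quarter turn brings the fourth quadrant to the first but exchanges the axes; `Q_swap` returns
to the integral in `x`. The quadrant II is treated likewise after a further half-turn. -/
theorem T_IV (i : Fin (m + 1)) {c : ℝ} (h0 : 0 < c) (hc : c ≤ D.C) :
    P.T i .IV c = (D.sys i).rot.Q c := by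
  rw [← Planar.Q_swap, Q_eq_integral _ h0, T, D.xPos_eq i h0]
  refine intervalIntegral.integral_congr fun r hr => ?_
  obtain ⟨h1, h2, h3⟩ := range_of_mem _ h0 hr
  rw [D.F_of_nonneg i h1, D.h_HinvNeg h2 (h3.trans hc)]
  rfl

theorem T_III (i : Fin (m + 1)) {c : ℝ} (h0 : 0 < c) (hc : c ≤ D.C) :
    P.T i .III c = (D.sys i).rot.rot.Q c := by
  rw [Q_eq_integral _ h0, T, D.xNeg_eq i h0, ← neg_zero,
    ← intervalIntegral.integral_comp_neg (fun x => 1 / -P.h (P.HinvNeg (c - P.F i x))), neg_zero]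
  refine intervalIntegral.integral_congr fun r hr => ?_
  obtain ⟨h1, h2, h3⟩ := range_of_mem (D.sys i).p.ref h0 hr
  rw [D.F_of_nonpos i (neg_nonpos.2 h1), ← Profile.ref_sp, D.h_HinvNeg h2 (h3.trans hc)]
  rfl

theorem T_II (i : Fin (m + 1)) {c : ℝ} (h0 : 0 < c) (hc : c ≤ D.C) :
    P.T i .II c = (D.sys i).rot.rot.rot.Q c := by
  rw [← Planar.Q_swap, Q_eq_integral _ h0, T, D.xNeg_eq i h0, ← neg_zero,
    ← intervalIntegral.integral_comp_neg (fun x => 1 / P.h (P.HinvPos (c - P.F i x))), neg_zero]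
  refine intervalIntegral.integral_congr fun r hr => ?_
  obtain ⟨h1, h2, h3⟩ := range_of_mem (D.sys i).p.ref h0 hr
  rw [D.F_of_nonpos i (neg_nonpos.2 h1), ← Profile.ref_sp, D.h_HinvPos h2 (h3.trans hc)]
  simp [Planar.swap, Planar.rot, sys]

end Trunc

end SwitchedSystem

end SturmLiouville

namespace SturmLiouville

open Filter Topology Real

/-! ### From crossing times to numbers of quarter turns, and the gluing of solutions. -/

namespace Planar

variable (S : Planar)

theorem iterate_rot_add_four (j : ℕ) : rot^[j + 4] S = rot^[j] S := by
  rw [Function.iterate_add_apply]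
  congr 1
  simp [Function.iterate_succ]

theorem sum_four (E : ℝ) (n : ℕ) : ∑ i ∈ Finset.range (n + 4), (rot^[i] S).Q E =
    ∑ i ∈ Finset.range n, (rot^[i] S).Q E + ∑ i ∈ Finset.range 4, (rot^[i] S).Q E := by
  induction n with
  | zero => simp
  | succ n ih =>
    rw [Finset.sum_range_succ _ n, show n + 1 + 4 = (n + 4) + 1 by ring, Finset.sum_range_succ, ih,
      iterate_rot_add_four]
    ring

theorem sum_mul_four (E : ℝ) (n k : ℕ) : ∑ i ∈ Finset.range (n + 4 * k), (rot^[i] S).Q E =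
    ∑ i ∈ Finset.range n, (rot^[i] S).Q E + k * ∑ i ∈ Finset.range 4, (rot^[i] S).Q E := by
  induction k with
  | zero => simp
  | succ k ih =>
    rw [show n + 4 * (k + 1) = (n + 4 * k) + 4 by ring, sum_four, ih]
    push_cast; ring

theorem sum_mono {E : ℝ} (hE : 0 < E) {a b : ℕ} (h : a ≤ b) :
    ∑ i ∈ Finset.range a, (rot^[i] S).Q E ≤ ∑ i ∈ Finset.range b, (rot^[i] S).Q E :=
  Finset.sum_le_sum_of_subset_of_nonneg (by simpa using h) fun i _ _ => ((rot^[i] S).Q_pos hE).le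

/-- A start at the end of quarter `2 * l` needs two more quarters and `α` full turns to reach angle
`(2 * l + 3 + 4 * α) * (π / 2)`, which is at or before the entrance to the target quadrant. -/
theorem sum_slow {E τ : ℝ} (hE : 0 < E) {l L α : ℕ}
    (h : τ < (rot^[2 * l + 1] S).Q E + (rot^[2 * l + 2] S).Q E +
      α * ∑ i ∈ Finset.range 4, (rot^[i] S).Q E) (hL : l + 1 + 2 * α ≤ L) :
    ∑ i ∈ Finset.range (2 * l + 1), (rot^[i] S).Q E + τ <
      ∑ i ∈ Finset.range (2 * L + 1), (rot^[i] S).Q E := by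
  refine lt_of_lt_of_le ?_ (S.sum_mono hE (a := 2 * l + 3 + 4 * α) (by omega))
  rw [sum_mul_four, Finset.sum_range_succ _ (2 * l + 2), Finset.sum_range_succ _ (2 * l + 1)]
  linarith

/-- A start at the beginning of quarter `2 * l` covers two quarters and `β` full turns in less than
`τ`, reaching an angle at or beyond the end of the target quadrant. -/
theorem sum_fast {E τ : ℝ} (hE : 0 < E) {l L β : ℕ}
    (h : (rot^[2 * l] S).Q E + (rot^[2 * l + 1] S).Q E +
      β * ∑ i ∈ Finset.range 4, (rot^[i] S).Q E < τ) (hL : L ≤ l + 2 * β) :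
    ∑ i ∈ Finset.range (2 * L + 2), (rot^[i] S).Q E <
      ∑ i ∈ Finset.range (2 * l), (rot^[i] S).Q E + τ := by
  refine lt_of_le_of_lt (S.sum_mono hE (b := 2 * l + 2 + 4 * β) (by omega)) ?_
  rw [sum_mul_four, Finset.sum_range_succ _ (2 * l + 1), Finset.sum_range_succ _ (2 * l)]
  linarith

end Planar

theorem lipschitzOnWith_union {f : ℝ → ℝ} {a b c : ℝ} (hab : a ≤ b) (hbc : b ≤ c)
    (h1 : ∃ K, LipschitzOnWith K f (Icc a b)) (h2 : ∃ K, LipschitzOnWith K f (Icc b c)) :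
    ∃ K, LipschitzOnWith K f (Icc a c) := by
  obtain ⟨K₁, h1⟩ := h1
  obtain ⟨K₂, h2⟩ := h2
  refine ⟨max K₁ K₂, LipschitzOnWith.of_dist_le_mul ?_⟩
  have g1 := (h1.weaken (le_max_left K₁ K₂)).dist_le_mul
  have g2 := (h2.weaken (le_max_right K₁ K₂)).dist_le_mul
  suffices H : ∀ s ∈ Icc a c, ∀ t ∈ Icc a c, s ≤ t →
      dist (f s) (f t) ≤ (max K₁ K₂ : NNReal) * dist s t by
    intro s hs t ht
    rcases le_total s t with h | h
    · exact H s hs t ht h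
    · rw [dist_comm, dist_comm s t]; exact H t ht s hs h
  intro s hs t ht hst
  rcases le_total t b with htb | htb
  · exact g1 s ⟨hs.1, hst.trans htb⟩ t ⟨ht.1, htb⟩
  rcases le_total b s with hsb | hsb
  · exact g2 s ⟨hsb, hs.2⟩ t ⟨htb, ht.2⟩
  refine (dist_triangle _ (f b) _).trans ((add_le_add (g1 s ⟨hs.1, hsb⟩ b ⟨hab, le_rfl⟩)
    (g2 b ⟨le_rfl, hbc⟩ t ⟨htb, ht.2⟩)).trans_eq ?_)
  rw [← mul_add, Real.dist_eq, Real.dist_eq, Real.dist_eq, abs_of_nonpos (by linarith),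
    abs_of_nonpos (by linarith), abs_of_nonpos (by linarith)]
  ring

/-- Point reflection reduces the gaps from IV to III to those from II to I. -/
theorem isSol_neg {p q : Profile} {u : ℝ → ℝ × ℝ} {a b : ℝ} (h : IsSol p.ref.f q.ref.f u a b) :
    IsSol p.f q.f (fun t => -u t) a b := by
  obtain ⟨⟨K₁, h1⟩, ⟨K₂, h2⟩, C, hC, hd⟩ := h
  refine ⟨⟨K₁, ?_⟩, ⟨K₂, ?_⟩, C, hC, fun t ht htC => ?_⟩
  · exact h1.neg
  · exact h2.neg
  · obtain ⟨d1, d2⟩ := hd t ht htC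
    refine ⟨d1.neg.congr_deriv ?_, d2.neg.congr_deriv ?_⟩
    · simp [Profile.ref_f]
    · simp [Profile.ref_f]

namespace SwitchedSystem

variable {m : ℕ} (P : SwitchedSystem m)

theorem strictMono_t : StrictMono P.t := by
  rw [Fin.strictMono_iff_lt_succ]
  exact fun i => (P.t_lt_s _).trans (P.s_lt_t i)

theorem s_lt_t_of_lt {i j : Fin (m + 1)} (h : i < j) : P.s i < P.t j := by
  have hi : i ≠ Fin.last m := (h.trans_le (Fin.le_last j)).ne
  obtain ⟨i, rfl⟩ := Fin.exists_castSucc_eq.2 hi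
  exact (P.s_lt_t i).trans_le (P.strictMono_t.monotone (Fin.castSucc_lt_iff_succ_le.1 h))

theorem a_eq_μ (i : Fin (m + 1)) {r : ℝ} (hr : r ∈ Icc (P.t i) (P.s i)) : P.a r = P.μ i := by
  rw [a, Finset.sum_eq_single i, indicator_of_mem hr]
  · intro j _ hj
    refine indicator_of_notMem (fun hr' => ?_) _
    rcases hj.lt_or_gt with h | h
    · linarith [P.s_lt_t_of_lt h, hr.1, hr'.2]
    · linarith [P.s_lt_t_of_lt h, hr.2, hr'.1]
  · simp

theorem a_eq_zero (i : Fin m) {r : ℝ} (hr : r ∈ Ioo (P.s i.castSucc) (P.t i.succ)) :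
    P.a r = 0 := by
  refine Finset.sum_eq_zero fun j _ => indicator_of_notMem (fun hr' => ?_) _
  rcases lt_or_ge i.castSucc j with h | h
  · have := P.strictMono_t.monotone (Fin.castSucc_lt_iff_succ_le.1 h)
    linarith [hr.2, hr'.1]
  · rcases h.eq_or_lt with rfl | h
    · linarith [hr.1, hr'.2]
    · linarith [P.s_lt_t_of_lt h, P.t_lt_s i.castSucc, hr.1, hr'.2]

/-- `u` is Lipschitz on `[a, b]` and solves the switched system off a countable set. -/
def SolOn (u : ℝ → ℝ × ℝ) (a b : ℝ) : Prop :=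
  (∃ K, LipschitzOnWith K (fun t => (u t).1) (Icc a b)) ∧
  (∃ K, LipschitzOnWith K (fun t => (u t).2) (Icc a b)) ∧
  (∀ t ∈ Icc a b, (u t).2 ∈ P.J) ∧
  ∃ C : Set ℝ, C.Countable ∧ ∀ t ∈ Ioo a b, t ∉ C →
    HasDerivAt (fun t => (u t).1) (P.h (u t).2) t ∧
    HasDerivAt (fun t => (u t).2) (-P.lam * (u t).1 - P.a t * P.g (u t).1) t

variable {P}

theorem lipschitzOnWith_of_eq {f g : ℝ → ℝ} {s : Set ℝ} {K : NNReal} (h : LipschitzOnWith K f s)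
    (he : ∀ t ∈ s, g t = f t) : LipschitzOnWith K g s := fun x hx y hy => by
  rw [he x hx, he y hy]; exact h hx hy

/-- The junction joins the exceptional set, since the weight may jump there. -/
theorem SolOn.glue {u v w : ℝ → ℝ × ℝ} {a b c : ℝ} (hab : a ≤ b) (hbc : b ≤ c)
    (hu : P.SolOn u a b) (hv : P.SolOn v b c) (hwu : ∀ t ≤ b, w t = u t)
    (hwv : ∀ t, b ≤ t → w t = v t) : P.SolOn w a c := by
  obtain ⟨⟨K₁, h1⟩, ⟨K₂, h2⟩, hJ, C, hC, hd⟩ := hu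
  obtain ⟨⟨K₁', h1'⟩, ⟨K₂', h2'⟩, hJ', C', hC', hd'⟩ := hv
  refine ⟨lipschitzOnWith_union hab hbc ⟨K₁, ?_⟩ ⟨K₁', ?_⟩,
    lipschitzOnWith_union hab hbc ⟨K₂, ?_⟩ ⟨K₂', ?_⟩, fun t ht => ?_,
    C ∪ C' ∪ {b}, (hC.union hC').union (countable_singleton b), fun t ht htC => ?_⟩
  · exact lipschitzOnWith_of_eq h1 fun t ht => by rw [hwu t ht.2]
  · exact lipschitzOnWith_of_eq h1' fun t ht => by rw [hwv t ht.1]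
  · exact lipschitzOnWith_of_eq h2 fun t ht => by rw [hwu t ht.2]
  · exact lipschitzOnWith_of_eq h2' fun t ht => by rw [hwv t ht.1]
  · rcases le_total t b with htb | htb
    · rw [hwu t htb]; exact hJ t ⟨ht.1, htb⟩
    · rw [hwv t htb]; exact hJ' t ⟨htb, ht.2⟩
  · simp only [mem_union, mem_singleton_iff, not_or] at htC
    rcases lt_or_gt_of_ne htC.2 with htb | htb
    · obtain ⟨d1, d2⟩ := hd t ⟨ht.1, htb⟩ htC.1.1
      have he : ∀ᶠ r in 𝓝 t, w r = u r := by
        filter_upwards [gt_mem_nhds htb] with r hr using hwu r (le_of_lt hr)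
      rw [he.self_of_nhds]
      exact ⟨d1.congr_of_eventuallyEq (he.mono fun r hr => by simp only [hr]),
        d2.congr_of_eventuallyEq (he.mono fun r hr => by simp only [hr])⟩
    · obtain ⟨d1, d2⟩ := hd' t ⟨htb, ht.2⟩ htC.1.2
      have he : ∀ᶠ r in 𝓝 t, w r = v r := by
        filter_upwards [lt_mem_nhds htb] with r hr using hwv r (le_of_lt hr)
      rw [he.self_of_nhds]
      exact ⟨d1.congr_of_eventuallyEq (he.mono fun r hr => by simp only [hr]),
        d2.congr_of_eventuallyEq (he.mono fun r hr => by simp only [hr])⟩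

/-- Lipschitz functions are absolutely continuous, and countable sets are null; the two endpoints
are added to the exceptional set. -/
theorem SolOn.isSolution {u : ℝ → ℝ × ℝ} (hL : 0 ≤ P.L) (hu : P.SolOn u 0 P.L) :
    P.IsSolution u := by
  obtain ⟨⟨K₁, h1⟩, ⟨K₂, h2⟩, hJ, C, hC, hd⟩ := hu
  refine ⟨LipschitzOnWith.absolutelyContinuousOnInterval (K := K₁) (by rwa [uIcc_of_le hL]),
    LipschitzOnWith.absolutelyContinuousOnInterval (K := K₂) (by rwa [uIcc_of_le hL]), hJ, ?_⟩
  have hC' : (C ∪ {0, P.L}).Countable := hC.union (by simp)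
  filter_upwards [hC'.ae_notMem volume] with r hr hrI
  simp only [mem_union, mem_insert_iff, mem_singleton_iff, not_or] at hr
  exact hd r ⟨hrI.1.lt_of_ne' hr.2.1, hrI.2.lt_of_ne hr.2.2⟩ hr.1

namespace Trunc

variable (D : P.Trunc)

theorem solOn_of_isSol {k : ℝ} (hk : 0 ≤ k) {u : ℝ → ℝ × ℝ} {a b : ℝ}
    (h : IsSol (D.fProf k hk).f D.hProf.f u a b)
    (hlev : ∀ t, (Planar.mk (D.fProf k hk) D.hProf).level (u t) ≤ D.C)
    (ha : ∀ t ∈ Ioo a b, P.a t = k) : P.SolOn u a b := by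
  obtain ⟨h1, h2, C, hC, hd⟩ := h
  have hm : ∀ t, (u t).2 ∈ Icc D.ym D.yp := fun t => D.mem_of_level_le (hlev t)
  refine ⟨h1, h2, fun t _ => D.Icc_subset_J (hm t), C, hC, fun t ht htC => ?_⟩
  obtain ⟨d1, d2⟩ := hd t ht htC
  refine ⟨d1.congr_deriv (D.hc_eq (hm t)), d2.congr_deriv ?_⟩
  rw [ha t ht]
  change -(P.lam * (u t).1 + k * P.g (u t).1) = _
  ring

theorem period_eq (i : Fin (m + 1)) {c : ℝ} (h0 : 0 < c) (hc : c ≤ D.C) :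
    P.period i c = ∑ j ∈ Finset.range 4, (Planar.rot^[j] (D.sys i)).Q c := by
  rw [period, D.T_I i h0 hc, D.T_IV i h0 hc, D.T_III i h0 hc, D.T_II i h0 hc]
  simp [Finset.sum_range_succ, Function.iterate_succ]

/-- The number of the half-turn of the angles that are assigned to a first quadrant. -/
def entryTurn : Quadrant → ℕ
  | .I => 2
  | .II => 2
  | .III => 3
  | .IV => 3

/-- The half-turn numbers `2` for I and `3` for III have the parity of the quadrant and are
positive, as is needed for starting angles inside the range where `N` is the true time. The index of
rotation is twice that number. -/
theorem T_entry (i : Fin (m + 1)) {κ : Quadrant} (hκ : κ = .I ∨ κ = .III) {c : ℝ} (h0 : 0 < c)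
    (hc : c ≤ D.C) :
    P.T i κ c = (Planar.rot^[2 * entryTurn κ] (D.sys i)).Q c ∧
    P.T i κ.next c = (Planar.rot^[2 * entryTurn κ + 1] (D.sys i)).Q c ∧
    P.T i κ.next.next c = (Planar.rot^[2 * entryTurn κ + 2] (D.sys i)).Q c := by
  rcases hκ with rfl | rfl <;>
    simp only [Quadrant.next, entryTurn, D.T_I i h0 hc, D.T_IV i h0 hc, D.T_III i h0 hc,
      D.T_II i h0 hc] <;> simp [Function.iterate_succ]

end Trunc

variable (P)

/-- The zeros of the components on `[t i, s i]`, for a solution that goes from the quadrant `κ` to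
the quadrant `ω` with the counter `n`. -/
def LapCount (i : Fin (m + 1)) (κ ω : Quadrant) (n : ℕ) (u : ℝ → ℝ × ℝ) : Prop :=
  (ω = κ.prev →
    zeros (fun r => (u r).1) (Ioo (P.t i) (P.s i)) = ((2 * n - 1 : ℕ) : ℕ∞) ∧
    zeros (fun r => (u r).2) (Icc (P.t i) (P.s i)) = ((2 * n : ℕ) : ℕ∞)) ∧
  (ω = κ.next →
    zeros (fun r => (u r).1) (Ioo (P.t i) (P.s i)) = ((2 * n : ℕ) : ℕ∞) ∧
    zeros (fun r => (u r).2) (Icc (P.t i) (P.s i)) = ((2 * n + 1 : ℕ) : ℕ∞))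

/-- The zeros of the components on the gap between `s i` and `t (i + 1)`. -/
def GapCount (i : Fin m) (u : ℝ → ℝ × ℝ) : Prop :=
  zeros (fun r => (u r).1) (Ioo (P.s i.castSucc) (P.t i.succ)) = 1 ∧
  zeros (fun r => (u r).1) (Icc (P.s i.castSucc) (P.t i.succ)) = 1 ∧
  zeros (fun r => (u r).2) (Icc (P.s i.castSucc) (P.t i.succ)) = 0

variable {P}

theorem inFirst_of_carrier {κ : Quadrant} (hκ : κ = .I ∨ κ = .III) {z : ℝ × ℝ}
    (hz : z ∈ κ.carrier) : InFirst (Trunc.entryTurn κ) z := by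
  rcases hκ with rfl | rfl
  · simpa [InFirst, Trunc.entryTurn, Quadrant.carrier] using hz
  · have h3 : (-1 : ℝ) ^ 3 = -1 := by norm_num
    simpa [InFirst, Trunc.entryTurn, Quadrant.carrier, h3] using hz

theorem carrier_of_inFourth_even {L : ℕ} (hL : Even L) {z : ℝ × ℝ} (hz : InFourth L z) :
    z ∈ Quadrant.carrier .IV := by
  simpa [InFourth, Quadrant.carrier, hL.neg_one_pow] using hz

theorem carrier_of_inFourth_odd {L : ℕ} (hL : Odd L) {z : ℝ × ℝ} (hz : InFourth L z) :
    z ∈ Quadrant.carrier .II := by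
  simpa [InFourth, Quadrant.carrier, hL.neg_one_pow] using hz

namespace Trunc

variable (D : P.Trunc)

/-- Stretching across the annulus `i`. -/
theorem twist_step (i : Fin (m + 1)) {c₁ c₂ : Fin (m + 1) → ℝ} (h0 : 0 < c₁ i)
    (h12 : c₁ i < c₂ i) (hC : c₂ i ≤ D.C) {α β : ℕ} {d e : ℝ}
    (hde : (d = c₁ i ∧ e = c₂ i) ∨ (d = c₂ i ∧ e = c₁ i)) {κ ω : Quadrant}
    (hκ : κ = .I ∨ κ = .III) (hω : ω = .II ∨ ω = .IV) (htw : P.Twist i κ α β d e) {n : ℕ}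
    (hn : α + 1 ≤ n) (hn' : n ≤ β) {γ : ℝ → ℝ × ℝ} {s₀ s₁ : ℝ} (hs : s₀ ≤ s₁)
    (hγ : ContinuousOn γ (Icc s₀ s₁)) (hmem : ∀ s ∈ Icc s₀ s₁, γ s ∈ P.annulus c₁ c₂ i κ)
    (hends : P.Ham i (γ s₀) = c₁ i ∧ P.Ham i (γ s₁) = c₂ i ∨
      P.Ham i (γ s₁) = c₁ i ∧ P.Ham i (γ s₀) = c₂ i) :
    ∃ s₀' s₁' : ℝ, s₀ ≤ s₀' ∧ s₀' < s₁' ∧ s₁' ≤ s₁ ∧ ∃ δ : ℝ → ℝ × ℝ,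
      ContinuousOn δ (Icc s₀' s₁') ∧
      (∀ s ∈ Icc s₀' s₁', δ s ∈ P.annulus c₁ c₂ i ω ∧ c₁ i < P.Ham i (γ s) ∧
        c₁ i < P.Ham i (δ s) ∧ ∃ u, P.SolOn u (P.t i) (P.s i) ∧ u (P.t i) = γ s ∧
          u (P.s i) = δ s ∧ P.LapCount i κ ω n u) ∧
      ((δ s₀').2 = 0 ∧ (δ s₁').1 = 0 ∨ (δ s₁').2 = 0 ∧ (δ s₀').1 = 0) := by
  have hd0 : 0 < d ∧ d ≤ D.C := by rcases hde with ⟨rfl, rfl⟩ | ⟨rfl, rfl⟩ <;> constructor <;> linarith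
  have he0 : 0 < e ∧ e ≤ D.C := by rcases hde with ⟨rfl, rfl⟩ | ⟨rfl, rfl⟩ <;> constructor <;> linarith
  set S := D.sys i with hS
  have hlev : ∀ s ∈ Icc s₀ s₁, S.level (γ s) = P.Ham i (γ s) := fun s hs =>
    D.level_sys i (D.mem_of_Ham_le i (hmem s hs).2.1 ((hmem s hs).2.2.2.trans hC))
  have hm0 : s₀ ∈ Icc s₀ s₁ := ⟨le_rfl, hs⟩
  have hm1 : s₁ ∈ Icc s₀ s₁ := ⟨hs, le_rfl⟩
  -- the half-turn in which the orbits have to end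
  obtain ⟨L, hL1, hL2, hLω, hLn⟩ : ∃ L, entryTurn κ + 1 + 2 * α ≤ L ∧ L ≤ entryTurn κ + 2 * β ∧
      (∀ z, InFourth L z → z ∈ ω.carrier) ∧
      ((ω = κ.prev → L - entryTurn κ = 2 * n - 1) ∧ (ω = κ.next → L - entryTurn κ = 2 * n)) := by
    -- The parity of `L` selects the exit: even for IV, odd for II. Relative to the entry, `2 * n -
    -- 1` half-turns lead to the preceding quadrant and `2 * n` to the following one; `α + 1 ≤ n ≤
    -- β` is exactly what keeps both within the bounds.
    rcases hκ with rfl | rfl <;> rcases hω with rfl | rfl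
    · exact ⟨2 + (2 * n - 1), by simp only [entryTurn]; omega, by simp only [entryTurn]; omega,
        fun z hz => carrier_of_inFourth_odd (by rw [Nat.odd_iff]; omega) hz,
        by simp [Quadrant.prev, Quadrant.next, entryTurn]⟩
    · exact ⟨2 + 2 * n, by simp only [entryTurn]; omega, by simp only [entryTurn]; omega,
        fun z hz => carrier_of_inFourth_even (by rw [Nat.even_iff]; omega) hz,
        by simp [Quadrant.prev, Quadrant.next, entryTurn]⟩
    · exact ⟨3 + 2 * n, by simp only [entryTurn]; omega, by simp only [entryTurn]; omega,
        fun z hz => carrier_of_inFourth_odd (by rw [Nat.odd_iff]; omega) hz,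
        by simp [Quadrant.prev, Quadrant.next, entryTurn]⟩
    · exact ⟨3 + (2 * n - 1), by simp only [entryTurn]; omega, by simp only [entryTurn]; omega,
        fun z hz => carrier_of_inFourth_even (by rw [Nat.even_iff]; omega) hz,
        by simp [Quadrant.prev, Quadrant.next, entryTurn]⟩
  have hl0 : 0 < entryTurn κ := by cases κ <;> simp [entryTurn]
  obtain ⟨hT1, hT2, hT3⟩ := D.T_entry i hκ hd0.1 hd0.2
  obtain ⟨hT1', hT2', hT3'⟩ := D.T_entry i hκ he0.1 he0.2
  have hslow := htw.1
  have hfast := htw.2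
  rw [hT2, hT3, D.period_eq i hd0.1 hd0.2] at hslow
  rw [hT1', hT2', D.period_eq i he0.1 he0.2] at hfast
  have hτ : 0 < P.tau i := sub_pos.2 (P.t_lt_s i)
  obtain ⟨a, b, ha, hab, hb, δ, hδc, hδ, hδe⟩ := S.exists_twist hl0 (L := L) (by omega) hτ hs hγ
    (fun s hs => inFirst_of_carrier hκ (hmem s hs).1)
    (fun s hs => by rw [hlev s hs]; exact h0.trans_le (hmem s hs).2.2.1)
    (d := d) (e := e) (by
      rw [hlev _ hm0, hlev _ hm1]
      rcases hde with ⟨rfl, rfl⟩ | ⟨rfl, rfl⟩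
      · exact hends
      · exact hends.symm.imp And.symm And.symm)
    (S.sum_slow hd0.1 hslow hL1) (S.sum_fast he0.1 hfast hL2)
  refine ⟨a, b, ha, hab, hb, δ, hδc, fun s hs => ?_, hδe⟩
  have hs' : s ∈ Icc s₀ s₁ := ⟨ha.trans hs.1, hs.2.trans hb⟩
  obtain ⟨q1, q2, q3, q4, q5⟩ := hδ s hs
  have hle : S.level (γ s) ≤ D.C := by
    rw [hlev s hs']; exact (hmem s hs').2.2.2.trans hC
  have hmδ : (δ s).2 ∈ Icc D.ym D.yp := D.mem_of_level_le (q2.trans_le hle)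
  have hHam : P.Ham i (δ s) = P.Ham i (γ s) := by
    rw [← D.level_sys i hmδ, ← hlev s hs']; exact q2
  rw [hlev s hs'] at q3 q4
  -- The orbits ending in the target never run on the boundary levels, as the twist inequalities are
  -- strict. The zero counts on the adjacent gaps rely on this.
  have hlt : c₁ i < P.Ham i (γ s) := by
    refine (hmem s hs').2.2.1.lt_of_ne ?_
    rcases hde with ⟨rfl, rfl⟩ | ⟨rfl, rfl⟩
    · exact q3.symm
    · exact q4.symm
  refine ⟨⟨hLω _ q1, D.Icc_subset_J hmδ, ?_, ?_⟩, hlt, hHam ▸ hlt, ?_⟩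
  · rw [hHam]; exact hlt.le
  · rw [hHam]; exact (hmem s hs').2.2.2
  · obtain ⟨u, hu, hu0, hu1, hz1, hz2, hul⟩ := q5 (P.t i)
    have hadd : P.t i + P.tau i = P.s i := by rw [tau]; ring
    rw [hadd] at hu hu1 hz1 hz2
    refine ⟨u, D.solOn_of_isSol (P.μ_pos i).le hu (fun t => (hul t).trans_le hle)
      (fun t ht => P.a_eq_μ i (Ioo_subset_Icc_self ht)), hu0, hu1, fun h => ?_, fun h => ?_⟩
    · rw [hz1, hz2, hLn.1 h]
      refine ⟨rfl, ?_⟩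
      congr 1; omega
    · rw [hz1, hz2, hLn.2 h]
      exact ⟨rfl, rfl⟩

end Trunc

end SwitchedSystem

end SturmLiouville

namespace SturmLiouville

open Filter Topology Real

/-! ### The gaps of the switched system. -/

namespace SwitchedSystem

variable {m : ℕ} {P : SwitchedSystem m}

/-- `G` need not be unbounded: the value is attained because compatibility bounds it by some `G r`,
and then `invFunOn` is a true inverse. -/
theorem xl_spec {j : Fin (m + 1)} {b c r : ℝ} (hr : r ≤ 0) (h0 : c ≤ b)
    (h : (b - c) / P.μ j ≤ P.G r) : P.xl j b c ≤ 0 ∧ P.μ j * P.G (P.xl j b c) = b - c := by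
  have hμ := P.μ_pos j
  have hv : 0 ≤ (b - c) / P.μ j := div_nonneg (sub_nonneg.2 h0) hμ.le
  obtain ⟨x, hx, hxG⟩ := intermediate_value_Icc' hr P.continuous_G.continuousOn
    (mem_Icc.2 ⟨(by rw [P.G_zero]; exact hv : P.G 0 ≤ (b - c) / P.μ j), h⟩)
  have hex : ∃ x ∈ Iic (0 : ℝ), P.G x = (b - c) / P.μ j := ⟨x, hx.2, hxG⟩
  refine ⟨Function.invFunOn_mem hex, ?_⟩
  have := Function.invFunOn_eq hex
  rw [xl, GinvNeg, this, mul_div_cancel₀ _ hμ.ne']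

theorem xr_spec {j : Fin (m + 1)} {b c r : ℝ} (hr : 0 ≤ r) (h0 : c ≤ b)
    (h : (b - c) / P.μ j ≤ P.G r) : 0 ≤ P.xr j b c ∧ P.μ j * P.G (P.xr j b c) = b - c := by
  have hμ := P.μ_pos j
  have hv : 0 ≤ (b - c) / P.μ j := div_nonneg (sub_nonneg.2 h0) hμ.le
  obtain ⟨x, hx, hxG⟩ := intermediate_value_Icc hr P.continuous_G.continuousOn
    (mem_Icc.2 ⟨(by rw [P.G_zero]; exact hv : P.G 0 ≤ (b - c) / P.μ j), h⟩)
  have hex : ∃ x ∈ Ici (0 : ℝ), P.G x = (b - c) / P.μ j := ⟨x, hx.1, hxG⟩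
  refine ⟨Function.invFunOn_mem hex, ?_⟩
  have := Function.invFunOn_eq hex
  rw [xr, GinvPos, this, mul_div_cancel₀ _ hμ.ne']

namespace Trunc

variable (D : P.Trunc)

theorem inv_gapSys {c : ℝ} (hc : 0 ≤ c) : D.gapSys.p.inv c = √(2 * c / P.lam) := by
  have hl := D.lam_pos
  have h : D.gapSys.p.sp (√(2 * c / P.lam)) = c := by
    have := D.abs_sp_fProf le_rfl (√(2 * c / P.lam))
    rw [abs_of_nonneg (Profile.sp_nonneg _ (sqrt_nonneg _)), sq_sqrt (by positivity)] at this
    rw [gapSys, this]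
    field_simp
    ring
  conv_lhs => rw [← h]
  exact Profile.inv_sp _ _

theorem inv_gapSys_neg {c : ℝ} (hc : 0 ≤ c) : D.gapSys.p.inv (-c) = -√(2 * c / P.lam) := by
  have hl := D.lam_pos
  have h : D.gapSys.p.sp (-√(2 * c / P.lam)) = -c := by
    have := D.abs_sp_fProf le_rfl (-√(2 * c / P.lam))
    rw [abs_of_nonpos (Profile.sp_nonpos _ (neg_nonpos.2 (sqrt_nonneg _))), neg_sq,
      sq_sqrt (by positivity)] at this
    rw [gapSys, ← neg_eq_iff_eq_neg, this]
    field_simp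
    ring
  conv_lhs => rw [← h]
  exact Profile.inv_sp _ _

theorem rot_rot_gapSys : D.gapSys.rot.rot = ⟨D.gapSys.p.ref, D.hProf.ref⟩ := rfl

theorem compatible_bounds {c₁ c₂ : Fin (m + 1) → ℝ} {i : Fin m} {c : ℝ}
    (h : P.Compatible c₁ c₂ i c) {j : Fin (m + 1)} (hj : j = i.castSucc ∨ j = i.succ) :
    c ≤ c₁ j ∧ (c₂ j - c) / P.μ j < P.G (-√(2 * c / P.lam)) ∧
      (c₂ j - c) / P.μ j < P.G (√(2 * c / P.lam)) := by
  obtain ⟨h0, h1, h2⟩ := h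
  rw [le_min_iff] at h1
  rw [max_lt_iff, lt_min_iff, lt_min_iff] at h2
  rcases hj with rfl | rfl
  · exact ⟨h1.1, h2.1⟩
  · exact ⟨h1.2, h2.2⟩

theorem crossLevel_upper {c₁ c₂ : Fin (m + 1) → ℝ} {i : Fin m} {c : ℝ}
    (h : P.Compatible c₁ c₂ i c) :
    D.gapSys.CrossLevel (fun x => P.μ i.castSucc * P.G x) (fun x => P.μ i.succ * P.G x)
      (c₁ i.castSucc) (c₂ i.castSucc) (c₁ i.succ) (c₂ i.succ) c := by
  obtain ⟨a1, a2, a3⟩ := compatible_bounds h (Or.inl rfl)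
  obtain ⟨b1, b2, b3⟩ := compatible_bounds h (Or.inr rfl)
  refine ⟨h.1, a1, b1, ?_, ?_⟩
  · rw [D.inv_gapSys_neg h.1.le]
    rwa [div_lt_iff₀' (P.μ_pos _)] at a2
  · rw [D.inv_gapSys h.1.le]
    rwa [div_lt_iff₀' (P.μ_pos _)] at b3

/-- In the half-turned system left and right are exchanged, so the bound at the first annulus is the
one at `√(2 * c / lam)` and the bound at the second the one at `-√(2 * c / lam)`. -/
theorem crossLevel_lower {c₁ c₂ : Fin (m + 1) → ℝ} {i : Fin m} {c : ℝ}
    (h : P.Compatible c₁ c₂ i c) :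
    D.gapSys.rot.rot.CrossLevel (fun x => P.μ i.castSucc * P.G (-x))
      (fun x => P.μ i.succ * P.G (-x))
      (c₁ i.castSucc) (c₂ i.castSucc) (c₁ i.succ) (c₂ i.succ) c := by
  obtain ⟨a1, a2, a3⟩ := compatible_bounds h (Or.inl rfl)
  obtain ⟨b1, b2, b3⟩ := compatible_bounds h (Or.inr rfl)
  refine ⟨h.1, a1, b1, ?_, ?_⟩
  · rw [rot_rot_gapSys, Profile.ref_inv, neg_neg, neg_neg, D.inv_gapSys h.1.le]
    rwa [div_lt_iff₀' (P.μ_pos _)] at a3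
  · rw [rot_rot_gapSys, Profile.ref_inv, neg_neg, D.inv_gapSys_neg h.1.le]
    rwa [div_lt_iff₀' (P.μ_pos _)] at b2

theorem abs_sp_gapSys (x : ℝ) : |D.gapSys.p.sp x| = P.lam / 2 * x ^ 2 := by
  rw [gapSys, D.abs_sp_fProf]; ring

theorem abs_sp_le_of_mem {p : Profile} {a b c r : ℝ} (ha : |p.sp a| ≤ c) (hb : |p.sp b| ≤ c)
    (hr : r ∈ Icc a b) : |p.sp r| ≤ c := by
  rw [abs_le] at *
  exact ⟨ha.1.trans (p.strictMono_sp.monotone hr.1), (p.strictMono_sp.monotone hr.2).trans hb.2⟩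

theorem SUpper_eq {b : Fin (m + 1) → ℝ} {i : Fin m} {c : ℝ} (hc : c ≤ D.C)
    (hl : P.xl i.castSucc (b i.castSucc) c ≤ P.xr i.succ (b i.succ) c)
    (h1 : |D.gapSys.p.sp (P.xl i.castSucc (b i.castSucc) c)| ≤ c)
    (h2 : |D.gapSys.p.sp (P.xr i.succ (b i.succ) c)| ≤ c) :
    P.SUpper b i c = ∫ r in P.xl i.castSucc (b i.castSucc) c..P.xr i.succ (b i.succ) c,
      1 / D.gapSys.q.f (D.gapSys.q.inv (c - |D.gapSys.p.sp r|)) := by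
  refine intervalIntegral.integral_congr fun r hr => ?_
  rw [uIcc_of_le hl] at hr
  have h3 := abs_sp_le_of_mem h1 h2 hr
  simp only [D.abs_sp_gapSys] at h3 ⊢
  rw [D.h_HinvPos (by linarith) (by
    have : 0 ≤ P.lam / 2 * r ^ 2 := by have := D.lam_pos; positivity
    linarith)]
  rfl

theorem SLower_eq {b : Fin (m + 1) → ℝ} {i : Fin m} {c : ℝ} (hc : c ≤ D.C)
    (hl : P.xl i.succ (b i.succ) c ≤ P.xr i.castSucc (b i.castSucc) c)
    (h1 : |D.gapSys.p.sp (P.xl i.succ (b i.succ) c)| ≤ c)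
    (h2 : |D.gapSys.p.sp (P.xr i.castSucc (b i.castSucc) c)| ≤ c) :
    P.SLower b i c = ∫ r in -P.xr i.castSucc (b i.castSucc) c..-P.xl i.succ (b i.succ) c,
      1 / D.gapSys.rot.rot.q.f (D.gapSys.rot.rot.q.inv (c - |D.gapSys.rot.rot.p.sp r|)) := by
  rw [SLower, ← neg_neg (P.xl i.succ (b i.succ) c), ← neg_neg (P.xr i.castSucc _ c),
    ← intervalIntegral.integral_comp_neg
      (fun x => 1 / -P.h (P.HinvNeg (c - P.lam / 2 * x ^ 2))), neg_neg, neg_neg]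
  refine intervalIntegral.integral_congr fun r hr => ?_
  rw [uIcc_of_le (neg_le_neg hl)] at hr
  have h3 := abs_sp_le_of_mem h1 h2 (r := -r) ⟨by linarith [hr.2], by linarith [hr.1]⟩
  simp only [rot_rot_gapSys, Profile.ref_sp, abs_neg, D.abs_sp_gapSys] at h3 ⊢
  rw [D.h_HinvNeg (by linarith) (by
    have : 0 ≤ P.lam / 2 * (-r) ^ 2 := by have := D.lam_pos; positivity
    linarith)]

theorem strictMonoOn_mul_G (j : Fin (m + 1)) : StrictMonoOn (fun x => P.μ j * P.G x) (Ici 0) :=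
  fun _ ha _ hb hab => mul_lt_mul_of_pos_left (P.strictMonoOn_G ha hb hab) (P.μ_pos j)

theorem strictAntiOn_mul_G (j : Fin (m + 1)) : StrictAntiOn (fun x => P.μ j * P.G x) (Iic 0) :=
  fun _ ha _ hb hab => mul_lt_mul_of_pos_left (P.strictAntiOn_G ha hb hab) (P.μ_pos j)

theorem strictMonoOn_mul_G_neg (j : Fin (m + 1)) :
    StrictMonoOn (fun x => P.μ j * P.G (-x)) (Ici 0) := fun a ha b hb hab =>
  strictAntiOn_mul_G j (a := -b) (b := -a) (mem_Iic.2 (neg_nonpos.2 (mem_Ici.1 hb)))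
    (mem_Iic.2 (neg_nonpos.2 (mem_Ici.1 ha))) (neg_lt_neg hab)

theorem strictAntiOn_mul_G_neg (j : Fin (m + 1)) :
    StrictAntiOn (fun x => P.μ j * P.G (-x)) (Iic 0) := fun a ha b hb hab =>
  strictMonoOn_mul_G j (a := -b) (b := -a) (mem_Ici.2 (neg_nonneg.2 (mem_Iic.1 hb)))
    (mem_Ici.2 (neg_nonneg.2 (mem_Iic.1 ha))) (neg_lt_neg hab)

theorem level_gapSys (j : Fin (m + 1)) {z : ℝ × ℝ} (hz : z.2 ∈ Icc D.ym D.yp) :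
    D.gapSys.level z + P.μ j * P.G z.1 = P.Ham j z := by
  rw [Planar.level, D.abs_sp_gapSys, gapSys, D.abs_sp_hProf hz, Ham, F]
  ring

theorem level_rot_rot (S : Planar) (z : ℝ × ℝ) : S.rot.rot.level (-z) = S.level z := by
  simp [Planar.level, Planar.rot, Profile.ref_sp]

/-- Stretching across a gap. -/
theorem gap_step (i : Fin m) {c₁ c₂ : Fin (m + 1) → ℝ} (h12 : ∀ j, c₁ j < c₂ j)
    (hC : ∀ j, c₂ j ≤ D.C)
    (hlink : P.LinkedTwist P.SUpper c₁ c₂ i ∧ P.LinkedTwist P.SLower c₁ c₂ i) {ω : Quadrant}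
    (hω : ω = .II ∨ ω = .IV) {γ : ℝ → ℝ × ℝ} {s₀ s₁ : ℝ} (hs : s₀ ≤ s₁)
    (hγ : ContinuousOn γ (Icc s₀ s₁))
    (hmem : ∀ s ∈ Icc s₀ s₁, γ s ∈ P.annulus c₁ c₂ i.castSucc ω)
    (hends : (γ s₀).2 = 0 ∧ (γ s₁).1 = 0 ∨ (γ s₁).2 = 0 ∧ (γ s₀).1 = 0) :
    ∃ s₀' s₁' : ℝ, s₀ ≤ s₀' ∧ s₀' < s₁' ∧ s₁' ≤ s₁ ∧ ∃ δ : ℝ → ℝ × ℝ,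
      ContinuousOn δ (Icc s₀' s₁') ∧
      (∀ s ∈ Icc s₀' s₁', δ s ∈ P.annulus c₁ c₂ i.succ ω.next ∧
        ∃ u, P.SolOn u (P.s i.castSucc) (P.t i.succ) ∧ u (P.s i.castSucc) = γ s ∧
          u (P.t i.succ) = δ s ∧ (c₁ i.castSucc < P.Ham i.castSucc (γ s) →
            c₁ i.succ < P.Ham i.succ (δ s) → P.GapCount i u)) ∧
      (P.Ham i.succ (δ s₀') = c₁ i.succ ∧ P.Ham i.succ (δ s₁') = c₂ i.succ ∨
        P.Ham i.succ (δ s₁') = c₁ i.succ ∧ P.Ham i.succ (δ s₀') = c₂ i.succ) := by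
  have hτ : 0 < P.gap i := sub_pos.2 (P.s_lt_t i)
  have hadd : P.s i.castSucc + P.gap i = P.t i.succ := by rw [gap]; ring
  have hJγ : ∀ s ∈ Icc s₀ s₁, (γ s).2 ∈ Icc D.ym D.yp := fun s hs =>
    D.mem_of_Ham_le _ (hmem s hs).2.1 ((hmem s hs).2.2.2.trans (hC _))
  have hHγ : ∀ s ∈ Icc s₀ s₁, D.gapSys.level (γ s) + P.μ i.castSucc * P.G (γ s).1 =
      P.Ham i.castSucc (γ s) := fun s hs => D.level_gapSys _ (hJγ s hs)
  have xlb : ∀ {b : Fin (m + 1) → ℝ} {c : ℝ} {j : Fin (m + 1)}, P.Compatible c₁ c₂ i c →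
      (j = i.castSucc ∨ j = i.succ) → c₁ j ≤ b j → b j ≤ c₂ j →
      (P.xl j (b j) c ≤ 0 ∧ P.μ j * P.G (P.xl j (b j) c) = b j - c) ∧
      (0 ≤ P.xr j (b j) c ∧ P.μ j * P.G (P.xr j (b j) c) = b j - c) := by
    intro b c j hc hj h1 h2
    obtain ⟨a1, a2, a3⟩ := compatible_bounds hc hj
    have h3 : (b j - c) / P.μ j ≤ (c₂ j - c) / P.μ j :=
      div_le_div_of_nonneg_right (by linarith) (P.μ_pos j).le
    exact ⟨xl_spec (neg_nonpos.2 (sqrt_nonneg _)) (a1.trans h1) (h3.trans a2.le),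
      xr_spec (sqrt_nonneg _) (a1.trans h1) (h3.trans a3.le)⟩
  have hle : ∀ {c : ℝ}, P.Compatible c₁ c₂ i c → c ≤ D.C := fun hc =>
    (compatible_bounds hc (Or.inl rfl)).1.trans ((h12 _).le.trans (hC _))
  have l12 := fun j => (h12 j).le
  have hG := P.continuous_G
  rcases hω with rfl | rfl
  · obtain ⟨d, e, hde, hd, he, hSe, hSd⟩ := hlink.1
    have cd := D.crossLevel_upper hd
    have ce := D.crossLevel_upper he
    obtain ⟨xl1, xl2⟩ := (xlb hd (Or.inl rfl) le_rfl (l12 _)).1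
    obtain ⟨xr1, xr2⟩ := (xlb hd (Or.inr rfl) le_rfl (l12 _)).2
    obtain ⟨yl1, yl2⟩ := (xlb he (Or.inl rfl) (l12 _) le_rfl).1
    obtain ⟨yr1, yr2⟩ := (xlb he (Or.inr rfl) (l12 _) le_rfl).2
    have hl := strictAntiOn_mul_G (P := P) i.castSucc
    have hr := strictMonoOn_mul_G (P := P) i.succ
    rw [D.SUpper_eq (hle hd) (xl1.trans xr1)
      (cd.abs_left hl xl1 (xl2.trans_le (by linarith [h12 i.castSucc]))).le
      (cd.abs_right hr xr1 (xr2.trans_le (by linarith [h12 i.succ]))).le] at hSd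
    rw [D.SUpper_eq (hle he) (yl1.trans yr1) (ce.abs_left hl yl1 yl2.le).le
      (ce.abs_right hr yr1 yr2.le).le] at hSe
    obtain ⟨a, b, ha, hab, hb, δ, hδc, hδ, hδe⟩ := D.gapSys.exists_gap hl (by simp [P.G_zero]) hr
      (by simp [P.G_zero]) (by fun_prop) hτ (l12 _) (h12 _) hs hγ
      (fun s hs => by simpa [InFourth, Quadrant.carrier] using (hmem s hs).1)
      (fun s hs => (hmem s hs).2.2.1.trans_eq (hHγ s hs).symm)
      (fun s hs => (hHγ s hs).trans_le (hmem s hs).2.2.2) hends hde cd ce xl1 xl2 xr1 xr2 hSd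
      yl1 yl2 yr1 yr2 hSe
    have hJδ : ∀ s ∈ Icc a b, D.gapSys.level (γ s) ≤ D.C ∧ (δ s).2 ∈ Icc D.ym D.yp := by
      intro s hs
      obtain ⟨q1, q2, q3, q4⟩ := hδ s hs
      have hlγ := q2.trans ((l12 _).trans (hC _))
      -- The arrival point inherits the level of its start, which is at most `C`, so its ordinate is
      -- untouched by the truncation.
      obtain ⟨u, -, -, hu1, -, hul⟩ := q4 0
      refine ⟨hlγ, D.mem_of_level_le (p := D.gapSys.p) ?_⟩
      rw [← hu1]
      exact (hul _).trans_le hlγ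
    have hHδ : ∀ s ∈ Icc a b, D.gapSys.level (δ s) + P.μ i.succ * P.G (δ s).1 =
        P.Ham i.succ (δ s) := fun s hs => D.level_gapSys _ (hJδ s hs).2
    refine ⟨a, b, ha, hab, hb, δ, hδc, fun s hs => ?_, ?_⟩
    · obtain ⟨q1, q2, q3, q4⟩ := hδ s hs
      have hs' : s ∈ Icc s₀ s₁ := ⟨ha.trans hs.1, hs.2.trans hb⟩
      rw [hHδ s hs] at q3
      refine ⟨⟨by simpa [InFirst, Quadrant.carrier, Quadrant.next] using q1, D.Icc_subset_J (hJδ s hs).2, q3.1, q3.2⟩, ?_⟩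
      obtain ⟨u, hu, hu0, hu1, huz, hul⟩ := q4 (P.s i.castSucc)
      rw [hadd] at hu hu1 huz
      refine ⟨u, D.solOn_of_isSol le_rfl hu (fun t => (hul t).trans_le (hJδ s hs).1)
        (fun t ht => P.a_eq_zero i ht), hu0, hu1, fun h1 h2 => huz ⟨?_, ?_⟩⟩
      · rwa [hHγ s hs']
      · rwa [hHδ s hs]
    · rwa [hHδ a ⟨le_rfl, hab.le⟩, hHδ b ⟨hab.le, le_rfl⟩] at hδe
  -- The same argument for `-γ` in the half-turned system, where `-xr` is the left abscissa and
  -- `-xl` the right one.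
  · obtain ⟨d, e, hde, hd, he, hSe, hSd⟩ := hlink.2
    have cd := D.crossLevel_lower hd
    have ce := D.crossLevel_lower he
    obtain ⟨xl1, xl2⟩ := (xlb hd (Or.inl rfl) le_rfl (l12 _)).2
    obtain ⟨xr1, xr2⟩ := (xlb hd (Or.inr rfl) le_rfl (l12 _)).1
    obtain ⟨yl1, yl2⟩ := (xlb he (Or.inl rfl) (l12 _) le_rfl).2
    obtain ⟨yr1, yr2⟩ := (xlb he (Or.inr rfl) (l12 _) le_rfl).1
    have hl := strictAntiOn_mul_G_neg (P := P) i.castSucc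
    have hr := strictMonoOn_mul_G_neg (P := P) i.succ
    have hsp : ∀ x, |D.gapSys.p.sp x| = |D.gapSys.rot.rot.p.sp (-x)| := fun x => by
      rw [rot_rot_gapSys, Profile.ref_sp, neg_neg, abs_neg]
    have xl1' := neg_nonpos.2 xl1
    have xr1' := neg_nonneg.2 xr1
    have yl1' := neg_nonpos.2 yl1
    have yr1' := neg_nonneg.2 yr1
    rw [← neg_neg (P.xr _ _ d)] at xl2
    rw [← neg_neg (P.xl _ _ d)] at xr2
    rw [← neg_neg (P.xr _ _ e)] at yl2
    rw [← neg_neg (P.xl _ _ e)] at yr2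
    rw [D.SLower_eq (hle hd) (xr1.trans xl1)
      ((hsp _).trans_le (cd.abs_right hr xr1' (xr2.trans_le (by linarith [h12 i.succ]))).le)
      ((hsp _).trans_le (cd.abs_left hl xl1' (xl2.trans_le (by linarith [h12 i.castSucc]))).le)]
      at hSd
    rw [D.SLower_eq (hle he) (yr1.trans yl1)
      ((hsp _).trans_le (ce.abs_right hr yr1' yr2.le).le)
      ((hsp _).trans_le (ce.abs_left hl yl1' yl2.le).le)] at hSe
    have hHγ' : ∀ s ∈ Icc s₀ s₁, D.gapSys.rot.rot.level (-γ s) +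
        P.μ i.castSucc * P.G (-(-γ s).1) = P.Ham i.castSucc (γ s) := fun s hs => by
      rw [level_rot_rot, Prod.fst_neg, neg_neg, hHγ s hs]
    obtain ⟨a, b, ha, hab, hb, δ, hδc, hδ, hδe⟩ := D.gapSys.rot.rot.exists_gap
      (γ := fun s => -γ s) hl (by simp [P.G_zero]) hr
      (by simp [P.G_zero]) (by fun_prop) hτ (l12 _) (h12 _) hs hγ.neg
      (fun s hs => by simpa [InFourth, Quadrant.carrier] using (hmem s hs).1)
      (fun s hs => (hmem s hs).2.2.1.trans_eq (hHγ' s hs).symm)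
      (fun s hs => (hHγ' s hs).trans_le (hmem s hs).2.2.2) (by simpa using hends) hde cd ce
      xl1' xl2 xr1' xr2 hSd yl1' yl2 yr1' yr2 hSe
    have hJδ : ∀ s ∈ Icc a b, D.gapSys.level (γ s) ≤ D.C ∧ (-δ s).2 ∈ Icc D.ym D.yp := by
      intro s hs
      obtain ⟨q1, q2, q3, q4⟩ := hδ s hs
      have hlγ := q2.trans ((l12 _).trans (hC _))
      obtain ⟨u, -, -, hu1, -, hul⟩ := q4 0
      rw [level_rot_rot] at hlγ
      refine ⟨hlγ, D.mem_of_level_le (p := D.gapSys.p) ?_⟩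
      have h3 := hul (0 + P.gap i)
      rw [hu1, level_rot_rot, ← neg_neg (δ s), level_rot_rot] at h3
      exact h3.trans_le hlγ
    have hHδ : ∀ s ∈ Icc a b, D.gapSys.rot.rot.level (δ s) + P.μ i.succ * P.G (-(δ s).1) =
        P.Ham i.succ (-δ s) := fun s hs => by
      rw [← D.level_gapSys _ (hJδ s hs).2, ← neg_neg (δ s), level_rot_rot, neg_neg]
      rfl
    refine ⟨a, b, ha, hab, hb, fun s => -δ s, hδc.neg, fun s hs => ?_, ?_⟩
    · obtain ⟨q1, q2, q3, q4⟩ := hδ s hs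
      have hs' : s ∈ Icc s₀ s₁ := ⟨ha.trans hs.1, hs.2.trans hb⟩
      rw [hHδ s hs] at q3
      refine ⟨⟨by simpa [InFirst, Quadrant.carrier, Quadrant.next] using q1, D.Icc_subset_J (hJδ s hs).2, q3.1, q3.2⟩, ?_⟩
      obtain ⟨u, hu, hu0, hu1, huz, hul⟩ := q4 (P.s i.castSucc)
      rw [hadd] at hu hu1 huz
      refine ⟨fun t => -u t, D.solOn_of_isSol le_rfl (isSol_neg hu) (fun t => ?_)
        (fun t ht => P.a_eq_zero i ht), by simp [hu0], by simp [hu1], fun h1 h2 => ?_⟩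
      · change D.gapSys.level (-u t) ≤ _
        have h3 := hul t
        rw [level_rot_rot, ← neg_neg (u t), level_rot_rot] at h3
        exact h3.trans_le (hJδ s hs).1
      · have hz := huz ⟨by rwa [hHγ' s hs'], by rwa [hHδ s hs]⟩
        simpa [GapCount, zeros] using hz
    · rwa [hHδ a ⟨le_rfl, hab.le⟩, hHδ b ⟨hab.le, le_rfl⟩] at hδe

end Trunc

end SwitchedSystem

end SturmLiouville

namespace SturmLiouville

open Filter Topology Real

/-! ### Chaining of paths, the final intersection, and uniqueness of itineraries. -/

theorem Profile.eq_of_abs_sp_eq (p : Profile) {x y : ℝ} (h : |p.sp x| = |p.sp y|)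
    (hxy : 0 ≤ x ∧ 0 ≤ y ∨ x ≤ 0 ∧ y ≤ 0) : x = y := by
  have h0 : p.sp 0 = 0 := p.sp_zero
  refine p.strictMono_sp.injective ?_
  have hm := p.strictMono_sp.monotone
  rcases hxy with ⟨hx, hy⟩ | ⟨hx, hy⟩
  · rwa [abs_of_nonneg (h0.symm.trans_le (hm hx)), abs_of_nonneg (h0.symm.trans_le (hm hy))] at h
  · rw [abs_of_nonpos ((hm hx).trans_eq h0), abs_of_nonpos ((hm hy).trans_eq h0)] at h
    exact neg_injective h

theorem zeros_congr_on {f g : ℝ → ℝ} {s : Set ℝ} (h : ∀ t ∈ s, f t = g t) :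
    zeros f s = zeros g s := by
  unfold zeros
  congr 1
  ext t
  exact ⟨fun ht => ⟨ht.1, h t ht.1 ▸ ht.2⟩, fun ht => ⟨ht.1, (h t ht.1).trans ht.2⟩⟩

namespace SwitchedSystem

variable {m : ℕ} {P : SwitchedSystem m}

theorem LapCount.congr {i : Fin (m + 1)} {κ ω : Quadrant} {n : ℕ} {u v : ℝ → ℝ × ℝ}
    (h : P.LapCount i κ ω n u) (huv : ∀ r ∈ Icc (P.t i) (P.s i), v r = u r) :
    P.LapCount i κ ω n v := by
  unfold LapCount at *
  rwa [zeros_congr_on (f := fun r => (v r).1) (g := fun r => (u r).1)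
      fun r hr => by rw [huv r (Ioo_subset_Icc_self hr)],
    zeros_congr_on (f := fun r => (v r).2) (g := fun r => (u r).2) fun r hr => by rw [huv r hr]]

theorem GapCount.congr {i : Fin m} {u v : ℝ → ℝ × ℝ} (h : P.GapCount i u)
    (huv : ∀ r ∈ Icc (P.s i.castSucc) (P.t i.succ), v r = u r) : P.GapCount i v := by
  unfold GapCount at *
  rwa [zeros_congr_on (f := fun r => (v r).1) (g := fun r => (u r).1)
      fun r hr => by rw [huv r (Ioo_subset_Icc_self hr)],
    zeros_congr_on (s := Icc _ _) (f := fun r => (v r).1) (g := fun r => (u r).1)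
      fun r hr => by rw [huv r hr],
    zeros_congr_on (f := fun r => (v r).2) (g := fun r => (u r).2) fun r hr => by rw [huv r hr]]

variable (P) in
/-- `u` follows the entries, exits and counters up to the annulus `k`. -/
def FollowsTo (c₁ c₂ : Fin (m + 1) → ℝ) (entry exit : Fin (m + 1) → Quadrant)
    (n : Fin (m + 1) → ℕ) (k : Fin (m + 1)) (u : ℝ → ℝ × ℝ) : Prop :=
  (∀ i ≤ k, u (P.t i) ∈ P.annulus c₁ c₂ i (entry i) ∧ u (P.s i) ∈ P.annulus c₁ c₂ i (exit i) ∧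
    P.LapCount i (entry i) (exit i) (n i) u) ∧
  ∀ i : Fin m, i.succ ≤ k → P.GapCount i u

theorem s_mono {i j : Fin (m + 1)} (h : i ≤ j) : P.s i ≤ P.s j := by
  rcases h.eq_or_lt with rfl | h
  · rfl
  · exact ((P.s_lt_t_of_lt h).trans (P.t_lt_s j)).le

theorem FollowsTo.extend {c₁ c₂ : Fin (m + 1) → ℝ} {entry exit : Fin (m + 1) → Quadrant}
    {n : Fin (m + 1) → ℕ} {i : Fin m} {u w : ℝ → ℝ × ℝ}
    (h : P.FollowsTo c₁ c₂ entry exit n i.castSucc u) (huw : ∀ r ≤ P.s i.castSucc, w r = u r)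
    (hgap : P.GapCount i w) (ht : w (P.t i.succ) ∈ P.annulus c₁ c₂ i.succ (entry i.succ))
    (hs : w (P.s i.succ) ∈ P.annulus c₁ c₂ i.succ (exit i.succ))
    (hlap : P.LapCount i.succ (entry i.succ) (exit i.succ) (n i.succ) w) :
    P.FollowsTo c₁ c₂ entry exit n i.succ w := by
  refine ⟨fun j hj => ?_, fun j hj => ?_⟩
  · rcases hj.eq_or_lt with rfl | hj
    · exact ⟨ht, hs, hlap⟩
    · have hj' : j ≤ i.castSucc := Fin.le_castSucc_iff.2 hj
      have hsj := P.s_mono hj'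
      obtain ⟨h1, h2, h3⟩ := h.1 j hj'
      rw [huw _ ((P.t_lt_s j).le.trans hsj), huw _ hsj]
      exact ⟨h1, h2, h3.congr fun r hr => huw r (hr.2.trans hsj)⟩
  · rcases hj.eq_or_lt with hj | hj
    · obtain rfl := Fin.succ_injective _ hj
      exact hgap
    · have hj' : j.succ ≤ i.castSucc := Fin.le_castSucc_iff.2 hj
      exact (h.2 j hj').congr fun r hr =>
        huw r (hr.2.trans ((P.t_lt_s _).le.trans (P.s_mono hj')))

theorem H_zero : P.H 0 = 0 := by simp [H]

theorem F_zero (i : Fin (m + 1)) : P.F i 0 = 0 := by simp [F, P.G_zero]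

theorem continuous_F (i : Fin (m + 1)) : Continuous (P.F i) := by
  have := P.continuous_G
  unfold F
  fun_prop

namespace Trunc

variable (D : P.Trunc)

/-- Chaining the annuli and the gaps. -/
theorem exists_path {c₁ c₂ : Fin (m + 1) → ℝ} (h0 : ∀ i, 0 < c₁ i) (h12 : ∀ i, c₁ i < c₂ i)
    (hC : ∀ i, c₂ i ≤ D.C) {α β : Fin (m + 1) → ℕ} {d e : Fin (m + 1) → ℝ}
    (hde : ∀ i, (d i = c₁ i ∧ e i = c₂ i) ∨ (d i = c₂ i ∧ e i = c₁ i))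
    (htw : ∀ i, P.Twist i .I (α i) (β i) (d i) (e i) ∧ P.Twist i .III (α i) (β i) (d i) (e i))
    (hlink : ∀ i : Fin m, P.LinkedTwist P.SUpper c₁ c₂ i ∧ P.LinkedTwist P.SLower c₁ c₂ i)
    {entry exit : Fin (m + 1) → Quadrant} {n : Fin (m + 1) → ℕ}
    (hentry : ∀ i, entry i = .I ∨ entry i = .III) (hexit : ∀ i, exit i = .II ∨ exit i = .IV)
    (hnext : ∀ i : Fin m, entry i.succ = (exit i.castSucc).next)
    (hn : ∀ i, α i + 1 ≤ n i ∧ n i ≤ β i) {γ : ℝ → ℝ × ℝ} (hγ : ContinuousOn γ (Icc 0 1))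
    (hmem : ∀ s ∈ Icc (0 : ℝ) 1, γ s ∈ P.annulus c₁ c₂ 0 (entry 0))
    (hends : P.Ham 0 (γ 0) = c₁ 0 ∧ P.Ham 0 (γ 1) = c₂ 0) (k : Fin (m + 1)) :
    ∃ a b : ℝ, 0 ≤ a ∧ a < b ∧ b ≤ 1 ∧ ∃ δ : ℝ → ℝ × ℝ, ContinuousOn δ (Icc a b) ∧
      (∀ s ∈ Icc a b, δ s ∈ P.annulus c₁ c₂ k (exit k) ∧ c₁ k < P.Ham k (δ s) ∧
        ∃ u, P.SolOn u 0 (P.s k) ∧ u 0 = γ s ∧ u (P.s k) = δ s ∧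
          P.FollowsTo c₁ c₂ entry exit n k u) ∧
      ((δ a).2 = 0 ∧ (δ b).1 = 0 ∨ (δ b).2 = 0 ∧ (δ a).1 = 0) := by
  have htw' : ∀ i, P.Twist i (entry i) (α i) (β i) (d i) (e i) := fun i => by
    rcases hentry i with h | h <;> rw [h]
    exacts [(htw i).1, (htw i).2]
  induction k using Fin.induction with
  | zero =>
    obtain ⟨a, b, ha, hab, hb, δ, hδc, hδ, hδe⟩ := D.twist_step 0 (h0 0) (h12 0) (hC 0) (hde 0)
      (hentry 0) (hexit 0) (htw' 0) (hn 0).1 (hn 0).2 zero_le_one hγ hmem (Or.inl hends)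
    refine ⟨a, b, ha, hab, hb, δ, hδc, fun s hs => ?_, hδe⟩
    obtain ⟨q1, q2, q3, u, hu, hu0, hu1, hul⟩ := hδ s hs
    have hs' : s ∈ Icc (0 : ℝ) 1 := ⟨ha.trans hs.1, hs.2.trans hb⟩
    refine ⟨q1, q3, u, by rwa [P.t_zero] at hu, by rwa [P.t_zero] at hu0, hu1, fun i hi => ?_,
      fun i hi => absurd hi (by simp)⟩
    obtain rfl := Fin.le_zero_iff.1 hi
    exact ⟨hu0 ▸ hmem s hs', hu1 ▸ q1, hul⟩
  | succ i ih =>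
    obtain ⟨a, b, ha, hab, hb, δ, hδc, hδ, hδe⟩ := ih
    obtain ⟨a', b', ha', hab', hb', δ', hδc', hδ', hδe'⟩ := D.gap_step i h12 hC (hlink i)
      (hexit i.castSucc) hab.le hδc (fun s hs => (hδ s hs).1) hδe
    rw [← hnext i] at hδ'
    obtain ⟨a'', b'', ha'', hab'', hb'', δ'', hδc'', hδ'', hδe''⟩ := D.twist_step i.succ
      (h0 _) (h12 _) (hC _) (hde _) (hentry _) (hexit _) (htw' _) (hn _).1 (hn _).2 hab'.le hδc'
      (fun s hs => (hδ' s hs).1) hδe'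
    refine ⟨a'', b'', ha.trans (ha'.trans ha''), hab'', hb''.trans (hb'.trans hb), δ'', hδc'',
      fun s hs => ?_, hδe''⟩
    have hs' : s ∈ Icc a' b' := ⟨ha''.trans hs.1, hs.2.trans hb''⟩
    obtain ⟨-, q2, u, hu, hu0, hu1, hul⟩ := hδ s ⟨ha'.trans hs'.1, hs'.2.trans hb'⟩
    obtain ⟨r1, v, hv, hv0, hv1, hvg⟩ := hδ' s hs'
    obtain ⟨p1, p2, p3, w, hw, hw0, hw1, hwl⟩ := hδ'' s hs
    have hst := P.s_lt_t i
    have hts := P.t_lt_s i.succ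
    have h0s : 0 ≤ P.s i.castSucc := by
      have h1 := P.strictMono_t.monotone (Fin.zero_le i.castSucc)
      rw [P.t_zero] at h1
      exact h1.trans (P.t_lt_s _).le
    -- The endpoint values agree, so each piece is valid on its closed interval, as the zero counts
    -- require.
    let z : ℝ → ℝ × ℝ := fun r => if r ≤ P.s i.castSucc then u r else
      if r ≤ P.t i.succ then v r else w r
    have zu : ∀ r ≤ P.s i.castSucc, z r = u r := fun r hr => if_pos hr
    have zv : ∀ r ∈ Icc (P.s i.castSucc) (P.t i.succ), z r = v r := fun r hr => by
      rcases hr.1.eq_or_lt with rfl | h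
      · rw [zu _ le_rfl, hu1, hv0]
      · exact (if_neg h.not_ge).trans (if_pos hr.2)
    have zw : ∀ r, P.t i.succ ≤ r → z r = w r := fun r hr => by
      rcases hr.eq_or_lt with rfl | h
      · rw [zv _ ⟨hst.le, le_rfl⟩, hv1, hw0]
      · exact (if_neg (hst.trans h).not_ge).trans (if_neg h.not_ge)
    -- `q2` and `p2` put both ends of the gap strictly outside the inner boundaries, which releases
    -- the zero counts of the gap.
    refine ⟨p1, p3, z, ?_, by rw [zu 0 h0s, hu0], by rw [zw _ hts.le, hw1],
      hul.extend zu ((hvg q2 p2).congr zv) ?_ ?_ (hwl.congr fun r hr => zw r hr.1)⟩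
    · refine SolOn.glue h0s (hst.le.trans hts.le) hu
        (v := fun r => if r ≤ P.t i.succ then v r else w r) ?_ zu fun r hr => ?_
      · refine SolOn.glue hst.le hts.le hv hw (fun r hr => if_pos hr) fun r hr => ?_
        rcases hr.eq_or_lt with rfl | h
        · rw [if_pos le_rfl, hv1, hw0]
        · exact if_neg h.not_ge
      · rcases hr.eq_or_lt with rfl | h
        · rw [zu _ le_rfl, hu1, if_pos hst.le, hv0]
        · exact if_neg h.not_ge
    · rw [zv _ ⟨hst.le, le_rfl⟩, hv1]; exact r1
    · rw [zw _ hts.le, hw1]; exact p1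

/-- A path between the axes meets a path between the boundaries of the annulus. -/
theorem exists_inter (i : Fin (m + 1)) {c₁ c₂ : Fin (m + 1) → ℝ} (h0 : 0 < c₁ i)
    (hC : c₂ i ≤ D.C) {ω : Quadrant} (hω : ω = .II ∨ ω = .IV) {δ η : ℝ → ℝ × ℝ} {a b : ℝ}
    (hab : a ≤ b) (hδ : ContinuousOn δ (Icc a b)) (hη : ContinuousOn η (Icc 0 1))
    (hδm : ∀ s ∈ Icc a b, δ s ∈ P.annulus c₁ c₂ i ω)
    (hηm : ∀ s ∈ Icc (0 : ℝ) 1, η s ∈ P.annulus c₁ c₂ i ω)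
    (hδe : (δ a).2 = 0 ∧ (δ b).1 = 0 ∨ (δ b).2 = 0 ∧ (δ a).1 = 0)
    (hη0 : P.Ham i (η 0) = c₁ i) (hη1 : P.Ham i (η 1) = c₂ i) :
    ∃ s ∈ Icc a b, ∃ t ∈ Icc (0 : ℝ) 1, δ s = η t := by
  wlog hδe' : (δ a).2 = 0 ∧ (δ b).1 = 0 generalizing δ
  · have hr : ∀ s ∈ Icc a b, a + b - s ∈ Icc a b := fun s hs => by
      constructor <;> linarith [hs.1, hs.2]
    have h1 := hδe.resolve_left hδe'
    have h2 : (δ (a + b - a)).2 = 0 ∧ (δ (a + b - b)).1 = 0 := by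
      rwa [add_sub_cancel_left, add_sub_cancel_right]
    obtain ⟨s, hs, t, ht, hst⟩ := this (δ := fun s => δ (a + b - s))
      (hδ.comp (by fun_prop) hr) (fun s hs => hδm _ (hr s hs)) (Or.inl h2) h2
    exact ⟨_, hr s hs, t, ht, hst⟩
  have hJ : ∀ z ∈ P.annulus c₁ c₂ i ω, z.2 ∈ Icc D.ym D.yp := fun z hz =>
    D.mem_of_Ham_le i hz.2.1 (hz.2.2.2.trans hC)
  have hH : ∀ z ∈ P.annulus c₁ c₂ i ω, |D.hProf.sp z.2| = P.H z.2 := fun z hz =>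
    D.abs_sp_hProf (hJ z hz)
  let cl : ℝ → ℝ → ℝ → ℝ := fun x y r => max x (min y r)
  have hcl : ∀ x y, Continuous (cl x y) := fun x y => by fun_prop
  have hclm : ∀ {x y}, x ≤ y → ∀ r, cl x y r ∈ Icc x y := fun {x y} hxy r =>
    ⟨le_max_left _ _, max_le hxy (min_le_left _ _)⟩
  have hcle : ∀ {x y r}, r ∈ Icc x y → cl x y r = r := fun {x y r} hr => by
    rw [show cl x y r = max x (min y r) from rfl, min_eq_right hr.2, max_eq_right hr.1]
  -- The two paths as functions of the two coordinates of the square; clamped parameters make them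
  -- continuous on the plane.
  let A : ℝ × ℝ → ℝ × ℝ := fun z => δ (cl a b (a + (b - a) * z.1))
  let B : ℝ × ℝ → ℝ × ℝ := fun z => η (cl 0 1 z.2)
  have hA : Continuous A := hδ.comp_continuous (by fun_prop) fun z => hclm hab _
  have hB : Continuous B := hη.comp_continuous (by fun_prop) fun z => hclm zero_le_one _
  have hAm : ∀ z, A z ∈ P.annulus c₁ c₂ i ω := fun z => hδm _ (hclm hab _)
  have hBm : ∀ z, B z ∈ P.annulus c₁ c₂ i ω := fun z => hηm _ (hclm zero_le_one _)
  have hsp := D.hProf.continuous_sp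
  have hF := P.continuous_F i
  have hF0 := fun x => D.F_nonneg i x
  have hA0 : ∀ t, A (0, t) = δ a := fun t => by
    simp only [A, mul_zero, add_zero, hcle (left_mem_Icc.2 hab)]
  have hA1 : ∀ t, A (1, t) = δ b := fun t => by
    simp only [A, mul_one, add_sub_cancel, hcle (right_mem_Icc.2 hab)]
  have hB0 : ∀ s, B (s, 0) = η 0 := fun s => by
    simp only [B, hcle (left_mem_Icc.2 zero_le_one)]
  have hB1 : ∀ s, B (s, 1) = η 1 := fun s => by
    simp only [B, hcle (right_mem_Icc.2 zero_le_one)]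
  have hHam : ∀ z ∈ P.annulus c₁ c₂ i ω, |D.hProf.sp z.2| + P.F i z.1 = P.Ham i z :=
    fun z hz => by rw [hH z hz]; rfl
  -- `f` compares the energies, with signs given by the boundary levels of `η`. `g` is a cross
  -- product that compares the shares of `x` and `y` in the energy, with signs given by the axes at
  -- the ends of `δ`.
  obtain ⟨s, hs, t, ht, e1, e2⟩ := exists_zero_of_sign
    (f := fun z => (|D.hProf.sp (A z).2| + P.F i (A z).1) -
      (|D.hProf.sp (B z).2| + P.F i (B z).1))
    (g := fun z => P.F i (A z).1 * |D.hProf.sp (B z).2| - |D.hProf.sp (A z).2| * P.F i (B z).1)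
    (by fun_prop) (by fun_prop)
    (fun s _ => by
      rw [hHam _ (hAm _), hHam _ (hBm _), hB0, hη0]
      linarith [(hAm (s, 0)).2.2.1])
    (fun s _ => by
      rw [hHam _ (hAm _), hHam _ (hBm _), hB1, hη1]
      linarith [(hAm (s, 1)).2.2.2])
    (fun t _ => by
      rw [hA0, hδe'.1, D.hProf.sp_zero, abs_zero, zero_mul, sub_zero]
      exact mul_nonneg (hF0 _) (abs_nonneg _))
    (fun t _ => by
      rw [hA1, hδe'.2, P.F_zero, zero_mul, zero_sub, neg_nonpos]
      exact mul_nonneg (abs_nonneg _) (hF0 _))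
  refine ⟨_, hclm hab (a + (b - a) * s), _, hclm zero_le_one t, ?_⟩
  change A (s, t) = B (s, t)
  have mA := hAm (s, t)
  have mB := hBm (s, t)
  have hpos : 0 < |D.hProf.sp (A (s, t)).2| + P.F i (A (s, t)).1 := by
    rw [hHam _ mA]; exact h0.trans_le mA.2.2.1
  generalize A (s, t) = z at *
  generalize B (s, t) = w at *
  -- Equal positive sums and vanishing cross product force equal summands; within a quadrant these
  -- determine the point.
  have e3 : P.F i z.1 = P.F i w.1 := by
    have : (|D.hProf.sp z.2| + P.F i z.1) * (P.F i z.1 - P.F i w.1) = 0 := by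
      linear_combination e2 + P.F i z.1 * e1
    rcases mul_eq_zero.1 this with h | h
    · exact absurd h hpos.ne'
    · linarith
  have e4 : |D.hProf.sp z.2| = |D.hProf.sp w.2| := by linarith
  have hz := mA.1
  have hw := mB.1
  rcases hω with rfl | rfl
  · refine Prod.ext ?_ (D.hProf.eq_of_abs_sp_eq e4 (Or.inl ⟨hz.2, hw.2⟩))
    rw [D.F_of_nonpos i hz.1, D.F_of_nonpos i hw.1] at e3
    exact (D.sys i).p.strictMono_sp.injective (neg_injective e3)
  · refine Prod.ext ?_ (D.hProf.eq_of_abs_sp_eq e4 (Or.inr ⟨hz.2, hw.2⟩))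
    rw [D.F_of_nonneg i hz.1, D.F_of_nonneg i hw.1] at e3
    exact (D.sys i).p.strictMono_sp.injective e3

end Trunc

theorem Icc_subset (i : Fin (m + 1)) : Icc (P.t i) (P.s i) ⊆ Icc 0 P.L := by
  refine Icc_subset_Icc ?_ ?_
  · rw [← P.t_zero]; exact P.strictMono_t.monotone (Fin.zero_le i)
  · rw [← P.s_last]; exact P.s_mono (Fin.le_last i)

theorem exists_param {c₁ c₂ : Fin (m + 1) → ℝ} {i : Fin (m + 1)} {κ : Quadrant}
    {r : Set (ℝ × ℝ)} (h : P.IsLinkingArc c₁ c₂ i κ r) : ∃ γ : ℝ → ℝ × ℝ, Continuous γ ∧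
      (∀ s, γ s ∈ r) ∧ r ⊆ P.annulus c₁ c₂ i κ ∧
      P.Ham i (γ 0) = c₁ i ∧ P.Ham i (γ 1) = c₂ i := by
  obtain ⟨γ, -, hr, hsub, h0, h1⟩ := h
  refine ⟨fun s => γ (projIcc 0 1 zero_le_one s), γ.continuous.comp continuous_projIcc,
    fun s => hr ▸ mem_range_self _, hsub, ?_, ?_⟩
  · simpa using h0
  · simpa using h1

/-- Opposite quadrants meet only at the origin, where the energy vanishes, while it is at least `c₁
i > 0` in the annulus. -/
theorem quadrant_unique {c₁ c₂ : Fin (m + 1) → ℝ} {i : Fin (m + 1)} (h0 : 0 < c₁ i)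
    {κ κ' : Quadrant} {z : ℝ × ℝ} (hz : z ∈ P.annulus c₁ c₂ i κ) (hz' : z ∈ P.annulus c₁ c₂ i κ')
    (h : (κ = .I ∨ κ = .III) ∧ (κ' = .I ∨ κ' = .III) ∨
      (κ = .II ∨ κ = .IV) ∧ (κ' = .II ∨ κ' = .IV)) : κ = κ' := by
  by_contra hne
  have hz0 : z.1 = 0 ∧ z.2 = 0 := by
    have h1 := hz.1
    have h2 := hz'.1
    rcases h with ⟨rfl | rfl, rfl | rfl⟩ | ⟨rfl | rfl, rfl | rfl⟩
    all_goals first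
      | exact absurd rfl hne
      | exact ⟨le_antisymm h1.1 h2.1, le_antisymm h1.2 h2.2⟩
      | exact ⟨le_antisymm h2.1 h1.1, le_antisymm h2.2 h1.2⟩
      | exact ⟨le_antisymm h1.1 h2.1, le_antisymm h2.2 h1.2⟩
      | exact ⟨le_antisymm h2.1 h1.1, le_antisymm h1.2 h2.2⟩
  have h3 := h0.trans_le hz.2.2.1
  rw [Ham, hz0.1, hz0.2, P.H_zero, P.F_zero, add_zero] at h3
  exact lt_irrefl _ h3

theorem LapCount.unique {i : Fin (m + 1)} {κ ω : Quadrant} (hκ : κ = .I ∨ κ = .III)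
    (hω : ω = .II ∨ ω = .IV) {n n' : ℕ} {u : ℝ → ℝ × ℝ} (h : P.LapCount i κ ω n u)
    (h' : P.LapCount i κ ω n' u) : n = n' := by
  have hor : ω = κ.prev ∨ ω = κ.next := by
    rcases hκ with rfl | rfl <;> rcases hω with rfl | rfl <;> simp [Quadrant.prev, Quadrant.next]
  rcases hor with h1 | h1
  -- The zeros of `y` are used here: their number `2 * n` is injective in `n`, while the truncated
  -- `2 * n - 1` does not separate `0` from other values in every arithmetic reading without the
  -- bound `1 ≤ n`.
  · have h2 := (h.1 h1).2.symm.trans (h'.1 h1).2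
    norm_cast at h2
    omega
  · have h2 := (h.2 h1).1.symm.trans (h'.2 h1).1
    norm_cast at h2
    omega

/-- The positions at `t i` and `s i` determine the quadrants, and then the zero counts determine the
counters. -/
theorem Follows.unique {c₁ c₂ : Fin (m + 1) → ℝ} (h0 : ∀ i, 0 < c₁ i) {κ₀ κL : Quadrant}
    {α β : Fin (m + 1) → ℕ} {ι ι' : Itinerary m κ₀ κL α β} {u v : ℝ → ℝ × ℝ}
    (hu : P.Follows c₁ c₂ ι u) (hv : P.Follows c₁ c₂ ι' v) (huv : ∀ r ∈ Icc 0 P.L, u r = v r) :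
    ι = ι' := by
  have ht : ∀ i, u (P.t i) = v (P.t i) := fun i =>
    huv _ (P.Icc_subset i (left_mem_Icc.2 (P.t_lt_s i).le))
  have hs : ∀ i, u (P.s i) = v (P.s i) := fun i =>
    huv _ (P.Icc_subset i (right_mem_Icc.2 (P.t_lt_s i).le))
  have e1 : ι.entry = ι'.entry := funext fun i => quadrant_unique (h0 i) (hu.1 i).1
    (ht i ▸ (hv.1 i).1) (Or.inl ⟨ι.entry_mem i, ι'.entry_mem i⟩)
  have e2 : ι.exit = ι'.exit := funext fun i => quadrant_unique (h0 i) (hu.1 i).2.1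
    (hs i ▸ (hv.1 i).2.1) (Or.inr ⟨ι.exit_mem i, ι'.exit_mem i⟩)
  have e3 : ι.lap = ι'.lap := funext fun i => by
    have l1 : P.LapCount i (ι.entry i) (ι.exit i) (α i + ι.lap i) u := (hu.1 i).2.2
    have l2 : P.LapCount i (ι'.entry i) (ι'.exit i) (α i + ι'.lap i) v := (hv.1 i).2.2
    rw [← e1, ← e2] at l2
    have := l1.unique (ι.entry_mem i) (ι.exit_mem i)
      (l2.congr fun r hr => huv r (P.Icc_subset i hr))
    omega
  cases ι
  cases ι'
  simp_all

end SwitchedSystem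

/-! ### Counting itineraries, and the theorem. -/

namespace Itinerary

variable {m : ℕ} {κ₀ κL : Quadrant} {α β : Fin (m + 1) → ℕ}

/-- The itinerary with prescribed exits into the gaps and prescribed counters. -/
def ofChoices (hκ₀ : κ₀ = .I ∨ κ₀ = .III) (hκL : κL = .II ∨ κL = .IV)
    (x : (Fin m → Bool) × ∀ i, Fin (β i - α i)) : Itinerary m κ₀ κL α β :=
  let ex : Fin (m + 1) → Quadrant :=
    Fin.lastCases (motive := fun _ => Quadrant) κL fun i => bif x.1 i then .II else .IV
  have hex : ∀ i, ex i = .II ∨ ex i = .IV := fun i => by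
    induction i using Fin.lastCases with
    | last => simpa [ex] using hκL
    | cast i => cases h : x.1 i <;> simp [ex, h]
  { entry := Fin.cases κ₀ fun i => (ex i.castSucc).next
    exit := ex
    lap := fun i => x.2 i + 1
    entry_mem := fun i => by
      induction i using Fin.cases with
      | zero => exact hκ₀
      | succ i => rcases hex i.castSucc with h | h <;> simp [h, Quadrant.next]
    exit_mem := hex
    entry_zero := rfl
    exit_last := by simp [ex]
    link := fun _ => rfl
    lap_pos := fun _ => Nat.le_add_left _ _
    lap_le := fun i => (x.2 i).isLt }

theorem ofChoices_injective (hκ₀ : κ₀ = .I ∨ κ₀ = .III) (hκL : κL = .II ∨ κL = .IV) :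
    Function.Injective (ofChoices (m := m) (α := α) (β := β) hκ₀ hκL) := by
  intro x y h
  refine Prod.ext (funext fun i => ?_) (funext fun i => ?_)
  · have h1 := congrFun (congrArg Itinerary.exit h) i.castSucc
    cases hx : x.1 i <;> cases hy : y.1 i <;> simp [ofChoices, hx, hy] at h1 ⊢
  · have h1 := congrFun (congrArg Itinerary.lap h) i
    exact Fin.ext (Nat.succ_injective h1)

end Itinerary

end SturmLiouville

theorem theorem6p3 {m : ℕ} (P : SturmLiouville.SwitchedSystem m) (hlam : 0 < P.lam)
    -- the annuli, contained in the domain of the system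
    (c₁ c₂ : Fin (m + 1) → ℝ)
    (hc : ∀ i, 0 < c₁ i ∧ c₁ i < c₂ i ∧ ((c₂ i : ℝ) : EReal) < P.Hstar)
    -- the twist conditions
    (α β : Fin (m + 1) → ℕ) (hαβ : ∀ i, α i < β i)
    (d e : Fin (m + 1) → ℝ)
    (hde : ∀ i, (d i = c₁ i ∧ e i = c₂ i) ∨ (d i = c₂ i ∧ e i = c₁ i))
    (htwist : ∀ i, P.Twist i .I (α i) (β i) (d i) (e i) ∧
      P.Twist i .III (α i) (β i) (d i) (e i))
    -- the compatibility and transition conditions on the gaps, for II → I and for IV → III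
    (hlink : ∀ i : Fin m, P.LinkedTwist P.SUpper c₁ c₂ i ∧ P.LinkedTwist P.SLower c₁ c₂ i)
    -- the boundary arcs
    (κ₀ κL : SturmLiouville.Quadrant)
    (hκ₀ : κ₀ = .I ∨ κ₀ = .III) (hκL : κL = .II ∨ κL = .IV)
    (r₀ rL : Set (ℝ × ℝ))
    (hr₀ : P.IsLinkingArc c₁ c₂ 0 κ₀ r₀) (hrL : P.IsLinkingArc c₁ c₂ (Fin.last m) κL rL) :
    -- at least `2 ^ m * ∏ (β i - α i)` solutions, as functions on `[0, L]`
    ((2 ^ m * ∏ i, (β i - α i) : ℕ) : ℕ∞) ≤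
      ((Set.Icc 0 P.L).domRestrict '' {u | P.IsBVPSolution r₀ rL u}).encard ∧
    -- one for each admissible itinerary, different for different itineraries
    ∃ u : SturmLiouville.Itinerary m κ₀ κL α β → ℝ → ℝ × ℝ,
      Function.Injective (fun ι => (Set.Icc 0 P.L).domRestrict (u ι)) ∧
      ∀ ι, P.IsBVPSolution r₀ rL (u ι) ∧ P.Follows c₁ c₂ ι (u ι) := by
  have h0 : ∀ i, 0 < c₁ i := fun i => (hc i).1
  have h12 : ∀ i, c₁ i < c₂ i := fun i => (hc i).2.1
  -- One truncation at the largest outer level serves all annuli and, as compatible levels lie below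
  -- the inner ones, all gaps.
  obtain ⟨i₀, hi₀⟩ := Finite.exists_max c₂
  obtain ⟨D, hD⟩ := P.exists_trunc hlam ((h0 i₀).trans (h12 i₀)) (hc i₀).2.2
  have hC : ∀ i, c₂ i ≤ D.C := fun i => (hi₀ i).trans_eq hD.symm
  obtain ⟨γ, hγ, hγr, hr₀', hγ0, hγ1⟩ := SturmLiouville.SwitchedSystem.exists_param hr₀
  obtain ⟨η, hη, hηr, hrL', hη0, hη1⟩ := SturmLiouville.SwitchedSystem.exists_param hrL
  have hL : 0 ≤ P.L := by
    have h := P.Icc_subset 0 (left_mem_Icc.2 (P.t_lt_s 0).le)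
    exact h.1.trans h.2
  have key : ∀ ι : SturmLiouville.Itinerary m κ₀ κL α β,
      ∃ u, P.IsBVPSolution r₀ rL u ∧ P.Follows c₁ c₂ ι u := by
    intro ι
    obtain ⟨a, b, ha, hab, hb, δ, hδc, hδ, hδe⟩ := D.exists_path h0 h12 hC hde htwist hlink
      ι.entry_mem ι.exit_mem ι.link (n := fun i => α i + ι.lap i)
      (fun i => ⟨by have := ι.lap_pos i; omega, by have := ι.lap_le i; have := hαβ i; omega⟩)
      hγ.continuousOn (fun s _ => by rw [ι.entry_zero]; exact hr₀' (hγr s)) ⟨hγ0, hγ1⟩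
      (Fin.last m)
    -- The stretched path joins the axes in the last exit quadrant and `rL` joins the boundaries
    -- there, so they meet; the parameter of the meeting point selects the solution.
    obtain ⟨s, hs, t, ht, hst⟩ := D.exists_inter (Fin.last m) (h0 _) (hC _) hκL hab.le hδc
      hη.continuousOn (fun s hs => ι.exit_last ▸ (hδ s hs).1) (fun s _ => hrL' (hηr s)) hδe hη0 hη1
    obtain ⟨-, -, u, hu, hu0, hu1, hul⟩ := hδ s hs
    rw [P.s_last] at hu hu1
    exact ⟨u, ⟨hu.isSolution hL, hu0 ▸ hγr s, by rw [hu1, hst]; exact hηr t⟩,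
      fun i => hul.1 i (Fin.le_last i), fun i => hul.2 i (Fin.le_last _)⟩
  choose u hu using key
  have hinj : Function.Injective (fun ι => (Set.Icc 0 P.L).domRestrict (u ι)) :=
    fun ι ι' h => (hu ι).2.unique h0 (hu ι').2 fun r hr => congrFun h ⟨r, hr⟩
  refine ⟨?_, u, hinj, hu⟩
  -- The free exits into the `m` gaps and the counters inject into the itineraries, and these into
  -- the solutions.
  have h1 := (hinj.comp (SturmLiouville.Itinerary.ofChoices_injective hκ₀ hκL)).encard_range
  have h2 : ENat.card ((Fin m → Bool) × ∀ i, Fin (β i - α i)) =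
      ((2 ^ m * ∏ i, (β i - α i) : ℕ) : ℕ∞) := by
    simp [ENat.card_eq_coe_fintype_card]
  rw [← h2]
  refine h1.trans (encard_le_encard ?_)
  rintro _ ⟨x, rfl⟩
  exact ⟨_, (hu _).1, rfl⟩
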